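/- Consider a cell that is a disk of radius $R>0$ centred at a base station (BS) with $M$ antennas, serving $K$ single-antenna users (UEs) at $x_1,\dots,x_K$, with $1\le K<M$. The UEs outside the cell that reuse the $k$-th pilot are the points of $\Phi_k$, and $\Phi=\bigcup_{k}\Phi_k$. The points $x_1,\dots,x_K$ are uniform in the disk, $\Phi_1,\dots,\Phi_K$ are homogeneous Poisson point processes of intensity $\lambda$ outside the disk with $\lambda\pi R^2=1$, and all of these are mutually independent. There is no shadowing and no noise: the large-scale gain of a UE at $x$ is $\beta_x=p_x$, where $p_x=A_0$ for $|x|<d_0$ and $p_x=A_0(|x|/d_0)^{-\gamma}$ for $|x|\ge d_0$, with $A_0>0$, $\gamma>2$ and $0<d_0\le R$. Put $l=d_0/R$. The channel of the UE at $y$ is $\mathbf g_y=\sqrt{\beta_y}\,\mathbf h_y$, where the $\mathbf h_y\sim\mathcal{CN}(0,\mathbf I_M)$ are independent. For $y\in\{x_k\}\cup\Phi_k$ let $\alpha_k=\beta_{x_k}+\sum_{x\in\Phi_k}\beta_x$, $C_y=\beta_y/\alpha_k$, $\widehat{\mathbf g}_y=C_y\bigl(\mathbf g_{x_k}+\sum_{x\in\Phi_k}\mathbf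 g_x\bigr)$ (the series converging in $L^2$) and $\widetilde{\mathbf g}_y=\mathbf g_y-\widehat{\mathbf g}_y$. Let $\widehat{\mathbf G}_0=[\widehat{\mathbf g}_{x_1},\dots,\widehat{\mathbf g}_{x_K}]$. The zero-forcing (ZF) receiver is $\mathbf w_k^{\mathrm{ZF}}=\widehat{\mathbf G}_0\bigl((\widehat{\mathbf G}_0^{\mathrm H}\widehat{\mathbf G}_0)^{-1}\bigr)_k$, where $(\cdot)_k$ is the $k$-th column, and the maximum ratio combining (MRC) receiver is $\mathbf w_k^{\mathrm{MRC}}=\sqrt{\alpha_k/M}\,\widehat{\mathbf g}_{x_k}/\|\widehat{\mathbf g}_{x_k}\|$. With $\mathbb E_{\mathbf h}$ the expectation over the small-scale fading only, the interference powers for the UE at $x_k$, normalized to a useful signal power $\beta_{x_k}^2$ and with pilot contamination accounted for separately, are (with $\mathbf w_k=\mathbf w_k^{\mathrm{ZF}}$ in the first two lines) $$I_{\mathrm{intra}}^{\mathrm{ZF}}=\beta_{x_k}^2\,\mathbb E_{\mathbf h}\Bigl\{\sum_{k'\ne k}|\mathbf w_k^{\mathrm H}\mathbf g_{x_{k'}}|^2+|\mathbf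 w_k^{\mathrm H}\widetilde{\mathbf g}_{x_k}|^2\Bigr\},$$ $$I_{\mathrm{inter}}^{\mathrm{ZF}}=\beta_{x_k}^2\,\mathbb E_{\mathbf h}\Bigl\{\sum_{y\in\Phi\setminus\Phi_k}|\mathbf w_k^{\mathrm H}\mathbf g_y|^2+\sum_{y\in\Phi_k}|\mathbf w_k^{\mathrm H}\widetilde{\mathbf g}_y|^2\Bigr\},$$ $$I_{\mathrm{inter}}^{\mathrm{MRC}}=\mathbb E_{\mathbf h}\Bigl\{\sum_{y\in\Phi\setminus\Phi_k}|(\mathbf w_k^{\mathrm{MRC}})^{\mathrm H}\mathbf g_y|^2\Bigr\}+\frac{\alpha_k}{M}\sum_{y\in\Phi_k}\beta_y .$$ Define the bounding random variables $$I_{\mathrm{intra}}^{\mathrm{ZF,u}}=\frac{M}{M-K}I_{\mathrm{inter}}^{\mathrm{MRC}},\qquad I_{\mathrm{intra}}^{\mathrm{ZF,l}}=\frac{\beta_{x_k}\sum_{x\in\Phi_k}\beta_x}{M-K}+\frac{\beta_{x_k}+\sum_{x\in\Phi_k}\beta_x}{M-K}\sum_{k'\ne k}\Bigl(\sum_{y\in\Phi_{k'}}\beta_y-\frac{\bigl(\sum_{y\in\Phi_{k'}}\beta_y\bigr)^2}{\beta_{x_{k'}}}\Bigr).$$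 Then, for every $k$, the expectations over the locations of the UEs satisfy $$\mathbb E[I_{\mathrm{intra}}^{\mathrm{ZF,l}}]\le\mathbb E[I_{\mathrm{intra}}^{\mathrm{ZF}}]<\mathbb E[I_{\mathrm{inter}}^{\mathrm{ZF}}]<\mathbb E[I_{\mathrm{intra}}^{\mathrm{ZF,u}}]<\infty,$$ where the first inequality is strict if $K\ge2$, and $$\mathbb E[I_{\mathrm{intra}}^{\mathrm{ZF,l}}]=\frac{2K\gamma l^{\gamma+2}A_0^2}{(M-K)(\gamma-2)^2}\Bigl\{1-\frac{2l^{\gamma-2}}{K\gamma}-\frac{K-1}{2K(\gamma+2)}\bigl[2+\gamma l^{\gamma+2}\bigr]\Bigl[\frac{\gamma-2}{\gamma-1}+\frac{4}{\gamma-2}\Bigr]\Bigr\},$$ $$\mathbb E[I_{\mathrm{intra}}^{\mathrm{ZF,u}}]=\frac{2K\gamma l^{\gamma+2}A_0^2}{(M-K)(\gamma-2)^2}+\frac{l^{2\gamma}A_0^2}{(M-K)(\gamma-1)}.$$ -/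

import Mathlib

open MeasureTheory ProbabilityTheory
open scoped ENNReal NNReal Matrix

namespace UplinkMIMO

/-! ### Small-scale fading, channel estimation and linear receivers, for fixed large-scale gains

There are `K` pilots. Pilot `k` is used by one UE inside the cell (`⟨k, none⟩`) and by the UEs
`⟨k, some y⟩`, `y : ι k`, outside the cell. `β u` is the large-scale gain of UE `u`. -/

section Fading

/-- All UEs, labelled by the pilot that they use. -/
abbrev UE {K : ℕ} (ι : Fin K → Type) : Type := (k : Fin K) × Option (ι k)

/-- The law `CN(0,1)`: independent real and imaginary parts, each `N(0,1/2)`. -/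
noncomputable def stdComplexGaussian : Measure ℂ :=
  ((gaussianReal 0 (1 / 2)).prod (gaussianReal 0 (1 / 2))).map
    (fun p : ℝ × ℝ => (⟨p.1, p.2⟩ : ℂ))

theorem measurable_complex_mk : Measurable (fun p : ℝ × ℝ => (⟨p.1, p.2⟩ : ℂ)) :=
  Complex.measurableEquivRealProd.symm.measurable

instance : IsProbabilityMeasure stdComplexGaussian :=
  Measure.isProbabilityMeasure_map measurable_complex_mk.aemeasurable

/-- The law of the small-scale fading: all entries of all vectors `h_u ∈ ℂ^M` are
independent `CN(0,1)`. -/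
noncomputable def fadingMeasure {K : ℕ} (ι : Fin K → Type) (M : ℕ) :
    Measure (UE ι × Fin M → ℂ) :=
  Measure.infinitePi (fun _ => stdComplexGaussian)

theorem memLp_stdComplexGaussian : MemLp (fun z : ℂ => z) 2 stdComplexGaussian := by
  have hre : MemLp (fun p : ℝ × ℝ => p.1) 2
      ((gaussianReal 0 (1 / 2)).prod (gaussianReal 0 (1 / 2))) :=
    (memLp_id_gaussianReal (μ := 0) (v := 1 / 2) 2).comp_fst _
  have him : MemLp (fun p : ℝ × ℝ => p.2) 2
      ((gaussianReal 0 (1 / 2)).prod (gaussianReal 0 (1 / 2))) :=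
    (memLp_id_gaussianReal (μ := 0) (v := 1 / 2) 2).comp_snd _
  refine (memLp_map_measure_iff (by fun_prop) measurable_complex_mk.aemeasurable).2 ?_
  have hsum := hre.norm.add him.norm
  refine hsum.mono measurable_complex_mk.aestronglyMeasurable (Filter.Eventually.of_forall ?_)
  intro p
  have h := Complex.norm_le_abs_re_add_abs_im (⟨p.1, p.2⟩ : ℂ)
  have h0 : 0 ≤ |p.1| + |p.2| := by positivity
  simpa [abs_of_nonneg h0] using h

theorem memLp_fading {K : ℕ} (ι : Fin K → Type) (M : ℕ) (i : UE ι × Fin M) :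
    MemLp (fun h : UE ι × Fin M → ℂ => h i) 2 (fadingMeasure ι M) :=
  memLp_stdComplexGaussian.comp_measurePreserving
    (measurePreserving_eval_infinitePi (fun _ : UE ι × Fin M => stdComplexGaussian) i)

variable {K : ℕ} {ι : Fin K → Type} (M : ℕ) (β : UE ι → ℝ)

/-- Entry `m` of the channel vector `g_u = √β_u h_u`, as an element of `L²`. -/
noncomputable def channel (u : UE ι) (m : Fin M) : Lp ℂ 2 (fadingMeasure ι M) :=
  (Real.sqrt (β u) : ℂ) • (memLp_fading ι M (u, m)).toLp

/-- Entry `m` of the noiseless pilot observation `g_{x_k} + ∑_{x ∈ Φ_k} g_x`; the sum over the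
(usually infinitely many) pilot-sharing UEs is an unconditional sum in `L²`. -/
noncomputable def pilotObservation (k : Fin K) (m : Fin M) : Lp ℂ 2 (fadingMeasure ι M) :=
  channel M β ⟨k, none⟩ m + ∑' y : ι k, channel M β ⟨k, some y⟩ m

/-- `α_k = β_{x_k} + ∑_{x ∈ Φ_k} β_x`. -/
noncomputable def alpha (k : Fin K) : ℝ :=
  β ⟨k, none⟩ + ∑' y : ι k, β ⟨k, some y⟩

/-- The MMSE normalization factor `C_u = β_u / α_k` of a UE `u` with pilot `k`. -/
noncomputable def mmseCoeff (u : UE ι) : ℝ := β u / alpha β u.1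

/-- Entry `m` of the linear MMSE channel estimate `ĝ_u`. -/
noncomputable def estimate (u : UE ι) (m : Fin M) : Lp ℂ 2 (fadingMeasure ι M) :=
  (mmseCoeff β u : ℂ) • pilotObservation M β u.1 m

/-- The channel vector `g_u` at a realization `h` of the fading. -/
noncomputable def channelVec (u : UE ι) (h : UE ι × Fin M → ℂ) : Fin M → ℂ :=
  fun m => channel M β u m h

/-- The estimated channel vector `ĝ_u` at a realization `h` of the fading. -/
noncomputable def estimateVec (u : UE ι) (h : UE ι × Fin M → ℂ) : Fin M → ℂ :=
  fun m => estimate M β u m h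

/-- The estimation error `g_u - ĝ_u` at a realization `h` of the fading. -/
noncomputable def errorVec (u : UE ι) (h : UE ι × Fin M → ℂ) : Fin M → ℂ :=
  channelVec M β u h - estimateVec M β u h

/-- The `M × K` matrix `Ĝ₀` whose columns are the estimates of the intra-cell channels. -/
noncomputable def estimateMatrix (h : UE ι × Fin M → ℂ) : Matrix (Fin M) (Fin K) ℂ :=
  Matrix.of fun m k => estimateVec M β ⟨k, none⟩ h m

/-- The MRC receiver `√(α_k / M) ĝ_{x_k} / ‖ĝ_{x_k}‖` (Euclidean norm). -/
noncomputable def mrcReceiver (k : Fin K) (h : UE ι × Fin M → ℂ) : Fin M → ℂ :=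
  ((Real.sqrt (alpha β k / M) /
      Real.sqrt (∑ m, ‖estimateVec M β ⟨k, none⟩ h m‖ ^ 2) : ℝ) : ℂ) •
    estimateVec M β ⟨k, none⟩ h

/-- The ZF receiver `Ĝ₀ ((Ĝ₀ᴴ Ĝ₀)⁻¹)_k`, where the index `k` denotes the `k`-th column. -/
noncomputable def zfReceiver (k : Fin K) (h : UE ι × Fin M → ℂ) : Fin M → ℂ :=
  estimateMatrix M β h *ᵥ
    fun j => ((estimateMatrix M β h)ᴴ * estimateMatrix M β h)⁻¹ j k

/-- The received power `|wᴴ v|²`. -/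
noncomputable def rxPower {M : ℕ} (w v : Fin M → ℂ) : ℝ≥0∞ :=
  ENNReal.ofReal (‖star w ⬝ᵥ v‖ ^ 2)

/-- Intra-cell interference power of ZF for the UE `x_k`, averaged over the small-scale fading and
normalized so that the useful signal power is `β_{x_k}²`. -/
noncomputable def intraZF (k : Fin K) : ℝ≥0∞ :=
  ENNReal.ofReal (β ⟨k, none⟩ ^ 2) *
    ∫⁻ h, (∑ k' ∈ Finset.univ.erase k,
          rxPower (zfReceiver M β k h) (channelVec M β ⟨k', none⟩ h)
        + rxPower (zfReceiver M β k h) (errorVec M β ⟨k, none⟩ h)) ∂(fadingMeasure ι M)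

/-- Inter-cell interference power of ZF for the UE `x_k`, with the same averaging and
normalization. For a UE that reuses pilot `k`, only the error part of its channel is counted; the
rest is the pilot contamination, a separate quantity. -/
noncomputable def interZF (k : Fin K) : ℝ≥0∞ :=
  ENNReal.ofReal (β ⟨k, none⟩ ^ 2) *
    ∫⁻ h, (∑ k' ∈ Finset.univ.erase k, ∑' y : ι k',
          rxPower (zfReceiver M β k h) (channelVec M β ⟨k', some y⟩ h)
        + ∑' y : ι k,
          rxPower (zfReceiver M β k h) (errorVec M β ⟨k, some y⟩ h)) ∂(fadingMeasure ι M)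

/-- Inter-cell interference power of MRC for the UE `x_k`, averaged over the small-scale fading.
The UEs that reuse pilot `k` contribute `(α_k / M) ∑_{y ∈ Φ_k} β_y`; the rest of their power is
the pilot contamination, a separate quantity. -/
noncomputable def interMRC (k : Fin K) : ℝ≥0∞ :=
  (∫⁻ h, (∑ k' ∈ Finset.univ.erase k, ∑' y : ι k',
      rxPower (mrcReceiver M β k h) (channelVec M β ⟨k', some y⟩ h)) ∂(fadingMeasure ι M))
    + ENNReal.ofReal (alpha β k / M * ∑' y : ι k, β ⟨k, some y⟩)

/-- The random variable `I_intra^{ZF,u} = M / (M - K) · I_inter^{MRC}`. -/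
noncomputable def upperZF (k : Fin K) : ℝ≥0∞ :=
  ENNReal.ofReal ((M : ℝ) / ((M : ℝ) - (K : ℝ))) * interMRC M β k

/-- The random variable `I_intra^{ZF,l}`. It comes from the intra-cell interference on replacing
`r t / (r + t)` by `(r - t) t / r` for each pilot `k' ≠ k`, where `r = β_{x_{k'}}` and
`t = ∑_{y ∈ Φ_{k'}} β_y`. -/
noncomputable def lowerZF (k : Fin K) : ℝ :=
  β ⟨k, none⟩ * (∑' y : ι k, β ⟨k, some y⟩) / ((M : ℝ) - (K : ℝ))
    + (β ⟨k, none⟩ + ∑' y : ι k, β ⟨k, some y⟩) / ((M : ℝ) - (K : ℝ)) *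
      ∑ k' ∈ Finset.univ.erase k,
        ((∑' y : ι k', β ⟨k', some y⟩)
          - (∑' y : ι k', β ⟨k', some y⟩) ^ 2 / β ⟨k', none⟩)

end Fading

/-! ### Locations of the UEs and path loss -/

section Geometry

/-- The plane. -/
abbrev Plane : Type := EuclideanSpace ℝ (Fin 2)

/-- The path loss model: `A₀` for `|x| < d₀`, and `A₀ (|x|/d₀)^{-γ}` for `|x| ≥ d₀`. -/
noncomputable def pathLoss (A₀ d₀ γ : ℝ) (x : Plane) : ℝ :=
  if ‖x‖ < d₀ then A₀ else A₀ * (‖x‖ / d₀) ^ (-γ)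

/-- The large-scale gains, without shadowing, when the intra-cell UEs are located at `x k` and the
UEs that reuse pilot `k` outside the cell at the points of `φ k`. -/
noncomputable def gain (A₀ d₀ γ : ℝ) {K : ℕ} (x : Fin K → Plane) (φ : Fin K → Set Plane) :
    UE (fun k => ↥(φ k)) → ℝ
  | ⟨k, none⟩ => pathLoss A₀ d₀ γ (x k)
  | ⟨_, some y⟩ => pathLoss A₀ d₀ γ y

variable {Ω : Type*} [MeasurableSpace Ω]

/-- The random set `Φ` is a Poisson point process with intensity measure `Λ`. -/
structure IsPoissonPointProcess (μ : Measure Ω) (Φ : Ω → Set Plane) (Λ : Measure Plane) :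
    Prop where
  measurable_count : ∀ B : Set Plane, MeasurableSet B → Measurable fun ω => (Φ ω ∩ B).encard
  law_count : ∀ B : Set Plane, MeasurableSet B → Λ B ≠ ∞ →
    μ.map (fun ω => (Φ ω ∩ B).encard)
      = (poissonMeasure (Λ B).toNNReal).map (fun n : ℕ => (n : ℕ∞))
  indep_count : ∀ (n : ℕ) (B : Fin n → Set Plane), (∀ i, MeasurableSet (B i)) →
    Pairwise (Function.onFun Disjoint B) → iIndepFun (fun i ω => (Φ ω ∩ B i).encard) μ

/-- The σ-algebra generated by the random set `Φ` (by all its counts in Borel sets). -/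
noncomputable abbrev pointProcessSigma (Φ : Ω → Set Plane) : MeasurableSpace Ω :=
  ⨆ (B : Set Plane) (_ : MeasurableSet B),
    MeasurableSpace.comap (fun ω => (Φ ω ∩ B).encard) inferInstance

/-- The spatial model: `x k`, `k < K`, are uniform in the disk of radius `R`; `Φ k`, `k < K`, are
homogeneous Poisson point processes of intensity `lam` outside this disk; all these random
objects are mutually independent. -/
structure IsSpatialModel (μ : Measure Ω) {K : ℕ} (R lam : ℝ) (x : Fin K → Ω → Plane)
    (Φ : Fin K → Ω → Set Plane) : Prop where
  measurable_intra : ∀ k, Measurable (x k)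
  uniform_intra : ∀ k, pdf.IsUniform (x k) (Metric.closedBall (0 : Plane) R) μ volume
  poisson_inter : ∀ k, IsPoissonPointProcess μ (Φ k)
    (ENNReal.ofReal lam • (volume : Measure Plane).restrict (Metric.closedBall (0 : Plane) R)ᶜ)
  indep : iIndep (Sum.elim (fun k : Fin K => MeasurableSpace.comap (x k) inferInstance)
    (fun k : Fin K => pointProcessSigma (Φ k))) μ

end Geometry

end UplinkMIMO

/-! Fix the locations first. Channel entries, pilot observations and estimation errors all lie in
the closed span of independent `CN(0,1)` coordinates, a Gaussian Hilbert space in which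
orthogonality is independence (`map_orthonormal_eq_gaussianFamily`,
`lintegral_rxPower_of_orthogonal`). The observation on pilot k is white with variance α_k per entry;
the error of a UE u is orthogonal to every observation and has variance e_u = β_u - β_u²/α. The ZF
receiver is a function of the observations only, so its mean power against an error is e_u E‖w_k‖².
Against a UE on another pilot it sees only the error too, because all estimates on one pilot are
proportional and ZF nulls one of them. Finally ‖w_k‖⁻² is, up to scale, the squared length of the
projection of a Gaussian vector to a space of dimension M - K + 1, whence E‖w_k‖² = (α_k / β_{x_k}²)
/ (M - K) (`lintegral_sum_normSq_zfVec`).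

For a pilot write r for the in-cell gain, t for the sum and s for the sum of squares of the outer
gains. Each power becomes α_k / (M - K) times a sum over pilots, of r t / (r + t) for the intra-cell
power, t - s / (r + t) for the inter-cell power, and t for the upper variable (`intraZF_eq`,
`interZF_eq`, `upperZF_eq`). The comparisons are s ≤ t², s ≥ 0, and r t / (r + t) - (t - t² / r) =
t³ / (r (r + t)) ≥ 0. They are strict when the relevant pilots have two outer UEs, an event of
positive probability (`measure_two_points_ne_zero`).

For the two closed forms, the bounding variables are polynomials in r, t and 1/r, and distinct r's
and t's are independent. Only four numbers are needed: E t and E t², from the first and second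
Campbell formulas, and E r and E 1/r, which are radial integrals over the disk. -/

namespace UplinkMIMO

/-! ### Complex Gaussian variables and the Gaussian Hilbert space. -/

section ComplexGaussian

open Complex

theorem charFun_stdComplexGaussian (t : ℂ) :
    charFun stdComplexGaussian t = cexp (-(‖t‖ ^ 2 / 4 : ℝ)) := by
  have hsplit : ∀ p : ℝ × ℝ, cexp ((inner ℝ (⟨p.1, p.2⟩ : ℂ) t : ℝ) * I)
      = cexp ((p.1 * t.re : ℝ) * I) * cexp ((p.2 * t.im : ℝ) * I) := by
    intro p
    rw [← Complex.exp_add, ← add_mul, ← Complex.ofReal_add]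
    congr 3
    simp [Complex.inner, Complex.mul_re]
    ring
  have hone : ∀ s : ℝ, ∫ x, cexp ((x * s : ℝ) * I) ∂(gaussianReal 0 (1 / 2))
      = cexp (-(s ^ 2 / 4 : ℝ)) := by
    intro s
    have h := charFun_gaussianReal (μ := 0) (v := 1 / 2) s
    rw [charFun_apply_real] at h
    have : ∀ x : ℝ, cexp ((x * s : ℝ) * I) = cexp (s * x * I) := by
      intro x; push_cast; ring_nf
    simp_rw [this]
    rw [h]
    push_cast
    ring_nf
  rw [charFun_apply, stdComplexGaussian, integral_map measurable_complex_mk.aemeasurable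
    (by fun_prop)]
  simp_rw [hsplit]
  rw [integral_prod_mul (fun x : ℝ => cexp ((x * t.re : ℝ) * I))
    (fun x : ℝ => cexp ((x * t.im : ℝ) * I)), hone, hone, ← Complex.exp_add]
  congr 1
  rw [← Complex.normSq_eq_norm_sq, Complex.normSq_apply]
  push_cast
  ring

theorem integral_id_stdComplexGaussian : ∫ z, z ∂stdComplexGaussian = 0 := by
  have hint : Integrable (fun z : ℂ => z) stdComplexGaussian :=
    memLp_stdComplexGaussian.integrable (by norm_num)
  have h1 : Integrable (fun x : ℝ => x) (gaussianReal 0 (1 / 2)) :=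
    (memLp_id_gaussianReal (μ := 0) (v := 1 / 2) 1).integrable le_rfl
  apply Complex.ext
  · rw [← reCLM_apply, ← reCLM.integral_comp_comm hint, stdComplexGaussian,
      integral_map measurable_complex_mk.aemeasurable (by fun_prop)]
    simp only [reCLM_apply, zero_re]
    rw [integral_fun_fst (f := fun x : ℝ => x)]
    simp
  · rw [← imCLM_apply, ← imCLM.integral_comp_comm hint, stdComplexGaussian,
      integral_map measurable_complex_mk.aemeasurable (by fun_prop)]
    simp only [imCLM_apply, zero_im]
    rw [integral_fun_snd (f := fun x : ℝ => x)]
    simp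

theorem integral_normSq_stdComplexGaussian : ∫ z : ℂ, ‖z‖ ^ 2 ∂stdComplexGaussian = 1 := by
  have h2 : Integrable (fun x : ℝ => x ^ 2) (gaussianReal 0 (1 / 2)) :=
    (memLp_id_gaussianReal (μ := 0) (v := 1 / 2) 2).integrable_sq
  have hv : ∫ x : ℝ, x ^ 2 ∂(gaussianReal 0 (1 / 2)) = 1 / 2 := by
    have h := variance_fun_id_gaussianReal (μ := 0) (v := 1 / 2)
    rw [variance_of_integral_eq_zero (by fun_prop) integral_id_gaussianReal] at h
    simpa using h
  rw [stdComplexGaussian, integral_map measurable_complex_mk.aemeasurable (by fun_prop)]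
  have : ∀ p : ℝ × ℝ, ‖(⟨p.1, p.2⟩ : ℂ)‖ ^ 2 = p.1 ^ 2 + p.2 ^ 2 := by
    intro p
    rw [← Complex.normSq_eq_norm_sq, Complex.normSq_apply]
    ring
  simp_rw [this]
  rw [integral_add (h2.comp_fst _) (h2.comp_snd _),
    integral_fun_fst (f := fun x : ℝ => x ^ 2), integral_fun_snd (f := fun x : ℝ => x ^ 2), hv]
  norm_num

variable (N : Type*)

/-- The law of a family of independent `CN(0,1)` random variables indexed by `N`. -/
noncomputable abbrev gaussianFamily : Measure (N → ℂ) :=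
  Measure.infinitePi (fun _ : N => stdComplexGaussian)

variable {N}

theorem memLp_gaussianFamily_eval (i : N) :
    MemLp (fun h : N → ℂ => h i) 2 (gaussianFamily N) :=
  memLp_stdComplexGaussian.comp_measurePreserving
    (measurePreserving_eval_infinitePi (fun _ : N => stdComplexGaussian) i)

/-- The coordinates of the Gaussian family, as elements of `L²`. -/
noncomputable def gaussianCoord (i : N) : Lp ℂ 2 (gaussianFamily N) :=
  (memLp_gaussianFamily_eval i).toLp

theorem gaussianCoord_coe (i : N) : gaussianCoord i =ᵐ[gaussianFamily N] fun h => h i :=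
  MemLp.coeFn_toLp _

theorem orthonormal_gaussianCoord :
    Orthonormal ℂ (gaussianCoord : N → Lp ℂ 2 (gaussianFamily N)) := by
  classical
  rw [orthonormal_iff_ite]
  intro i j
  rw [L2.inner_def]
  have hij : ∫ h, inner ℂ (gaussianCoord i h) (gaussianCoord j h) ∂(gaussianFamily N)
      = ∫ h : N → ℂ, starRingEnd ℂ (h i) * h j ∂(gaussianFamily N) := by
    refine integral_congr_ae ?_
    filter_upwards [gaussianCoord_coe i, gaussianCoord_coe j] with h hi hj
    rw [hi, hj]
    simp [RCLike.inner_apply, mul_comm]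
  rw [hij]
  split_ifs with h
  · subst h
    have hmp := measurePreserving_eval_infinitePi (fun _ : N => stdComplexGaussian) i
    have : ∀ z : ℂ, starRingEnd ℂ z * z = ((‖z‖ ^ 2 : ℝ) : ℂ) := by
      intro z
      rw [mul_comm, Complex.mul_conj, Complex.normSq_eq_norm_sq]
    simp_rw [this]
    rw [integral_complex_ofReal]
    have h1 := integral_map (μ := gaussianFamily N) (φ := fun h : N → ℂ => h i)
      (f := fun z : ℂ => ‖z‖ ^ 2) (measurable_pi_apply i).aemeasurable (by fun_prop)
    have h2 : (gaussianFamily N).map (fun h : N → ℂ => h i) = stdComplexGaussian := hmp.map_eq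
    rw [h2, integral_normSq_stdComplexGaussian] at h1
    rw [← h1]
    simp
  · have hind : iIndepFun (fun (i : N) (h : N → ℂ) => h i) (gaussianFamily N) :=
      iIndepFun_infinitePi (P := fun _ : N => stdComplexGaussian) (X := fun _ z => z)
        (fun _ => measurable_id)
    have hp := (hind.indepFun h).comp (φ := starRingEnd ℂ) (ψ := id)
      Complex.continuous_conj.measurable measurable_id
    have hmul := hp.integral_fun_mul_eq_mul_integral
      (Complex.continuous_conj.measurable.comp (measurable_pi_apply i)).aestronglyMeasurable
      (measurable_id.comp (measurable_pi_apply j)).aestronglyMeasurable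
    simp only [Function.comp_apply, id] at hmul
    rw [hmul]
    have h2 : (gaussianFamily N).map (fun h : N → ℂ => h j) = stdComplexGaussian :=
      (measurePreserving_eval_infinitePi (fun _ : N => stdComplexGaussian) j).map_eq
    have h1 := integral_map (μ := gaussianFamily N) (φ := fun h : N → ℂ => h j)
      (f := fun z : ℂ => z) (measurable_pi_apply j).aemeasurable
      (by fun_prop)
    rw [h2, integral_id_stdComplexGaussian] at h1
    rw [← h1, mul_zero]

/-- The closed linear span of the coordinates: a Gaussian Hilbert space. -/
noncomputable def gaussianSpace (N : Type*) : Submodule ℂ (Lp ℂ 2 (gaussianFamily N)) :=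
  (Submodule.span ℂ (Set.range gaussianCoord)).topologicalClosure

theorem gaussianCoord_mem (i : N) : gaussianCoord i ∈ gaussianSpace N :=
  Submodule.le_topologicalClosure _ (Submodule.subset_span ⟨i, rfl⟩)

/-- The exponential factors over the coordinates in `s`, and Re (a z) is the real inner product of z
with the conjugate of a, so each factor is a value of the one-variable characteristic function. -/
theorem integral_exp_re_finsetSum (s : Finset N) (a : N → ℂ) :
    ∫ h : N → ℂ, cexp (((∑ i ∈ s, a i * h i).re : ℝ) * Complex.I) ∂(gaussianFamily N)
      = cexp (-((∑ i ∈ s, ‖a i‖ ^ 2) / 4 : ℝ)) := by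
  have hone : ∀ a : ℂ, ∫ z, cexp (((a * z).re : ℝ) * Complex.I) ∂stdComplexGaussian
      = cexp (-(‖a‖ ^ 2 / 4 : ℝ)) := by
    intro a
    have h := charFun_stdComplexGaussian (starRingEnd ℂ a)
    rw [charFun_apply] at h
    rw [RCLike.norm_conj] at h
    rw [← h]
    congr with z
    congr 3
    simp [Complex.inner, Complex.mul_re]
  have h1 : ∀ h : N → ℂ, cexp (((∑ i ∈ s, a i * h i).re : ℝ) * Complex.I)
      = (fun y : s → ℂ => ∏ i : s, cexp (((a i * y i).re : ℝ) * Complex.I)) (s.restrict h) := by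
    intro h
    simp only [Finset.restrict]
    rw [← Complex.exp_sum, ← Finset.sum_mul]
    congr 2
    rw [Complex.re_sum]
    push_cast
    rw [← Finset.sum_coe_sort]
  rw [integral_congr_ae (Filter.Eventually.of_forall h1)]
  rw [integral_restrict_infinitePi (μ := fun _ : N => stdComplexGaussian)
      (f := fun y : s → ℂ => ∏ i : s, cexp (((a i * y i).re : ℝ) * Complex.I))
      (Measurable.aestronglyMeasurable (by fun_prop)),
    integral_fintype_prod_eq_prod (fun (i : s) (z : ℂ) => cexp (((a i * z).re : ℝ) * Complex.I))]
  simp_rw [hone]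
  rw [← Complex.exp_sum]
  congr 1
  push_cast
  rw [Finset.sum_neg_distrib, ← Finset.sum_div, ← Finset.sum_coe_sort s]

/-- The functional `Z ↦ E exp(i Re Z)` on `L²`. -/
noncomputable def expRe {α : Type*} [MeasurableSpace α] {ν : Measure α} (Z : Lp ℂ 2 ν) : ℂ :=
  ∫ h, cexp (((Z h).re : ℝ) * Complex.I) ∂ν

theorem norm_exp_mul_I_sub_le (x y : ℝ) :
    ‖cexp (x * Complex.I) - cexp (y * Complex.I)‖ ≤ |x - y| := by
  have h : cexp (x * Complex.I) - cexp (y * Complex.I)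
      = cexp (y * Complex.I) * (cexp (Complex.I * ((x - y : ℝ) : ℂ)) - 1) := by
    rw [mul_sub, ← Complex.exp_add]
    push_cast
    ring_nf
  rw [h, norm_mul, Complex.norm_exp_ofReal_mul_I, one_mul]
  exact Real.norm_exp_I_mul_ofReal_sub_one_le

/-- The map x ↦ exp(ix) is 1-Lipschitz, and the L¹ norm is at most the L² norm on a probability
space. The resulting continuity carries the Gaussian formula from finite combinations to L² limits.
-/
theorem dist_expRe_le {α : Type*} [MeasurableSpace α] {ν : Measure α} [IsProbabilityMeasure ν]
    (Z W : Lp ℂ 2 ν) : dist (expRe Z) (expRe W) ≤ dist Z W := by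
  have hm : ∀ Z : Lp ℂ 2 ν,
      Integrable (fun h => cexp (((Z h).re : ℝ) * Complex.I)) ν := by
    intro Z
    refine Integrable.of_bound (C := 1) ?_ ?_
    · have := (Lp.aestronglyMeasurable Z).aemeasurable
      exact AEMeasurable.aestronglyMeasurable (by fun_prop)
    · filter_upwards with h
      rw [Complex.norm_exp_ofReal_mul_I]
  have hZW : MemLp (⇑(Z - W)) 2 ν := Lp.memLp _
  rw [dist_eq_norm, dist_eq_norm, expRe, expRe, ← integral_sub (hm Z) (hm W)]
  have h1 : Integrable (fun h => ‖(Z - W) h‖) ν := (hZW.integrable (by norm_num)).norm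
  refine (norm_integral_le_integral_norm _).trans ?_
  have h2 : ∫ h, ‖cexp (((Z h).re : ℝ) * Complex.I) - cexp (((W h).re : ℝ) * Complex.I)‖ ∂ν
      ≤ ∫ h, ‖(Z - W) h‖ ∂ν := by
    refine integral_mono_ae ((hm Z).sub (hm W)).norm h1 ?_
    filter_upwards [Lp.coeFn_sub Z W] with h hh
    refine (norm_exp_mul_I_sub_le _ _).trans ?_
    rw [hh, ← Complex.sub_re]
    exact Complex.abs_re_le_norm _
  refine h2.trans ?_
  rw [integral_norm_eq_lintegral_enorm hZW.aestronglyMeasurable,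
    ← eLpNorm_one_eq_lintegral_enorm, Lp.norm_def]
  exact ENNReal.toReal_mono hZW.eLpNorm_ne_top
    (eLpNorm_le_eLpNorm_of_exponent_le (by norm_num) hZW.aestronglyMeasurable)

theorem norm_sq_sum_smul_of_orthonormal {E ι : Type*} [NormedAddCommGroup E]
    [InnerProductSpace ℂ E] {e : ι → E} (he : Orthonormal ℂ e) (s : Finset ι) (a : ι → ℂ) :
    ‖∑ i ∈ s, a i • e i‖ ^ 2 = ∑ i ∈ s, ‖a i‖ ^ 2 := by
  have h1 := he.inner_sum a a s
  have h2 : ((‖∑ i ∈ s, a i • e i‖ ^ 2 : ℝ) : ℂ) = ((∑ i ∈ s, ‖a i‖ ^ 2 : ℝ) : ℂ) := by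
    rw [Complex.ofReal_pow, Complex.ofReal_sum]
    refine (inner_self_eq_norm_sq_to_K (𝕜 := ℂ) _).symm.trans
      (h1.trans (Finset.sum_congr rfl fun i _ => ?_))
    rw [mul_comm, Complex.mul_conj, Complex.normSq_eq_norm_sq]
  exact_mod_cast h2

theorem Lp_coe_sum_smul {α ι : Type*} [MeasurableSpace α] {ν : Measure α} (s : Finset ι)
    (a : ι → ℂ) (e : ι → Lp ℂ 2 ν) :
    ⇑(∑ i ∈ s, a i • e i) =ᵐ[ν] fun h => ∑ i ∈ s, a i * e i h := by
  refine (Lp.coeFn_fun_finsetSum _ _).trans ?_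
  have : ∀ i ∈ s, ∀ᵐ h ∂ν, (a i • e i : Lp ℂ 2 ν) h = a i * e i h := by
    intro i _
    filter_upwards [Lp.coeFn_smul (a i) (e i)] with h h1
    rw [h1, Pi.smul_apply, smul_eq_mul]
  filter_upwards [(Filter.eventually_all_finset s).2 this] with h hh
  exact Finset.sum_congr rfl fun i hi => hh i hi

theorem gaussianCoord_coe_sum_smul (s : Finset N) (a : N → ℂ) :
    ⇑(∑ i ∈ s, a i • gaussianCoord i) =ᵐ[gaussianFamily N] fun h => ∑ i ∈ s, a i * h i := by
  filter_upwards [Lp_coe_sum_smul s a gaussianCoord,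
    (Filter.eventually_all_finset s).2 fun i _ => gaussianCoord_coe i] with h h1 h2
  rw [h1]
  exact Finset.sum_congr rfl fun i hi => by rw [h2 i hi]

/-- Both sides are continuous in Z and agree on finite combinations of coordinates, hence on the
closure. This is what makes the infinite sums over pilot-sharing UEs Gaussian. -/
theorem expRe_of_mem_gaussianSpace {Z : Lp ℂ 2 (gaussianFamily N)} (hZ : Z ∈ gaussianSpace N) :
    expRe Z = cexp (-(‖Z‖ ^ 2 / 4 : ℝ)) := by
  have hcont : Continuous (expRe : Lp ℂ 2 (gaussianFamily N) → ℂ) :=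
    (LipschitzWith.of_dist_le_mul (K := 1) (by simpa using dist_expRe_le)).continuous
  have hclosed : IsClosed {Z : Lp ℂ 2 (gaussianFamily N) |
      expRe Z = cexp (-(‖Z‖ ^ 2 / 4 : ℝ))} :=
    isClosed_eq hcont (by fun_prop)
  refine closure_minimal ?_ hclosed hZ
  intro Z hZ
  obtain ⟨c, rfl⟩ := Finsupp.mem_span_range_iff_exists_finsupp.1 hZ
  change expRe _ = _
  rw [Finsupp.sum, norm_sq_sum_smul_of_orthonormal orthonormal_gaussianCoord,
    ← integral_exp_re_finsetSum, expRe]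
  refine integral_congr_ae ?_
  filter_upwards [gaussianCoord_coe_sum_smul c.support c] with h hh
  rw [hh]

end ComplexGaussian

/-! ### Orthogonality and independence in the Gaussian Hilbert space. -/

section OrthonormalGaussians

open Complex

variable {N : Type*} {J : Type*}

theorem measurable_Lp_family {α : Type*} [MeasurableSpace α] {ν : Measure α}
    (e : J → Lp ℂ 2 ν) : Measurable fun h j => e j h :=
  measurable_pi_lambda _ fun j => (Lp.stronglyMeasurable (e j)).measurable

variable [Fintype J]

theorem exists_re_sum_eq_dual (L : StrongDual ℝ (J → ℂ)) :
    ∃ a : J → ℂ, ∀ y, L y = (∑ j, a j * y j).re := by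
  classical
  -- The minus sign matches Re (a y) = Re a Re y - Im a Im y.
  refine ⟨fun j => ⟨L (Pi.single j 1), -L (Pi.single j Complex.I)⟩, fun y => ?_⟩
  have hy : y = ∑ j, ((y j).re • (Pi.single j 1 : J → ℂ)
      + (y j).im • (Pi.single j Complex.I : J → ℂ)) := by
    ext i
    simp only [Finset.sum_apply, Pi.add_apply, Pi.smul_apply, Pi.single_apply]
    rw [Finset.sum_eq_single i (by intro b _ hb; simp [hb.symm]) (by simp)]
    simp [Complex.re_add_im]
  conv_lhs => rw [hy]
  rw [map_sum, Complex.re_sum]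
  refine Finset.sum_congr rfl fun j _ => ?_
  simp [Complex.mul_re]
  ring

/-- A finite orthonormal family in the closed span of independent `CN(0,1)` variables is again a
family of independent `CN(0,1)` variables. -/
theorem map_orthonormal_eq_gaussianFamily {e : J → Lp ℂ 2 (gaussianFamily N)}
    (he : Orthonormal ℂ e) (hmem : ∀ j, e j ∈ gaussianSpace N) :
    (gaussianFamily N).map (fun h j => e j h) = gaussianFamily J := by
  have hm := measurable_Lp_family e
  have : IsProbabilityMeasure ((gaussianFamily N).map (fun h j => e j h)) :=
    Measure.isProbabilityMeasure_map hm.aemeasurable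
  refine Measure.ext_of_charFunDual ?_
  ext L
  obtain ⟨a, ha⟩ := exists_re_sum_eq_dual L
  rw [charFunDual_apply, charFunDual_apply, integral_map hm.aemeasurable (by fun_prop)]
  simp_rw [ha]
  -- Both characteristic functions depend only on ∑ ‖a j‖²: on the right by the explicit formula, on
  -- the left because this is the squared L² norm of ∑ a j • e j.
  rw [integral_exp_re_finsetSum Finset.univ a,
    ← norm_sq_sum_smul_of_orthonormal he, ← expRe_of_mem_gaussianSpace
      (Submodule.sum_mem _ fun j _ => Submodule.smul_mem _ _ (hmem j)), expRe]
  refine integral_congr_ae ?_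
  filter_upwards [Lp_coe_sum_smul Finset.univ a e] with h hh
  rw [hh]

theorem lintegral_normSq_Lp {α : Type*} [MeasurableSpace α] {ν : Measure α} (Z : Lp ℂ 2 ν) :
    ∫⁻ h, ENNReal.ofReal (‖Z h‖ ^ 2) ∂ν = ENNReal.ofReal (‖Z‖ ^ 2) := by
  have h1 : ‖Z‖ₑ ^ 2 = ∫⁻ h, ‖Z h‖ₑ ^ 2 ∂ν := by
    rw [Lp.enorm_def, eLpNorm_eq_lintegral_rpow_enorm_toReal (by norm_num) (by norm_num),
      ← ENNReal.rpow_natCast, ← ENNReal.rpow_mul]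
    simp
  have h2 : ∀ x : ℂ, ENNReal.ofReal (‖x‖ ^ 2) = ‖x‖ₑ ^ 2 := fun x => by
    rw [ENNReal.ofReal_pow (norm_nonneg _), ofReal_norm]
  simp_rw [h2]
  rw [← h1, ENNReal.ofReal_pow (norm_nonneg _), ofReal_norm]

theorem rxPower_eq_sum {M : ℕ} (w v : Fin M → ℂ) :
    rxPower w v = ENNReal.ofReal (‖∑ m, star (w m) * v m‖ ^ 2) := rfl

theorem measurable_rxPower {α : Type*} [MeasurableSpace α] {M : ℕ} {w v : α → Fin M → ℂ}
    (hw : Measurable w) (hv : Measurable v) : Measurable fun a => rxPower (w a) (v a) := by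
  simp_rw [rxPower_eq_sum]
  have h1 : ∀ m, Measurable fun a => w a m := fun m => (measurable_pi_apply m).comp hw
  have h2 : ∀ m, Measurable fun a => v a m := fun m => (measurable_pi_apply m).comp hv
  have h3 : ∀ m, Measurable fun a => star (w a m) := fun m =>
    Complex.continuous_conj.measurable.comp (h1 m)
  fun_prop

/-- For a deterministic receiver the output is a combination of orthonormal coordinates, so its mean
power is the sum of the squared coefficients. -/
theorem lintegral_rxPower_gaussianFamily {M : ℕ} (w : Fin M → ℂ) (c : ℝ) :
    ∫⁻ y, rxPower w (fun m => (c : ℂ) * y m) ∂(gaussianFamily (Fin M))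
      = ENNReal.ofReal (c ^ 2) * ENNReal.ofReal (∑ m, ‖w m‖ ^ 2) := by
  have h1 := gaussianCoord_coe_sum_smul Finset.univ (fun m => star (w m) * (c : ℂ))
  rw [lintegral_congr_ae (g := fun y => ENNReal.ofReal
    (‖(∑ m, (star (w m) * (c : ℂ)) • gaussianCoord m : Lp ℂ 2 (gaussianFamily (Fin M))) y‖ ^ 2)),
    lintegral_normSq_Lp, norm_sq_sum_smul_of_orthonormal orthonormal_gaussianCoord]
  · rw [← ENNReal.ofReal_mul (sq_nonneg _), Finset.mul_sum]
    congr 1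
    refine Finset.sum_congr rfl fun m _ => ?_
    rw [norm_mul, norm_star, Complex.norm_real, mul_pow, Real.norm_eq_abs, sq_abs, mul_comm]
  · filter_upwards [h1] with y hy
    rw [hy, rxPower_eq_sum]
    simp_rw [mul_assoc]

theorem lintegral_gaussianFamily_sum {J' : Type*} [Fintype J'] {F : (J → ℂ) → (J' → ℂ) → ℝ≥0∞}
    (hF : Measurable (Function.uncurry F)) :
    ∫⁻ y, F (fun j => y (Sum.inl j)) (fun j => y (Sum.inr j)) ∂(gaussianFamily (J ⊕ J'))
      = ∫⁻ y, ∫⁻ z, F y z ∂(gaussianFamily J') ∂(gaussianFamily J) := by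
  have h := measurePreserving_sumPiEquivProdPi (fun _ : J ⊕ J' => stdComplexGaussian)
  have h2 := h.lintegral_comp hF
  rw [lintegral_prod _ hF.aemeasurable] at h2
  simp only [gaussianFamily, Measure.infinitePi_eq_pi]
  exact h2

/-- If `q` is orthogonal to the orthonormal family `p`, then `q` is independent of `p`, and the
received power of a receiver computed from `p` factorizes. -/
theorem lintegral_rxPower_of_orthogonal {M : ℕ} {p : J → Lp ℂ 2 (gaussianFamily N)}
    {q : Fin M → Lp ℂ 2 (gaussianFamily N)} {s : ℝ} (hs : 0 ≤ s) (hp : Orthonormal ℂ p)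
    (hpm : ∀ j, p j ∈ gaussianSpace N) (hqm : ∀ m, q m ∈ gaussianSpace N)
    (hqq : ∀ m m', inner ℂ (q m) (q m') = if m = m' then (s : ℂ) else 0)
    (hpq : ∀ j m, inner ℂ (p j) (q m) = 0)
    {w : (J → ℂ) → Fin M → ℂ} (hw : Measurable w) :
    ∫⁻ h, rxPower (w fun j => p j h) (fun m => q m h) ∂(gaussianFamily N)
      = ENNReal.ofReal s *
        ∫⁻ y, ENNReal.ofReal (∑ m, ‖w y m‖ ^ 2) ∂(gaussianFamily J) := by
  classical
  -- Zero variance is treated apart, as `q` cannot then be normalized; it does occur, for the error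
  -- on a pilot with no outer UE.
  rcases hs.eq_or_lt with rfl | hs
  · have hq0 : ∀ m, q m = 0 := fun m => by
      have := hqq m m
      simpa using this
    rw [ENNReal.ofReal_zero, zero_mul]
    refine (lintegral_congr_ae ?_).trans lintegral_zero
    have : ∀ᵐ h ∂(gaussianFamily N), ∀ m, q m h = 0 := by
      rw [ae_all_iff]
      intro m
      rw [hq0 m]
      exact Lp.coeFn_zero _ _ _
    filter_upwards [this] with h hh
    simp [rxPower_eq_sum, hh]
  · have hc0 : (Real.sqrt s : ℂ) ≠ 0 := by
      exact_mod_cast (Real.sqrt_pos.2 hs).ne'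
    have hcs : (Real.sqrt s : ℂ) * Real.sqrt s = s := by
      exact_mod_cast Real.mul_self_sqrt hs.le
    -- Joined with the normalized `q`, the family `p` stays orthonormal, so the joint law is a
    -- product measure; the receiver can then be frozen while averaging over `q`.
    set e : J ⊕ Fin M → Lp ℂ 2 (gaussianFamily N) :=
      Sum.elim p (fun m => (Real.sqrt s : ℂ)⁻¹ • q m) with he_def
    have hqp : ∀ j m, inner ℂ (q m) (p j) = 0 := fun j m => by
      rw [← inner_conj_symm, hpq, map_zero]
    have he : Orthonormal ℂ e := by
      rw [orthonormal_iff_ite] at hp ⊢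
      rintro (i | i) (j | j)
      · simp [he_def, hp i j]
      · simp [he_def, inner_smul_right, hpq]
      · simp [he_def, inner_smul_left, hqp]
      · simp only [he_def, Sum.elim_inr, inner_smul_left, inner_smul_right, hqq,
          Sum.inr.injEq, map_inv₀, Complex.conj_ofReal]
        split_ifs
        · rw [← hcs]; field_simp
        · simp
    have hem : ∀ j, e j ∈ gaussianSpace N := by
      rintro (i | i)
      · exact hpm i
      · exact Submodule.smul_mem _ _ (hqm i)
    have hlaw := map_orthonormal_eq_gaussianFamily he hem
    have hqe : ∀ᵐ h ∂(gaussianFamily N), ∀ m,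
        q m h = (Real.sqrt s : ℂ) * e (Sum.inr m) h := by
      rw [ae_all_iff]
      intro m
      filter_upwards [Lp.coeFn_smul (Real.sqrt s : ℂ)⁻¹ (q m)] with h hh
      simp only [he_def, Sum.elim_inr]
      rw [hh, Pi.smul_apply, smul_eq_mul, mul_inv_cancel_left₀ hc0]
    have hF : Measurable (Function.uncurry fun (y : J → ℂ) (z : Fin M → ℂ) =>
        rxPower (w y) (fun m => (Real.sqrt s : ℂ) * z m)) :=
      measurable_rxPower (hw.comp measurable_fst) (by fun_prop)
    have hstep : ∫⁻ h, rxPower (w fun j => p j h) (fun m => q m h) ∂(gaussianFamily N)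
        = ∫⁻ y, rxPower (w fun j => y (Sum.inl j)) (fun m => (Real.sqrt s : ℂ) * y (Sum.inr m))
          ∂(gaussianFamily (J ⊕ Fin M)) := by
      rw [← hlaw, lintegral_map (measurable_rxPower (by fun_prop) (by fun_prop))
        (measurable_Lp_family e)]
      refine lintegral_congr_ae ?_
      filter_upwards [hqe] with h hh
      congr 1
      ext m
      exact hh m
    rw [hstep, lintegral_gaussianFamily_sum hF]
    simp_rw [lintegral_rxPower_gaussianFamily, Real.sq_sqrt hs.le]
    rw [lintegral_const_mul']
    exact ENNReal.ofReal_ne_top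

end OrthonormalGaussians

/-! ### The inverse moment of a sum of squared moduli. -/

section InverseMoment

theorem integral_exp_neg_mul_sq_gaussianReal {u : ℝ} (hu : 0 ≤ u) :
    ∫ x : ℝ, Real.exp (-u * x ^ 2) ∂(gaussianReal 0 (1 / 2)) = Real.sqrt (1 / (1 + u)) := by
  rw [integral_gaussianReal_eq_integral_smul (by norm_num)]
  have h : ∀ x : ℝ, gaussianPDFReal 0 (1 / 2) x • Real.exp (-u * x ^ 2)
      = (Real.sqrt Real.pi)⁻¹ * Real.exp (-(1 + u) * x ^ 2) := by
    intro x
    rw [gaussianPDFReal, smul_eq_mul, mul_assoc, ← Real.exp_add]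
    have h1 : (2 * Real.pi * ((1 / 2 : ℝ≥0) : ℝ)) = Real.pi := by
      push_cast; ring
    rw [h1]
    congr 2
    push_cast
    ring
  simp_rw [h]
  rw [integral_const_mul, integral_gaussian, ← Real.sqrt_inv, ← Real.sqrt_mul (by positivity)]
  congr 1
  field_simp

theorem integral_exp_neg_mul_normSq {u : ℝ} (hu : 0 ≤ u) :
    ∫ z : ℂ, Real.exp (-u * ‖z‖ ^ 2) ∂stdComplexGaussian = 1 / (1 + u) := by
  rw [stdComplexGaussian, integral_map measurable_complex_mk.aemeasurable (by fun_prop)]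
  have : ∀ p : ℝ × ℝ, Real.exp (-u * ‖(⟨p.1, p.2⟩ : ℂ)‖ ^ 2)
      = Real.exp (-u * p.1 ^ 2) * Real.exp (-u * p.2 ^ 2) := by
    intro p
    rw [← Complex.normSq_eq_norm_sq, Complex.normSq_apply, ← Real.exp_add]
    ring_nf
  simp_rw [this]
  rw [integral_prod_mul (fun x : ℝ => Real.exp (-u * x ^ 2)) (fun x : ℝ => Real.exp (-u * x ^ 2)),
    integral_exp_neg_mul_sq_gaussianReal hu, Real.mul_self_sqrt (by positivity)]

/-- The squared modulus of a `CN(0,1)` variable is exponential of rate 1, with Laplace transform 1 /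
(1 + u); independence turns the sum into a product. -/
theorem lintegral_exp_neg_mul_sum_normSq {J : Type*} [Fintype J] {u : ℝ} (hu : 0 ≤ u) :
    ∫⁻ y : J → ℂ, ENNReal.ofReal (Real.exp (-u * ∑ j, ‖y j‖ ^ 2)) ∂(gaussianFamily J)
      = ENNReal.ofReal (((1 + u) ^ Fintype.card J)⁻¹) := by
  have hint : Integrable (fun y : J → ℂ => Real.exp (-u * ∑ j, ‖y j‖ ^ 2)) (gaussianFamily J) := by
    refine Integrable.of_bound (C := 1) (Measurable.aestronglyMeasurable (by fun_prop)) ?_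
    filter_upwards with y
    rw [Real.norm_eq_abs, Real.abs_exp, Real.exp_le_one_iff]
    have : 0 ≤ ∑ j, ‖y j‖ ^ 2 := Finset.sum_nonneg fun _ _ => sq_nonneg _
    nlinarith
  rw [← ofReal_integral_eq_lintegral_ofReal hint
    (Filter.Eventually.of_forall fun y => (Real.exp_pos _).le)]
  congr 1
  have h : ∀ y : J → ℂ, Real.exp (-u * ∑ j, ‖y j‖ ^ 2) = ∏ j, Real.exp (-u * ‖y j‖ ^ 2) := by
    intro y
    rw [← Real.exp_sum, Finset.mul_sum]
  simp_rw [h]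
  rw [gaussianFamily, Measure.infinitePi_eq_pi,
    integral_fintype_prod_eq_prod (fun (_ : J) (z : ℂ) => Real.exp (-u * ‖z‖ ^ 2))]
  simp_rw [integral_exp_neg_mul_normSq hu]
  simp

theorem lintegral_Ioi_inv_one_add_pow (m : ℕ) :
    ∫⁻ u in Set.Ioi (0 : ℝ), ENNReal.ofReal (((1 + u) ^ (m + 2))⁻¹)
      = ENNReal.ofReal (1 / (m + 1)) := by
  have hderiv : ∀ u ∈ Set.Ici (0 : ℝ),
      HasDerivAt (fun u : ℝ => -(((1 + u) ^ (m + 1))⁻¹ / (m + 1))) (((1 + u) ^ (m + 2))⁻¹) u := by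
    intro u hu
    have hu' : (1 + u) ≠ 0 := by
      have : (0 : ℝ) ≤ u := hu
      positivity
    have hm : (m + 1 : ℝ) ≠ 0 := by positivity
    have h1 := ((((hasDerivAt_id u).const_add 1).pow (m + 1)).inv (pow_ne_zero _ hu')).div_const
      (m + 1 : ℝ)
    convert! h1.neg using 1
    simp only [id, Pi.pow_apply]
    push_cast
    field_simp
    ring_nf
  have hlim : Filter.Tendsto (fun u : ℝ => -(((1 + u) ^ (m + 1))⁻¹ / (m + 1))) Filter.atTop
      (nhds 0) := by
    have h1 : Filter.Tendsto (fun u : ℝ => (1 + u) ^ (m + 1)) Filter.atTop Filter.atTop :=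
      (Filter.tendsto_pow_atTop (by omega)).comp
        (Filter.tendsto_atTop_add_const_left _ _ Filter.tendsto_id)
    simpa using (h1.inv_tendsto_atTop.div_const (m + 1 : ℝ)).neg
  have hpos : ∀ u ∈ Set.Ioi (0 : ℝ), 0 ≤ ((1 + u) ^ (m + 2))⁻¹ := by
    intro u hu
    have : (0 : ℝ) < u := hu
    positivity
  have hint := integrableOn_Ioi_deriv_of_nonneg' hderiv hpos hlim
  rw [← ofReal_integral_eq_lintegral_ofReal hint
    ((ae_restrict_iff' measurableSet_Ioi).2 (Filter.Eventually.of_forall hpos)),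
    integral_Ioi_of_hasDerivAt_of_nonneg' hderiv hpos hlim]
  simp

theorem lintegral_Ioi_exp_neg_mul {S : ℝ} (hS : 0 < S) :
    ∫⁻ u in Set.Ioi (0 : ℝ), ENNReal.ofReal (Real.exp (-u * S)) = ENNReal.ofReal S⁻¹ := by
  have h1 := integral_exp_mul_Ioi (neg_lt_zero.2 hS) 0
  have h2 := integrableOn_exp_mul_Ioi (neg_lt_zero.2 hS) 0
  have h3 : ∀ u : ℝ, -u * S = -S * u := fun u => by ring
  simp_rw [h3]
  rw [← ofReal_integral_eq_lintegral_ofReal h2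
    (Filter.Eventually.of_forall fun _ => (Real.exp_pos _).le), h1]
  simp

theorem ae_sum_normSq_pos {J : Type*} [Fintype J] [Nonempty J] :
    ∀ᵐ y : J → ℂ ∂(gaussianFamily J), 0 < ∑ j, ‖y j‖ ^ 2 := by
  obtain ⟨j₀⟩ := ‹Nonempty J›
  have hz : ∀ᵐ z : ℂ ∂stdComplexGaussian, z ≠ 0 := by
    have h1 : ∀ᵐ p : ℝ × ℝ ∂((gaussianReal 0 (1 / 2)).prod (gaussianReal 0 (1 / 2))),
        p.1 ≠ 0 := by
      have : ∀ᵐ x : ℝ ∂(gaussianReal 0 (1 / 2 : ℝ≥0)), x ≠ 0 := by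
        have : NullSingletonClass (gaussianReal 0 (1 / 2 : ℝ≥0)) :=
          nullSingletonClass_gaussianReal (by norm_num)
        exact Measure.ae_ne _ _
      exact Measure.quasiMeasurePreserving_fst.ae this
    refine (ae_map_iff (p := fun z : ℂ => z ≠ 0) measurable_complex_mk.aemeasurable
      (measurableSet_singleton (0 : ℂ)).compl).2 ?_
    filter_upwards [h1] with p hp h
    exact hp (congrArg Complex.re h)
  have h2 : ∀ᵐ y : J → ℂ ∂(gaussianFamily J), y j₀ ≠ 0 :=
    (measurePreserving_eval_infinitePi (fun _ : J => stdComplexGaussian)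
      j₀).quasiMeasurePreserving.ae hz
  filter_upwards [h2] with y hy
  refine Finset.sum_pos' (fun _ _ => sq_nonneg _) ⟨j₀, Finset.mem_univ _, ?_⟩
  have := norm_pos_iff.2 hy
  positivity

/-- Write 1 / S as the integral of exp(-u S) over u > 0 and exchange the integrals: what remains is
the integral of (1 + u)^{-(m + 2)}. At least two summands are needed for it to converge. -/
theorem lintegral_inv_sum_normSq {J : Type*} [Fintype J] {m : ℕ} (hJ : Fintype.card J = m + 2) :
    ∫⁻ y : J → ℂ, ENNReal.ofReal (∑ j, ‖y j‖ ^ 2)⁻¹ ∂(gaussianFamily J)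
      = ENNReal.ofReal (1 / (m + 1)) := by
  have : Nonempty J := Fintype.card_pos_iff.1 (by omega)
  rw [lintegral_congr_ae (g := fun y : J → ℂ => ∫⁻ u in Set.Ioi (0 : ℝ),
    ENNReal.ofReal (Real.exp (-u * ∑ j, ‖y j‖ ^ 2))), lintegral_lintegral_swap,
    ← lintegral_Ioi_inv_one_add_pow, ← hJ]
  · refine setLIntegral_congr_fun measurableSet_Ioi fun u hu => ?_
    exact lintegral_exp_neg_mul_sum_normSq (le_of_lt hu)
  · exact Measurable.aemeasurable (by fun_prop)
  · filter_upwards [ae_sum_normSq_pos] with y hy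
    exact (lintegral_Ioi_exp_neg_mul hy).symm

end InverseMoment

/-! ### Linear algebra of the zero-forcing vector. -/

section ZeroForcing

variable {M K : ℕ}

/-- The zero-forcing vector for column `k` of `A`. -/
noncomputable def zfVec (A : Matrix (Fin M) (Fin K) ℂ) (k : Fin K) : Fin M → ℂ :=
  A *ᵥ fun j => (Aᴴ * A)⁻¹ j k

theorem zfReceiver_eq_zfVec {ι : Fin K → Type} (β : UE ι → ℝ) (k : Fin K)
    (h : UE ι × Fin M → ℂ) : zfReceiver M β k h = zfVec (estimateMatrix M β h) k := rfl

/-- By the adjugate formula the entries of the inverse Gram matrix are polynomials in the entries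
divided by a determinant, with the value 0 where it vanishes; no invertibility is needed. -/
theorem measurable_zfVec {α : Type*} [MeasurableSpace α] {A : α → Matrix (Fin M) (Fin K) ℂ}
    (hA : ∀ m j, Measurable fun a => A a m j) (k : Fin K) :
    Measurable fun a => zfVec (A a) k := by
  have hconj : ∀ m j, Measurable fun a => star (A a m j) := fun m j =>
    Complex.continuous_conj.measurable.comp (hA m j)
  have hG : ∀ i j, Measurable fun a => ((A a)ᴴ * A a) i j := by
    intro i j
    simp only [Matrix.mul_apply, Matrix.conjTranspose_apply]
    exact Finset.measurable_sum _ fun m _ => (hconj m i).mul (hA m j)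
  have hdet : ∀ B : α → Matrix (Fin K) (Fin K) ℂ, (∀ i j, Measurable fun a => B a i j) →
      Measurable fun a => (B a).det := by
    intro B hB
    simp only [Matrix.det_apply]
    exact Finset.measurable_sum _ fun σ _ =>
      (Finset.measurable_prod _ fun i _ => hB _ _).const_smul _
  have hinv : ∀ i j, Measurable fun a => ((A a)ᴴ * A a)⁻¹ i j := by
    intro i j
    simp only [Matrix.inv_def, Matrix.smul_apply, Matrix.adjugate_apply, smul_eq_mul,
      Ring.inverse_eq_inv']
    refine (hdet _ hG).inv.mul (hdet _ fun i' j' => ?_)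
    simp only [Matrix.updateRow_apply]
    split_ifs
    · exact measurable_const
    · exact hG _ _
  refine measurable_pi_lambda _ fun m => ?_
  simp only [zfVec, Matrix.mulVec, dotProduct]
  exact Finset.measurable_sum _ fun j _ => (hA m j).mul (hinv j k)

open scoped ComplexOrder in
-- The matrices AᴴA and A have the same kernel.
theorem isUnit_det_gram {A : Matrix (Fin M) (Fin K) ℂ} (hA : LinearIndependent ℂ A.col) :
    IsUnit (Aᴴ * A).det := by
  rw [← Matrix.isUnit_iff_isUnit_det, ← Matrix.mulVec_injective_iff_isUnit]
  rw [← Matrix.mulVec_injective_iff] at hA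
  intro x y hxy
  refine hA (sub_eq_zero.1 ?_)
  change A *ᵥ x - A *ᵥ y = 0
  rw [← Matrix.mulVec_sub, ← Matrix.conjTranspose_mul_self_mulVec_eq_zero, Matrix.mulVec_sub]
  exact sub_eq_zero.2 hxy

theorem conjTranspose_mulVec_zfVec {A : Matrix (Fin M) (Fin K) ℂ}
    (hA : LinearIndependent ℂ A.col) (k : Fin K) : Aᴴ *ᵥ zfVec A k = Pi.single k 1 := by
  rw [zfVec, Matrix.mulVec_mulVec]
  have h : (fun j => (Aᴴ * A)⁻¹ j k) = (Aᴴ * A)⁻¹ *ᵥ Pi.single k 1 := by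
    ext j; simp
  rw [h, Matrix.mulVec_mulVec, Matrix.mul_nonsing_inv _ (isUnit_det_gram hA), Matrix.one_mulVec]

theorem star_zfVec_dotProduct {A : Matrix (Fin M) (Fin K) ℂ}
    (hA : LinearIndependent ℂ A.col) (k j : Fin K) :
    star (zfVec A k) ⬝ᵥ A.col j = if j = k then 1 else 0 := by
  have h := congrFun (conjTranspose_mulVec_zfVec hA k) j
  have h2 : star (zfVec A k) ⬝ᵥ A.col j = star ((Aᴴ *ᵥ zfVec A k) j) := by
    simp [Matrix.mulVec, dotProduct, Matrix.conjTranspose_apply, mul_comm]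
  rw [h2, h, Pi.single_apply]
  split_ifs <;> simp

end ZeroForcing

/-! ### Projections of Gaussian vectors and almost sure linear independence. -/

section ProjectedGaussian

variable {M : ℕ}

/-- The coordinates of a standard complex Gaussian vector with respect to a finite orthonormal
family are independent `CN(0,1)` variables. -/
theorem map_inner_orthonormal {J : Type*} [Fintype J] {b : J → EuclideanSpace ℂ (Fin M)}
    (hb : Orthonormal ℂ b) :
    (gaussianFamily (Fin M)).map (fun g j => inner ℂ (b j) (WithLp.toLp 2 g))
      = gaussianFamily J := by
  classical
  -- The inner product with `b j`, seen as an element of the Gaussian Hilbert space; orthonormality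
  -- of `b` passes to `e` with the indices exchanged by conjugation.
  set e : J → Lp ℂ 2 (gaussianFamily (Fin M)) :=
    fun j => ∑ m, star (b j m) • gaussianCoord m with he_def
  have he : Orthonormal ℂ e := by
    rw [orthonormal_iff_ite] at hb ⊢
    intro i j
    rw [he_def, orthonormal_gaussianCoord.inner_sum]
    have h := hb j i
    rw [EuclideanSpace.inner_eq_star_dotProduct] at h
    simp only [eq_comm (a := j)] at h
    rw [← h]
    simp [dotProduct]
  have hem : ∀ j, e j ∈ gaussianSpace (Fin M) := fun j =>
    Submodule.sum_mem _ fun m _ => Submodule.smul_mem _ _ (gaussianCoord_mem m)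
  rw [← map_orthonormal_eq_gaussianFamily he hem]
  refine Measure.map_congr ?_
  have hall : ∀ᵐ g ∂(gaussianFamily (Fin M)), ∀ j, e j g = ∑ m, star (b j m) * g m := by
    rw [ae_all_iff]
    exact fun j => gaussianCoord_coe_sum_smul Finset.univ _
  filter_upwards [hall] with g hg
  ext j
  rw [hg, EuclideanSpace.inner_eq_star_dotProduct]
  simp [dotProduct, mul_comm]

theorem measurable_inner_family {J : Type*} (b : J → EuclideanSpace ℂ (Fin M)) :
    Measurable fun (g : Fin M → ℂ) j => inner ℂ (b j) (WithLp.toLp 2 g) := by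
  refine measurable_pi_lambda _ fun j => ?_
  simp only [EuclideanSpace.inner_eq_star_dotProduct, dotProduct]
  fun_prop

/-- The orthogonal complement of the span is nonzero, and the coordinates of `g` along an
orthonormal basis of it are again `CN(0,1)`, hence almost surely not all zero. -/
theorem ae_notMem_of_finrank_lt {K : ℕ} (hKM : K < M) (r : Fin K → Fin M → ℂ) :
    ∀ᵐ g ∂(gaussianFamily (Fin M)), g ∉ Submodule.span ℂ (Set.range r) := by
  set W : Submodule ℂ (EuclideanSpace ℂ (Fin M)) :=
    Submodule.span ℂ (Set.range fun i => WithLp.toLp 2 (r i)) with hW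
  have hWK : Module.finrank ℂ W ≤ K := by
    simpa [Set.finrank] using finrank_range_le_card (R := ℂ) (fun i => WithLp.toLp 2 (r i))
  have hsum := Submodule.finrank_add_finrank_orthogonal W
  rw [finrank_euclideanSpace_fin] at hsum
  have hne : Nonempty (Fin (Module.finrank ℂ Wᗮ)) := Fin.pos_iff_nonempty.1 (by omega)
  have hb : Orthonormal ℂ fun i => (stdOrthonormalBasis ℂ Wᗮ i : EuclideanSpace ℂ (Fin M)) :=
    (stdOrthonormalBasis ℂ Wᗮ).orthonormal.comp_linearIsometry Wᗮ.subtypeₗᵢ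
  have hpos := ae_sum_normSq_pos (J := Fin (Module.finrank ℂ Wᗮ))
  rw [← map_inner_orthonormal hb] at hpos
  filter_upwards [ae_of_ae_map (measurable_inner_family _).aemeasurable hpos] with g hg hmem
  have hgW : WithLp.toLp 2 g ∈ W := by
    have := Submodule.mem_map_of_mem (f := (WithLp.linearEquiv 2 ℂ (Fin M → ℂ)).symm.toLinearMap)
      hmem
    rw [Submodule.map_span, ← Set.range_comp] at this
    exact this
  refine hg.ne' (Finset.sum_eq_zero fun i _ => ?_)
  rw [Submodule.inner_left_of_mem_orthogonal hgW (stdOrthonormalBasis ℂ Wᗮ i).2]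
  simp

/-- At most `M` independent standard complex Gaussian vectors in `ℂ^M` are almost surely linearly
independent. -/
theorem ae_linearIndependent_gaussian {K : ℕ} (hKM : K ≤ M) :
    ∀ᵐ v ∂(Measure.pi fun _ : Fin K => gaussianFamily (Fin M)), LinearIndependent ℂ v := by
  induction K with
  | zero => exact Filter.Eventually.of_forall fun v => linearIndependent_empty_type
  | succ K ih =>
    have ih := ih (by omega)
    have hmp := measurePreserving_piFinSuccAbove
      (fun _ : Fin (K + 1) => gaussianFamily (Fin M)) 0
    have hmeas : MeasurableSet {v : Fin (K + 1) → Fin M → ℂ | LinearIndependent ℂ v} :=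
      isOpen_setOfPred_linearIndependent.measurableSet
    have hS : MeasurableSet {p : (Fin M → ℂ) × (Fin K → Fin M → ℂ) |
        LinearIndependent ℂ ((MeasurableEquiv.piFinSuccAbove (fun _ => Fin M → ℂ) 0).symm p)} :=
      (MeasurableEquiv.measurable _) hmeas
    have hprod : ∀ᵐ p ∂((gaussianFamily (Fin M)).prod
        (Measure.pi fun _ : Fin K => gaussianFamily (Fin M))),
        LinearIndependent ℂ
          ((MeasurableEquiv.piFinSuccAbove (fun _ => Fin M → ℂ) 0).symm p) := by
      rw [ae_iff]
      change (_ : Measure _) ({p | LinearIndependent ℂ _}ᶜ) = 0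
      -- By Fubini it suffices to fix the remaining columns, independent by induction, and show that
      -- the new column almost surely avoids their span.
      rw [Measure.prod_apply_symm hS.compl, lintegral_eq_zero_iff
        (measurable_measure_prodMk_right hS.compl)]
      filter_upwards [ih] with r hr
      have := ae_notMem_of_finrank_lt (Nat.lt_of_succ_le hKM) r
      rw [ae_iff] at this
      refine measure_mono_null ?_ this
      intro g hg hmem
      refine hg ?_
      have hcons : (MeasurableEquiv.piFinSuccAbove (fun _ => Fin M → ℂ) 0).symm (g, r)
          = (Fin.cons g r : Fin (K + 1) → Fin M → ℂ) :=
        Fin.insertNth_zero (α := fun _ => Fin M → ℂ) g r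
      change LinearIndependent ℂ _
      rw [hcons]
      exact linearIndependent_finCons.2 ⟨hr, hmem⟩
    filter_upwards [hmp.quasiMeasurePreserving.ae hprod] with v hv
    rwa [MeasurableEquiv.symm_apply_apply] at hv

end ProjectedGaussian

/-! ### The norm of the zero-forcing vector and its second moment. -/

section ZeroForcingNorm

variable {M K : ℕ}

/-- The matrix with columns `c j • v j`. -/
noncomputable def scaledColumns (c : Fin K → ℝ) (v : Fin K → Fin M → ℂ) :
    Matrix (Fin M) (Fin K) ℂ :=
  Matrix.of fun m j => (c j : ℂ) * v j m

theorem linearIndependent_scaledColumns {c : Fin K → ℝ} (hc : ∀ j, c j ≠ 0)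
    {v : Fin K → Fin M → ℂ} (hv : LinearIndependent ℂ v) :
    LinearIndependent ℂ (scaledColumns c v).col :=
  hv.units_smul fun j => Units.mk0 (c j : ℂ) (by exact_mod_cast hc j)

/-- The vector w lies in the span of all columns and is orthogonal to every column but the k-th, so
it is a multiple of the projection of `g` to Wᗮ; the condition that its inner product with the k-th
column is 1 fixes the multiple. The right side is the inverse squared length of the projection of
c_k g. -/
theorem sum_normSq_zfVec {c : Fin (K + 1) → ℝ} (hc : ∀ j, c j ≠ 0) (k : Fin (K + 1))
    {g : Fin M → ℂ} {r : Fin K → Fin M → ℂ}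
    (hv : LinearIndependent ℂ (k.insertNth g r : Fin (K + 1) → Fin M → ℂ))
    {J : Type*} [Fintype J]
    {W : Submodule ℂ (EuclideanSpace ℂ (Fin M))}
    (hW : W = Submodule.span ℂ (Set.range fun i => WithLp.toLp 2 (r i)))
    (b : OrthonormalBasis J ℂ Wᗮ) :
    ∑ m, ‖zfVec (scaledColumns c (k.insertNth g r)) k m‖ ^ 2
      = (c k ^ 2)⁻¹
        * (∑ i, ‖inner ℂ (b i : EuclideanSpace ℂ (Fin M)) (WithLp.toLp 2 g)‖ ^ 2)⁻¹ := by
  set v : Fin (K + 1) → Fin M → ℂ := k.insertNth g r with hv_def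
  set A := scaledColumns c v with hA
  set w : EuclideanSpace ℂ (Fin M) := WithLp.toLp 2 (zfVec A k) with hw
  have hc' : ∀ j, (c j : ℂ) ≠ 0 := fun j => by exact_mod_cast hc j
  have hinner : ∀ j, inner ℂ w (WithLp.toLp 2 (v j)) = if j = k then (c k : ℂ)⁻¹ else 0 := by
    intro j
    have h := star_zfVec_dotProduct (linearIndependent_scaledColumns hc hv) k j
    have h2 : star (zfVec A k) ⬝ᵥ A.col j = (c j : ℂ) * inner ℂ w (WithLp.toLp 2 (v j)) := by
      rw [EuclideanSpace.inner_toLp_toLp]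
      simp only [dotProduct, Finset.mul_sum]
      refine Finset.sum_congr rfl fun m _ => ?_
      simp [hA, scaledColumns]
      ring
    rw [h2] at h
    rw [← mul_right_inj' (hc' j), h]
    split_ifs with hj
    · rw [hj, mul_inv_cancel₀ (hc' k)]
    · simp
  set d : Fin (K + 1) → ℂ := fun j => (Aᴴ * A)⁻¹ j k * c j with hd
  have hwsum : w = ∑ j, d j • WithLp.toLp 2 (v j) := by
    ext m
    simp only [hw, zfVec, Matrix.mulVec, dotProduct, WithLp.ofLp_sum, WithLp.ofLp_smul,
      Finset.sum_apply, Pi.smul_apply, smul_eq_mul]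
    refine Finset.sum_congr rfl fun j _ => ?_
    simp only [hd, hA, scaledColumns, Matrix.of_apply]
    ring
  have hwW : w ∈ Wᗮ := by
    rw [Submodule.mem_orthogonal', hW]
    intro u hu
    induction hu using Submodule.span_induction with
    | mem x hx =>
      obtain ⟨i, rfl⟩ := hx
      have := hinner (k.succAbove i)
      rw [if_neg (Fin.succAbove_ne k i), hv_def, Fin.insertNth_apply_succAbove] at this
      exact this
    | zero => simp
    | add x y _ _ hx hy => rw [inner_add_right, hx, hy, add_zero]
    | smul a x _ hx => rw [inner_smul_right, hx, mul_zero]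
  -- Expanding only the second argument of ⟨w, w⟩ leaves the single term j = k.
  have hnorm : (‖w‖ ^ 2 : ℂ) = d k * (c k : ℂ)⁻¹ := by
    have h1 := inner_self_eq_norm_sq_to_K (𝕜 := ℂ) w
    refine h1.symm.trans ?_
    conv_lhs => arg 3; rw [hwsum]
    rw [inner_sum]
    simp only [inner_smul_right, hinner]
    simp
  have hbi : ∀ i, inner ℂ (b i : EuclideanSpace ℂ (Fin M)) w
      = d k * inner ℂ (b i : EuclideanSpace ℂ (Fin M)) (WithLp.toLp 2 g) := by
    intro i
    rw [hwsum, inner_sum, Finset.sum_eq_single k]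
    · rw [inner_smul_right, hv_def, Fin.insertNth_apply_same]
    · intro j _ hj
      obtain ⟨i', rfl⟩ := Fin.exists_succAbove_eq hj
      rw [inner_smul_right, hv_def, Fin.insertNth_apply_succAbove,
        Submodule.inner_left_of_mem_orthogonal (hW ▸ Submodule.subset_span ⟨i', rfl⟩)
          (b i).2, mul_zero]
    · simp
  have hparseval : ‖w‖ ^ 2 = ‖d k‖ ^ 2 *
      ∑ i, ‖inner ℂ (b i : EuclideanSpace ℂ (Fin M)) (WithLp.toLp 2 g)‖ ^ 2 := by
    have h := b.sum_sq_norm_inner_right ⟨w, hwW⟩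
    simp only [Submodule.coe_inner, Submodule.coe_norm, hbi, norm_mul, mul_pow] at h
    rw [← h, Finset.mul_sum]
  have hdk : ‖d k‖ = |c k| * ‖w‖ ^ 2 := by
    have h := congrArg norm hnorm
    rw [norm_mul, norm_inv, Complex.norm_real, Real.norm_eq_abs, norm_pow, Complex.norm_real,
      norm_norm] at h
    rw [h]
    field_simp [abs_ne_zero.2 (hc k)]
  have hw0 : ‖w‖ ^ 2 ≠ 0 := by
    intro h0
    have hw0 : w = 0 := by simpa using h0
    have := hinner k
    rw [hw0, inner_zero_left, if_pos rfl] at this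
    exact inv_ne_zero (hc' k) this.symm
  have hsum : ∑ m, ‖zfVec A k m‖ ^ 2 = ‖w‖ ^ 2 := by
    rw [EuclideanSpace.norm_sq_eq]
  rw [hsum]
  rw [hdk, mul_pow, sq_abs] at hparseval
  set n := ‖w‖ ^ 2
  set S := ∑ i, ‖inner ℂ (b i : EuclideanSpace ℂ (Fin M)) (WithLp.toLp 2 g)‖ ^ 2
  -- From n = |d k|² S and |d k| = |c k| n one gets n = c k² n² S; cancel one factor n.
  have h1 : 1 = c k ^ 2 * n * S := by
    have : n * 1 = n * (c k ^ 2 * n * S) := by rw [mul_one]; nlinarith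
    exact mul_left_cancel₀ hw0 this
  rw [← mul_inv]
  refine eq_inv_of_mul_eq_one_left ?_
  linarith

/-- Condition on the other K - 1 columns. The k-th column has M - K + 1 independent `CN(0,1)`
coordinates in the orthogonal complement of their span, so the inverse moment is 1 / (M - K)
whatever those columns are. -/
theorem lintegral_sum_normSq_zfVec_pi (hKM : K < M) {c : Fin K → ℝ} (hc : ∀ j, c j ≠ 0)
    (k : Fin K) :
    ∫⁻ v, ENNReal.ofReal (∑ m, ‖zfVec (scaledColumns c v) k m‖ ^ 2)
        ∂(Measure.pi fun _ : Fin K => gaussianFamily (Fin M))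
      = ENNReal.ofReal ((c k ^ 2)⁻¹ * (1 / ((M : ℝ) - K))) := by
  obtain ⟨K, rfl⟩ : ∃ K', K = K' + 1 := ⟨K - 1, by have := k.2; omega⟩
  have hF : Measurable fun v : Fin (K + 1) → Fin M → ℂ =>
      ENNReal.ofReal (∑ m, ‖zfVec (scaledColumns c v) k m‖ ^ 2) := by
    have h : Measurable fun v : Fin (K + 1) → Fin M → ℂ => zfVec (scaledColumns c v) k :=
      measurable_zfVec (fun m j => by simp only [scaledColumns, Matrix.of_apply]; fun_prop) k
    fun_prop
  have hmp := (measurePreserving_piFinSuccAbove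
    (fun _ : Fin (K + 1) => gaussianFamily (Fin M)) k).symm
  have hli := hmp.quasiMeasurePreserving.ae (ae_linearIndependent_gaussian hKM.le)
  rw [← hmp.lintegral_comp hF]
  refine (lintegral_prod_symm' _ (hF.comp (MeasurableEquiv.measurable
    (MeasurableEquiv.piFinSuccAbove (fun _ => Fin M → ℂ) k).symm))).trans ?_
  rw [← Measure.prod_swap] at hli
  have hli' := Measure.ae_ae_of_ae_prod
    (ae_of_ae_map measurable_swap.aemeasurable hli)
  have hconst : ∀ᵐ r ∂(Measure.pi fun _ : Fin K => gaussianFamily (Fin M)),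
      ∫⁻ g, ENNReal.ofReal (∑ m, ‖zfVec (scaledColumns c
        ((MeasurableEquiv.piFinSuccAbove (fun _ => Fin M → ℂ) k).symm (g, r))) k m‖ ^ 2)
          ∂(gaussianFamily (Fin M))
      = ENNReal.ofReal ((c k ^ 2)⁻¹ * (1 / ((M : ℝ) - ((K + 1 : ℕ) : ℝ)))) := by
    filter_upwards [hli'] with r hr
    set W : Submodule ℂ (EuclideanSpace ℂ (Fin M)) :=
      Submodule.span ℂ (Set.range fun i => WithLp.toLp 2 (r i)) with hW
    have hrLI : LinearIndependent ℂ r := by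
      obtain ⟨g, hg⟩ := hr.exists
      have := hg.comp k.succAbove Fin.succAbove_right_injective
      convert this
      ext1 i
      exact (Fin.insertNth_apply_succAbove (α := fun _ => Fin M → ℂ) k g r i).symm
    have hWK : Module.finrank ℂ W = K := by
      have h2 : LinearIndependent ℂ fun i => WithLp.toLp 2 (r i) :=
        hrLI.map' (WithLp.linearEquiv 2 ℂ (Fin M → ℂ)).symm.toLinearMap
          (LinearEquiv.ker _)
      simpa using finrank_span_eq_card h2
    have hdim := Submodule.finrank_add_finrank_orthogonal W
    rw [finrank_euclideanSpace_fin, hWK] at hdim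
    -- Here `K` is one less than the number of columns; the strict inequality leaves the n + 2 ≥ 2
    -- dimensions required by the inverse moment.
    obtain ⟨n, hn⟩ : ∃ n, M = K + 1 + (n + 1) := ⟨M - K - 2, by omega⟩
    have hcard : Fintype.card (Fin (Module.finrank ℂ Wᗮ)) = n + 2 := by
      rw [Fintype.card_fin]; omega
    set b := stdOrthonormalBasis ℂ Wᗮ
    have hb : Orthonormal ℂ fun i => (b i : EuclideanSpace ℂ (Fin M)) :=
      b.orthonormal.comp_linearIsometry Wᗮ.subtypeₗᵢ
    have hmom := lintegral_inv_sum_normSq hcard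
    rw [← map_inner_orthonormal hb, lintegral_map (by fun_prop) (measurable_inner_family _)] at hmom
    have hMK : (M : ℝ) - ((K + 1 : ℕ) : ℝ) = n + 1 := by rw [hn]; push_cast; ring
    rw [hMK, ENNReal.ofReal_mul (by positivity), ← hmom,
      ← lintegral_const_mul' _ _ ENNReal.ofReal_ne_top]
    refine lintegral_congr_ae ?_
    filter_upwards [hr] with g hg
    rw [← ENNReal.ofReal_mul (by positivity)]
    congr 1
    exact sum_normSq_zfVec hc k hg hW b
  refine (lintegral_congr_ae hconst).trans ?_
  simp

/-- The mean squared norm of the zero-forcing vector (an inverse Wishart moment). -/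
theorem lintegral_sum_normSq_zfVec (hKM : K < M) {c : Fin K → ℝ} (hc : ∀ j, c j ≠ 0)
    (k : Fin K) :
    ∫⁻ y, ENNReal.ofReal (∑ m, ‖zfVec (scaledColumns c fun j m => y (j, m)) k m‖ ^ 2)
        ∂(gaussianFamily (Fin K × Fin M))
      = ENNReal.ofReal ((c k ^ 2)⁻¹ * (1 / ((M : ℝ) - K))) := by
  have hcurry := Measure.infinitePi_map_curry
    (fun (_ : Fin K) (_ : Fin M) => stdComplexGaussian)
  rw [← lintegral_sum_normSq_zfVec_pi hKM hc k, ← Measure.infinitePi_eq_pi, gaussianFamily,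
    ← hcurry, lintegral_map_equiv]
  rfl

theorem ae_linearIndependent_gaussianFamily (hKM : K ≤ M) :
    ∀ᵐ y ∂(gaussianFamily (Fin K × Fin M)), LinearIndependent ℂ fun j m => y (j, m) := by
  have hcurry := Measure.infinitePi_map_curry
    (fun (_ : Fin K) (_ : Fin M) => stdComplexGaussian)
  have h := ae_linearIndependent_gaussian hKM
  rw [← Measure.infinitePi_eq_pi, gaussianFamily, ← hcurry] at h
  exact ae_of_ae_map (MeasurableEquiv.measurable _).aemeasurable h

end ZeroForcingNorm

/-! ### Covariances of observations and errors, and mean power per UE. -/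

section SecondOrder

variable {K : ℕ} {ι : Fin K → Type} (M : ℕ) (β : UE ι → ℝ)

/-- The channel entries in the Gaussian Hilbert space. -/
noncomputable def gaussChannel (u : UE ι) (m : Fin M) : Lp ℂ 2 (gaussianFamily (UE ι × Fin M)) :=
  (Real.sqrt (β u) : ℂ) • gaussianCoord (u, m)

/-- The pilot observations in the Gaussian Hilbert space. -/
noncomputable def gaussObs (k : Fin K) (m : Fin M) : Lp ℂ 2 (gaussianFamily (UE ι × Fin M)) :=
  gaussChannel M β ⟨k, none⟩ m + ∑' y : ι k, gaussChannel M β ⟨k, some y⟩ m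

/-- The estimation errors in the Gaussian Hilbert space. -/
noncomputable def gaussError (u : UE ι) (m : Fin M) : Lp ℂ 2 (gaussianFamily (UE ι × Fin M)) :=
  gaussChannel M β u m - (mmseCoeff β u : ℂ) • gaussObs M β u.1 m

/-- The variance of an entry of the estimation error. -/
noncomputable def errorVar (u : UE ι) : ℝ := β u - β u ^ 2 / alpha β u.1

/-- The normalized pilot observations. -/
noncomputable def whiteObs (i : Fin K × Fin M) : Lp ℂ 2 (gaussianFamily (UE ι × Fin M)) :=
  ((Real.sqrt (alpha β i.1))⁻¹ : ℂ) • gaussObs M β i.1 i.2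

variable {M β}

theorem channelVec_eq (u : UE ι) (h : UE ι × Fin M → ℂ) :
    channelVec M β u h = fun m => gaussChannel M β u m h := rfl

open Classical in
theorem inner_gaussChannel (hβ : ∀ u, 0 < β u) (u u' : UE ι) (m m' : Fin M) :
    inner ℂ (gaussChannel M β u m) (gaussChannel M β u' m')
      = if u = u' ∧ m = m' then (β u : ℂ) else 0 := by
  have h := orthonormal_iff_ite.1 (orthonormal_gaussianCoord (N := UE ι × Fin M)) (u, m) (u', m')
  rw [gaussChannel, gaussChannel, inner_smul_left, inner_smul_right, h, Complex.conj_ofReal]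
  simp only [Prod.mk.injEq]
  split_ifs with hu
  · rw [← hu.1, mul_one, ← Complex.ofReal_mul, Real.mul_self_sqrt (hβ u).le]
  · simp

theorem gaussChannel_mem (u : UE ι) (m : Fin M) :
    gaussChannel M β u m ∈ gaussianSpace (UE ι × Fin M) :=
  Submodule.smul_mem _ _ (gaussianCoord_mem _)

/-- An orthogonal series converges in L² exactly when its squared norms, here the gains, are
summable. This makes the infinite sum in the pilot observation a genuine limit. -/
theorem summable_gaussChannel (hβ : ∀ u, 0 < β u)
    (hs : ∀ k, Summable fun y : ι k => β ⟨k, some y⟩) (k : Fin K) (m : Fin M) :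
    Summable fun y : ι k => gaussChannel M β ⟨k, some y⟩ m := by
  have ho : Orthonormal ℂ fun y : ι k =>
      gaussianCoord (((⟨k, some y⟩ : UE ι), m) : UE ι × Fin M) :=
    orthonormal_gaussianCoord.comp _ fun y y' h => by simpa using h
  have h := (ho.orthogonalFamily.summable_iff_norm_sq_summable
    fun y => (Real.sqrt (β ⟨k, some y⟩) : ℂ)).2 (by
      simpa [Real.sq_sqrt (hβ _).le] using hs k)
  simp only [LinearIsometry.toSpanSingleton_apply] at h
  exact h

theorem gaussObs_mem (hβ : ∀ u, 0 < β u)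
    (hs : ∀ k, Summable fun y : ι k => β ⟨k, some y⟩) (k : Fin K) (m : Fin M) :
    gaussObs M β k m ∈ gaussianSpace (UE ι × Fin M) := by
  refine Submodule.add_mem _ (gaussChannel_mem _ _) ?_
  have hcl : IsClosed (gaussianSpace (UE ι × Fin M) :
      Set (Lp ℂ 2 (gaussianFamily (UE ι × Fin M)))) :=
    Submodule.isClosed_topologicalClosure
      (Submodule.span ℂ (Set.range (gaussianCoord (N := UE ι × Fin M))))
  exact hcl.mem_of_tendsto (summable_gaussChannel hβ hs k m).hasSum
    (Filter.Eventually.of_forall fun s => Submodule.sum_mem _ fun y _ => gaussChannel_mem _ _)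

theorem inner_gaussObs_right (hβ : ∀ u, 0 < β u)
    (hs : ∀ k, Summable fun y : ι k => β ⟨k, some y⟩)
    (z : Lp ℂ 2 (gaussianFamily (UE ι × Fin M))) (k : Fin K) (m : Fin M) :
    inner ℂ z (gaussObs M β k m) = inner ℂ z (gaussChannel M β ⟨k, none⟩ m)
      + ∑' y : ι k, inner ℂ z (gaussChannel M β ⟨k, some y⟩ m) := by
  rw [gaussObs, inner_add_right]
  congr 1
  exact (innerSL ℂ z).map_tsum (summable_gaussChannel hβ hs k m)

theorem inner_gaussChannel_gaussObs (hβ : ∀ u, 0 < β u)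
    (hs : ∀ k, Summable fun y : ι k => β ⟨k, some y⟩) (u : UE ι) (k : Fin K) (m m' : Fin M) :
    inner ℂ (gaussChannel M β u m) (gaussObs M β k m')
      = if u.1 = k ∧ m = m' then (β u : ℂ) else 0 := by
  rw [inner_gaussObs_right hβ hs]
  simp only [inner_gaussChannel hβ]
  obtain ⟨k', v⟩ := u
  by_cases hm : m = m'
  · by_cases hk : k' = k
    · subst hk hm
      cases v with
      | none => simp
      | some y₀ =>
        rw [tsum_eq_single y₀]
        · simp
        · intro y hy
          simp [hy.symm]
    · simp [hk]
  · simp [hm]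

theorem inner_gaussObs_gaussChannel (hβ : ∀ u, 0 < β u)
    (hs : ∀ k, Summable fun y : ι k => β ⟨k, some y⟩) (u : UE ι) (k : Fin K) (m m' : Fin M) :
    inner ℂ (gaussObs M β k m') (gaussChannel M β u m)
      = if u.1 = k ∧ m = m' then (β u : ℂ) else 0 := by
  rw [← inner_conj_symm, inner_gaussChannel_gaussObs hβ hs]
  split_ifs <;> simp

theorem inner_gaussObs (hβ : ∀ u, 0 < β u)
    (hs : ∀ k, Summable fun y : ι k => β ⟨k, some y⟩) (k k' : Fin K) (m m' : Fin M) :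
    inner ℂ (gaussObs M β k m) (gaussObs M β k' m')
      = if k = k' ∧ m = m' then (alpha β k : ℂ) else 0 := by
  rw [inner_gaussObs_right hβ hs]
  simp only [inner_gaussObs_gaussChannel hβ hs]
  by_cases h : k = k' ∧ m = m'
  · obtain ⟨rfl, rfl⟩ := h
    simp [alpha, Complex.ofReal_tsum]
  · have h' : ¬ (k' = k ∧ m' = m) := fun h'' => h ⟨h''.1.symm, h''.2.symm⟩
    simp [h, h']

theorem alpha_pos (hβ : ∀ u, 0 < β u) (k : Fin K) : 0 < alpha β k :=
  add_pos_of_pos_of_nonneg (hβ _) (tsum_nonneg fun _ => (hβ _).le)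

theorem le_alpha (hβ : ∀ u, 0 < β u) (hs : ∀ k, Summable fun y : ι k => β ⟨k, some y⟩)
    (u : UE ι) : β u ≤ alpha β u.1 := by
  obtain ⟨k, v⟩ := u
  cases v with
  | none => exact le_add_of_nonneg_right (tsum_nonneg fun _ => (hβ _).le)
  | some y =>
    exact ((hs k).le_tsum y fun _ _ => (hβ _).le).trans (le_add_of_nonneg_left (hβ _).le)

theorem errorVar_nonneg (hβ : ∀ u, 0 < β u) (hs : ∀ k, Summable fun y : ι k => β ⟨k, some y⟩)
    (u : UE ι) : 0 ≤ errorVar β u := by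
  have h1 := le_alpha hβ hs u
  have h2 := alpha_pos hβ u.1
  rw [errorVar, sub_nonneg, div_le_iff₀ h2, sq]
  exact mul_le_mul_of_nonneg_left h1 (hβ u).le

/-- The orthogonality principle: β_u / α is the projection coefficient of g_u onto the observation
on its own pilot, and observations on other pilots involve different UEs. -/
theorem inner_gaussObs_gaussError (hβ : ∀ u, 0 < β u)
    (hs : ∀ k, Summable fun y : ι k => β ⟨k, some y⟩) (u : UE ι) (k : Fin K) (m m' : Fin M) :
    inner ℂ (gaussObs M β k m) (gaussError M β u m') = 0 := by
  have hα : (alpha β k : ℂ) ≠ 0 := by exact_mod_cast (alpha_pos hβ k).ne'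
  rw [gaussError, inner_sub_right, inner_smul_right, inner_gaussObs_gaussChannel hβ hs,
    inner_gaussObs hβ hs]
  by_cases h : u.1 = k ∧ m' = m
  · obtain ⟨rfl, rfl⟩ := h
    simp only [and_self, if_true, mmseCoeff]
    push_cast
    field_simp
    simp
  · have h' : ¬ (k = u.1 ∧ m = m') := fun h'' => h ⟨h''.1.symm, h''.2.symm⟩
    simp [h, h']

theorem inner_gaussError (hβ : ∀ u, 0 < β u)
    (hs : ∀ k, Summable fun y : ι k => β ⟨k, some y⟩) (u : UE ι) (m m' : Fin M) :
    inner ℂ (gaussError M β u m) (gaussError M β u m')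
      = if m = m' then (errorVar β u : ℂ) else 0 := by
  -- Only the left error is expanded: its observation part is orthogonal to the right error and
  -- drops out.
  conv_lhs => arg 2; rw [gaussError]
  rw [inner_sub_left, inner_smul_left, inner_gaussObs_gaussError hβ hs, mul_zero, sub_zero,
    gaussError, inner_sub_right, inner_smul_right, inner_gaussChannel hβ,
    inner_gaussChannel_gaussObs hβ hs]
  by_cases h : m = m'
  · simp only [h, and_self, if_true, mmseCoeff, errorVar]
    push_cast
    ring
  · simp [h]

theorem gaussError_mem (hβ : ∀ u, 0 < β u)
    (hs : ∀ k, Summable fun y : ι k => β ⟨k, some y⟩) (u : UE ι) (m : Fin M) :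
    gaussError M β u m ∈ gaussianSpace (UE ι × Fin M) :=
  Submodule.sub_mem _ (gaussChannel_mem _ _) (Submodule.smul_mem _ _ (gaussObs_mem hβ hs _ _))

theorem orthonormal_whiteObs (hβ : ∀ u, 0 < β u)
    (hs : ∀ k, Summable fun y : ι k => β ⟨k, some y⟩) :
    Orthonormal ℂ (whiteObs M β) := by
  rw [orthonormal_iff_ite]
  rintro ⟨k, m⟩ ⟨k', m'⟩
  simp only [whiteObs, inner_smul_left, inner_smul_right, inner_gaussObs hβ hs, Prod.mk.injEq,
    map_inv₀, Complex.conj_ofReal]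
  split_ifs with h
  · rw [← h.1]
    have hα := Real.sqrt_pos.2 (alpha_pos hβ k)
    have h1 : (Real.sqrt (alpha β k) : ℂ) ≠ 0 := by exact_mod_cast hα.ne'
    have h2 : (alpha β k : ℂ) = Real.sqrt (alpha β k) * Real.sqrt (alpha β k) := by
      exact_mod_cast (Real.mul_self_sqrt (alpha_pos hβ k).le).symm
    conv_lhs => arg 2; arg 2; rw [h2]
    field_simp
  · simp

theorem whiteObs_mem (hβ : ∀ u, 0 < β u)
    (hs : ∀ k, Summable fun y : ι k => β ⟨k, some y⟩) (i : Fin K × Fin M) :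
    whiteObs M β i ∈ gaussianSpace (UE ι × Fin M) :=
  Submodule.smul_mem _ _ (gaussObs_mem hβ hs _ _)

/-- The scale of the intra-cell estimates relative to the normalized observations. -/
noncomputable def estimateScale (β : UE ι → ℝ) (k : Fin K) : ℝ :=
  β ⟨k, none⟩ / Real.sqrt (alpha β k)

theorem estimateScale_pos (hβ : ∀ u, 0 < β u) (k : Fin K) : 0 < estimateScale β k :=
  div_pos (hβ _) (Real.sqrt_pos.2 (alpha_pos hβ k))

theorem ae_estimateVec (hβ : ∀ u, 0 < β u) :
    ∀ᵐ h ∂(gaussianFamily (UE ι × Fin M)), ∀ k m,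
      estimateVec M β ⟨k, none⟩ h m = (estimateScale β k : ℂ) * whiteObs M β (k, m) h := by
  rw [ae_all_iff]
  intro k
  rw [ae_all_iff]
  intro m
  filter_upwards [Lp.coeFn_smul (mmseCoeff β ⟨k, none⟩ : ℂ) (gaussObs M β k m),
    Lp.coeFn_smul ((Real.sqrt (alpha β k))⁻¹ : ℂ) (gaussObs M β k m)] with h h1 h2
  have hα := Real.sqrt_pos.2 (alpha_pos hβ k)
  have hα' : (Real.sqrt (alpha β k) : ℂ) ≠ 0 := by exact_mod_cast hα.ne'
  have hsq : Real.sqrt (alpha β k) ^ 2 = alpha β k := Real.sq_sqrt (alpha_pos hβ k).le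
  have hsq' : (alpha β k : ℂ) = (Real.sqrt (alpha β k) : ℂ) ^ 2 := by exact_mod_cast hsq.symm
  have e1 : estimateVec M β ⟨k, none⟩ h m = (mmseCoeff β ⟨k, none⟩ : ℂ) * gaussObs M β k m h := h1
  have e2 : whiteObs M β (k, m) h = (Real.sqrt (alpha β k) : ℂ)⁻¹ * gaussObs M β k m h := h2
  rw [e1, e2, mmseCoeff, estimateScale]
  push_cast
  conv_lhs => rw [hsq']
  field_simp

theorem ae_errorVec :
    ∀ u : UE ι, ∀ᵐ h ∂(gaussianFamily (UE ι × Fin M)),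
      errorVec M β u h = fun m => gaussError M β u m h := by
  intro u
  have : ∀ᵐ h ∂(gaussianFamily (UE ι × Fin M)), ∀ m, gaussError M β u m h
      = gaussChannel M β u m h - ((mmseCoeff β u : ℂ) • gaussObs M β u.1 m : Lp ℂ 2 _) h := by
    rw [ae_all_iff]
    intro m
    exact Lp.coeFn_sub _ _
  filter_upwards [this] with h hh
  ext m
  rw [hh]
  rfl

theorem ae_estimateMatrix (hβ : ∀ u, 0 < β u) :
    ∀ᵐ h ∂(gaussianFamily (UE ι × Fin M)), estimateMatrix M β h
      = scaledColumns (estimateScale β) fun j m => whiteObs M β (j, m) h := by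
  filter_upwards [ae_estimateVec (M := M) hβ] with h hh
  ext m j
  simp [estimateMatrix, scaledColumns, hh]

theorem ae_linearIndependent_estimate (hβ : ∀ u, 0 < β u)
    (hs : ∀ k, Summable fun y : ι k => β ⟨k, some y⟩) (hKM : K ≤ M) :
    ∀ᵐ h ∂(gaussianFamily (UE ι × Fin M)), LinearIndependent ℂ (estimateMatrix M β h).col := by
  have h := ae_linearIndependent_gaussianFamily hKM
  rw [← map_orthonormal_eq_gaussianFamily (orthonormal_whiteObs hβ hs) (whiteObs_mem hβ hs)] at h
  filter_upwards [ae_of_ae_map (measurable_Lp_family _).aemeasurable h, ae_estimateMatrix hβ]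
    with h h1 h2
  rw [h2]
  exact linearIndependent_scaledColumns (fun j => (estimateScale_pos hβ j).ne') h1

/-- All UEs on a pilot have estimates proportional to the same observation. The receiver nulls the
estimate of the in-cell UE on that pilot, hence that of `u`, inside or outside the cell. -/
theorem ae_rxPower_zf_channelVec (hβ : ∀ u, 0 < β u)
    (hs : ∀ k, Summable fun y : ι k => β ⟨k, some y⟩) (hKM : K ≤ M) (k : Fin K) (u : UE ι)
    (hu : u.1 ≠ k) :
    ∀ᵐ h ∂(gaussianFamily (UE ι × Fin M)), rxPower (zfReceiver M β k h) (channelVec M β u h)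
      = rxPower (zfReceiver M β k h) (errorVec M β u h) := by
  have hc0 : (mmseCoeff β ⟨u.1, none⟩ : ℂ) ≠ 0 := by
    exact_mod_cast (div_pos (hβ ⟨u.1, none⟩) (alpha_pos hβ u.1)).ne'
  have hest : ∀ᵐ h ∂(gaussianFamily (UE ι × Fin M)), ∀ m, estimateVec M β u h m
      = (mmseCoeff β u : ℂ) / mmseCoeff β ⟨u.1, none⟩ * estimateVec M β ⟨u.1, none⟩ h m := by
    rw [ae_all_iff]
    intro m
    filter_upwards [Lp.coeFn_smul (mmseCoeff β u : ℂ) (gaussObs M β u.1 m),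
      Lp.coeFn_smul (mmseCoeff β ⟨u.1, none⟩ : ℂ) (gaussObs M β u.1 m)] with h h1 h2
    have e1 : estimateVec M β u h m = (mmseCoeff β u : ℂ) * gaussObs M β u.1 m h := h1
    have e2 : estimateVec M β ⟨u.1, none⟩ h m
        = (mmseCoeff β ⟨u.1, none⟩ : ℂ) * gaussObs M β u.1 m h := h2
    rw [e1, e2]
    field_simp
  filter_upwards [hest, ae_linearIndependent_estimate hβ hs hKM] with h h1 h2
  have hzf := star_zfVec_dotProduct h2 k u.1
  rw [if_neg hu] at hzf
  have h0 : star (zfReceiver M β k h) ⬝ᵥ estimateVec M β u h = 0 := by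
    have : estimateVec M β u h = ((mmseCoeff β u : ℂ) / mmseCoeff β ⟨u.1, none⟩) •
        (estimateMatrix M β h).col u.1 := by
      ext m
      rw [h1 m]
      rfl
    rw [this, dotProduct_smul, zfReceiver_eq_zfVec, hzf, smul_zero]
  rw [rxPower, rxPower, errorVec, dotProduct_sub, h0, sub_zero]

/-- The receiver is a function of the white observations, to which every error is orthogonal,
including errors on pilot `k` itself. The power is thus the error variance times E‖w_k‖². -/
theorem lintegral_rxPower_zf_errorVec (hβ : ∀ u, 0 < β u)
    (hs : ∀ k, Summable fun y : ι k => β ⟨k, some y⟩) (hKM : K < M) (k : Fin K) (u : UE ι) :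
    ∫⁻ h, rxPower (zfReceiver M β k h) (errorVec M β u h) ∂(gaussianFamily (UE ι × Fin M))
      = ENNReal.ofReal (errorVar β u) *
        ENNReal.ofReal (alpha β k / β ⟨k, none⟩ ^ 2 * (1 / ((M : ℝ) - K))) := by
  have hw : Measurable fun y : Fin K × Fin M → ℂ =>
      zfVec (scaledColumns (estimateScale β) fun j m => y (j, m)) k :=
    measurable_zfVec (fun m j => by simp only [scaledColumns, Matrix.of_apply]; fun_prop) k
  have h := lintegral_rxPower_of_orthogonal (errorVar_nonneg hβ hs u) (orthonormal_whiteObs hβ hs)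
    (whiteObs_mem hβ hs) (gaussError_mem (M := M) hβ hs u) (inner_gaussError hβ hs u)
    (fun j m => by
      rw [whiteObs, inner_smul_left, inner_gaussObs_gaussError hβ hs, mul_zero]) hw
  rw [lintegral_sum_normSq_zfVec hKM (fun j => (estimateScale_pos hβ j).ne'), estimateScale,
    div_pow, Real.sq_sqrt (alpha_pos hβ k).le, inv_div] at h
  rw [← h]
  refine lintegral_congr_ae ?_
  filter_upwards [ae_estimateMatrix hβ, ae_errorVec u] with h h1 h2
  rw [zfReceiver_eq_zfVec, h1, h2]

theorem lintegral_rxPower_zf_channelVec (hβ : ∀ u, 0 < β u)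
    (hs : ∀ k, Summable fun y : ι k => β ⟨k, some y⟩) (hKM : K < M) (k : Fin K) (u : UE ι)
    (hu : u.1 ≠ k) :
    ∫⁻ h, rxPower (zfReceiver M β k h) (channelVec M β u h) ∂(gaussianFamily (UE ι × Fin M))
      = ENNReal.ofReal (errorVar β u) *
        ENNReal.ofReal (alpha β k / β ⟨k, none⟩ ^ 2 * (1 / ((M : ℝ) - K))) := by
  rw [lintegral_congr_ae (ae_rxPower_zf_channelVec hβ hs hKM.le k u hu),
    lintegral_rxPower_zf_errorVec hβ hs hKM]

/-- The receiver depends only on the observation on pilot `k`, which is orthogonal to channels on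
other pilots, and its squared norm is almost surely the constant α_k / M. -/
theorem lintegral_rxPower_mrc_channelVec (hβ : ∀ u, 0 < β u)
    (hs : ∀ k, Summable fun y : ι k => β ⟨k, some y⟩) (hKM : K < M) (k : Fin K) (u : UE ι)
    (hu : u.1 ≠ k) :
    ∫⁻ h, rxPower (mrcReceiver M β k h) (channelVec M β u h) ∂(gaussianFamily (UE ι × Fin M))
      = ENNReal.ofReal (β u) * ENNReal.ofReal (alpha β k / M) := by
  have : Nonempty (Fin M) := ⟨⟨0, by omega⟩⟩
  set c := estimateScale β k with hc_def
  have hc : 0 < c := estimateScale_pos hβ k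
  set w : (Fin M → ℂ) → Fin M → ℂ := fun y m =>
    ((Real.sqrt (alpha β k / M) / Real.sqrt (∑ m, ‖(c : ℂ) * y m‖ ^ 2) : ℝ) : ℂ)
      * ((c : ℂ) * y m) with hw_def
  have hw : Measurable w := by
    refine measurable_pi_lambda _ fun m => ?_
    have : Measurable fun y : Fin M → ℂ =>
      Real.sqrt (alpha β k / M) / Real.sqrt (∑ m, ‖(c : ℂ) * y m‖ ^ 2) := by fun_prop
    simp only [hw_def]
    fun_prop
  have hwnorm : ∀ᵐ y ∂(gaussianFamily (Fin M)), ENNReal.ofReal (∑ m, ‖w y m‖ ^ 2)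
      = ENNReal.ofReal (alpha β k / M) := by
    filter_upwards [ae_sum_normSq_pos (J := Fin M)] with y hy
    have hpos : 0 < ∑ m, ‖(c : ℂ) * y m‖ ^ 2 := by
      simp only [norm_mul, mul_pow, ← Finset.mul_sum]
      have : 0 < ‖(c : ℂ)‖ := by rw [Complex.norm_real]; exact abs_pos.2 hc.ne'
      positivity
    have hαM : 0 ≤ alpha β k / M := div_nonneg (alpha_pos hβ k).le (Nat.cast_nonneg _)
    simp only [hw_def]
    congr 1
    have : ∀ m, ‖((Real.sqrt (alpha β k / M) / Real.sqrt (∑ m, ‖(c : ℂ) * y m‖ ^ 2) : ℝ) : ℂ)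
        * ((c : ℂ) * y m)‖ ^ 2
        = (alpha β k / M) / (∑ m, ‖(c : ℂ) * y m‖ ^ 2) * ‖(c : ℂ) * y m‖ ^ 2 := by
      intro m
      rw [norm_mul, mul_pow, Complex.norm_real, Real.norm_eq_abs, sq_abs, div_pow,
        Real.sq_sqrt hαM, Real.sq_sqrt hpos.le]
    rw [Finset.sum_congr rfl fun m _ => this m, ← Finset.mul_sum, div_mul_cancel₀ _ hpos.ne']
  have ho : Orthonormal ℂ fun m => whiteObs M β (k, m) :=
    (orthonormal_whiteObs hβ hs).comp _ fun m m' h => by simpa using h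
  have h := lintegral_rxPower_of_orthogonal (hβ u).le ho
    (fun m => whiteObs_mem hβ hs _) (gaussChannel_mem (M := M) u)
    (fun m m' => by rw [inner_gaussChannel hβ]; simp only [true_and])
    (fun j m => by
      rw [whiteObs, inner_smul_left, inner_gaussObs_gaussChannel hβ hs, if_neg (by simp [hu]),
        mul_zero]) hw
  rw [lintegral_congr_ae hwnorm] at h
  simp only [lintegral_const, measure_univ, mul_one] at h
  rw [← h]
  refine lintegral_congr_ae ?_
  filter_upwards [ae_estimateVec hβ] with h h1
  have : mrcReceiver M β k h = w fun m => whiteObs M β (k, m) h := by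
    ext m
    simp [mrcReceiver, hw_def, h1, hc_def]
  rw [this, channelVec_eq]

end SecondOrder

/-! ### Closed forms of the interference powers for fixed locations. -/

section MeanPowers

variable {K M : ℕ} {ι : Fin K → Type} {β : UE ι → ℝ}

/-- A summable family has countable support. Countability is what permits exchanging the sum over
outer UEs with the integral over the fading. -/
theorem countable_of_summable_gain (hβ : ∀ u, 0 < β u)
    (hs : ∀ k, Summable fun y : ι k => β ⟨k, some y⟩) (k : Fin K) : Countable (ι k) := by
  have h := (hs k).countable_support
  have h2 : (Function.support fun y : ι k => β ⟨k, some y⟩) = Set.univ :=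
    Set.eq_univ_of_forall fun y => (hβ _).ne'
  rw [h2] at h
  exact Set.countable_univ_iff.1 h

theorem summable_errorVar (hβ : ∀ u, 0 < β u)
    (hs : ∀ k, Summable fun y : ι k => β ⟨k, some y⟩) (k : Fin K) :
    Summable fun y : ι k => errorVar β ⟨k, some y⟩ :=
  Summable.of_nonneg_of_le (fun _ => errorVar_nonneg hβ hs _)
    (fun _ => sub_le_self _ (div_nonneg (sq_nonneg _) (alpha_pos hβ k).le)) (hs k)

theorem measurable_channelVec (u : UE ι) : Measurable (channelVec M β u) :=
  measurable_pi_lambda _ fun m => (Lp.stronglyMeasurable (channel M β u m)).measurable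

theorem measurable_estimateVec (u : UE ι) : Measurable (estimateVec M β u) :=
  measurable_pi_lambda _ fun m => (Lp.stronglyMeasurable (estimate M β u m)).measurable

theorem measurable_errorVec (u : UE ι) : Measurable (errorVec M β u) :=
  (measurable_channelVec u).sub (measurable_estimateVec u)

theorem measurable_zfReceiver (k : Fin K) : Measurable (zfReceiver M β k) :=
  measurable_zfVec (fun m j => (measurable_pi_apply m).comp (measurable_estimateVec ⟨j, none⟩)) k

theorem measurable_mrcReceiver (k : Fin K) : Measurable (mrcReceiver M β k) := by
  have h := measurable_estimateVec (M := M) (β := β) ⟨k, none⟩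
  have hm : ∀ m, Measurable fun a => estimateVec M β ⟨k, none⟩ a m :=
    fun m => (measurable_pi_apply m).comp h
  have h1 : Measurable fun a => Real.sqrt (alpha β k / M) /
      Real.sqrt (∑ m, ‖estimateVec M β ⟨k, none⟩ a m‖ ^ 2) := by fun_prop
  refine measurable_pi_lambda _ fun m => ?_
  simp only [mrcReceiver, Pi.smul_apply, smul_eq_mul]
  exact (Complex.measurable_ofReal.comp h1).mul (hm m)

/-- The error term of x_k supplies the summand missing from the sum over the other pilots, and the
normalization β_{x_k}² cancels the denominator of E‖w_k‖². -/
theorem intraZF_eq (hβ : ∀ u, 0 < β u) (hs : ∀ k, Summable fun y : ι k => β ⟨k, some y⟩)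
    (hKM : K < M) (k : Fin K) :
    intraZF M β k = ENNReal.ofReal
      (alpha β k / ((M : ℝ) - K) * ∑ k', errorVar β ⟨k', none⟩) := by
  have hMK : 0 < (M : ℝ) - K := sub_pos.2 (by exact_mod_cast hKM)
  have hα := alpha_pos hβ k
  have hb := hβ ⟨k, none⟩
  change ENNReal.ofReal (β ⟨k, none⟩ ^ 2) *
    ∫⁻ h, (∑ k' ∈ Finset.univ.erase k,
          rxPower (zfReceiver M β k h) (channelVec M β ⟨k', none⟩ h)
        + rxPower (zfReceiver M β k h) (errorVec M β ⟨k, none⟩ h))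
      ∂(gaussianFamily (UE ι × Fin M)) = _
  rw [lintegral_add_right _ (measurable_rxPower (measurable_zfReceiver k) (measurable_errorVec _)),
    lintegral_finsetSum _ fun k' _ =>
      measurable_rxPower (measurable_zfReceiver k) (measurable_channelVec _),
    lintegral_rxPower_zf_errorVec hβ hs hKM,
    Finset.sum_congr rfl fun k' hk' =>
      lintegral_rxPower_zf_channelVec hβ hs hKM k ⟨k', none⟩ (Finset.ne_of_mem_erase hk'),
    Finset.sum_erase_add _ _ (Finset.mem_univ k), ← Finset.sum_mul,
    ← ENNReal.ofReal_sum_of_nonneg fun k' _ => errorVar_nonneg hβ hs _,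
    ← ENNReal.ofReal_mul (Finset.sum_nonneg fun k' _ => errorVar_nonneg hβ hs _),
    ← ENNReal.ofReal_mul (sq_nonneg _)]
  congr 1
  field_simp

theorem interZF_eq (hβ : ∀ u, 0 < β u) (hs : ∀ k, Summable fun y : ι k => β ⟨k, some y⟩)
    (hKM : K < M) (k : Fin K) :
    interZF M β k = ENNReal.ofReal
      (alpha β k / ((M : ℝ) - K) * ∑ k', ∑' y : ι k', errorVar β ⟨k', some y⟩) := by
  have hcount := countable_of_summable_gain hβ hs
  have hMK : 0 < (M : ℝ) - K := sub_pos.2 (by exact_mod_cast hKM)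
  have hα := alpha_pos hβ k
  have hb := hβ ⟨k, none⟩
  change ENNReal.ofReal (β ⟨k, none⟩ ^ 2) *
    ∫⁻ h, (∑ k' ∈ Finset.univ.erase k, ∑' y : ι k',
          rxPower (zfReceiver M β k h) (channelVec M β ⟨k', some y⟩ h)
        + ∑' y : ι k, rxPower (zfReceiver M β k h) (errorVec M β ⟨k, some y⟩ h))
      ∂(gaussianFamily (UE ι × Fin M)) = _
  have hm1 : ∀ u, Measurable fun h => rxPower (zfReceiver M β k h) (errorVec M β u h) :=
    fun u => measurable_rxPower (measurable_zfReceiver k) (measurable_errorVec _)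
  have hm2 : ∀ u, Measurable fun h => rxPower (zfReceiver M β k h) (channelVec M β u h) :=
    fun u => measurable_rxPower (measurable_zfReceiver k) (measurable_channelVec _)
  have hsum : ∀ k', 0 ≤ ∑' y : ι k', errorVar β ⟨k', some y⟩ :=
    fun k' => tsum_nonneg fun y => errorVar_nonneg hβ hs _
  have hpilot : ∀ k' ∈ Finset.univ.erase k, ∫⁻ h, ∑' y : ι k',
        rxPower (zfReceiver M β k h) (channelVec M β ⟨k', some y⟩ h)
          ∂(gaussianFamily (UE ι × Fin M))
      = ENNReal.ofReal (∑' y : ι k', errorVar β ⟨k', some y⟩) *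
        ENNReal.ofReal (alpha β k / β ⟨k, none⟩ ^ 2 * (1 / ((M : ℝ) - K))) := by
    intro k' hk'
    rw [lintegral_tsum fun y => (hm2 _).aemeasurable]
    simp_rw [lintegral_rxPower_zf_channelVec hβ hs hKM k ⟨k', some _⟩ (Finset.ne_of_mem_erase hk')]
    rw [ENNReal.tsum_mul_right, ENNReal.ofReal_tsum_of_nonneg (fun y => errorVar_nonneg hβ hs _)
      (summable_errorVar hβ hs k')]
  have hown : ∫⁻ h, ∑' y : ι k, rxPower (zfReceiver M β k h) (errorVec M β ⟨k, some y⟩ h)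
        ∂(gaussianFamily (UE ι × Fin M))
      = ENNReal.ofReal (∑' y : ι k, errorVar β ⟨k, some y⟩) *
        ENNReal.ofReal (alpha β k / β ⟨k, none⟩ ^ 2 * (1 / ((M : ℝ) - K))) := by
    rw [lintegral_tsum fun y => (hm1 _).aemeasurable]
    simp_rw [lintegral_rxPower_zf_errorVec hβ hs hKM k]
    rw [ENNReal.tsum_mul_right, ENNReal.ofReal_tsum_of_nonneg (fun y => errorVar_nonneg hβ hs _)
      (summable_errorVar hβ hs k)]
  rw [lintegral_add_right _ (Measurable.tsum fun y => hm1 _),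
    lintegral_finsetSum _ fun k' _ => Measurable.tsum fun y => hm2 _,
    hown, Finset.sum_congr rfl hpilot,
    Finset.sum_erase_add _ _ (Finset.mem_univ k), ← Finset.sum_mul,
    ← ENNReal.ofReal_sum_of_nonneg fun k' _ => hsum k',
    ← ENNReal.ofReal_mul (Finset.sum_nonneg fun k' _ => hsum k'),
    ← ENNReal.ofReal_mul (sq_nonneg _)]
  congr 1
  field_simp

/-- Every pilot, `k` included, contributes α_k / M times its outer gain to the MRC power; the factor
M / (M - K) gives it the same prefactor as the ZF powers. -/
theorem upperZF_eq (hβ : ∀ u, 0 < β u) (hs : ∀ k, Summable fun y : ι k => β ⟨k, some y⟩)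
    (hKM : K < M) (k : Fin K) :
    upperZF M β k = ENNReal.ofReal
      (alpha β k / ((M : ℝ) - K) * ∑ k', ∑' y : ι k', β ⟨k', some y⟩) := by
  have hcount := countable_of_summable_gain hβ hs
  have hMK : 0 < (M : ℝ) - K := sub_pos.2 (by exact_mod_cast hKM)
  have hM : 0 < (M : ℝ) := by exact_mod_cast (Nat.zero_le K).trans_lt hKM
  have hα := alpha_pos hβ k
  have hm : ∀ u, Measurable fun h => rxPower (mrcReceiver M β k h) (channelVec M β u h) :=
    fun u => measurable_rxPower (measurable_mrcReceiver k) (measurable_channelVec _)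
  have hsum : ∀ k', 0 ≤ ∑' y : ι k', β ⟨k', some y⟩ := fun k' => tsum_nonneg fun y => (hβ _).le
  have hpilot : ∀ k' ∈ Finset.univ.erase k, ∫⁻ h, ∑' y : ι k',
        rxPower (mrcReceiver M β k h) (channelVec M β ⟨k', some y⟩ h)
          ∂(gaussianFamily (UE ι × Fin M))
      = ENNReal.ofReal (∑' y : ι k', β ⟨k', some y⟩) * ENNReal.ofReal (alpha β k / M) := by
    intro k' hk'
    rw [lintegral_tsum fun y => (hm _).aemeasurable]
    simp_rw [lintegral_rxPower_mrc_channelVec hβ hs hKM k ⟨k', some _⟩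
      (Finset.ne_of_mem_erase hk')]
    rw [ENNReal.tsum_mul_right, ENNReal.ofReal_tsum_of_nonneg (fun y => (hβ _).le) (hs k')]
  change ENNReal.ofReal ((M : ℝ) / ((M : ℝ) - (K : ℝ))) *
    ((∫⁻ h, (∑ k' ∈ Finset.univ.erase k, ∑' y : ι k',
      rxPower (mrcReceiver M β k h) (channelVec M β ⟨k', some y⟩ h))
        ∂(gaussianFamily (UE ι × Fin M)))
      + ENNReal.ofReal (alpha β k / M * ∑' y : ι k, β ⟨k, some y⟩)) = _
  rw [lintegral_finsetSum _ fun k' _ => Measurable.tsum fun y => hm _,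
    Finset.sum_congr rfl hpilot, mul_comm (alpha β k / M), ENNReal.ofReal_mul (hsum k),
    Finset.sum_erase_add _ _ (Finset.mem_univ k), ← Finset.sum_mul,
    ← ENNReal.ofReal_sum_of_nonneg fun k' _ => hsum k',
    ← ENNReal.ofReal_mul (Finset.sum_nonneg fun k' _ => hsum k'),
    ← ENNReal.ofReal_mul (by positivity)]
  congr 1
  field_simp

theorem summable_sq_gain (hβ : ∀ u, 0 < β u) (hs : ∀ k, Summable fun y : ι k => β ⟨k, some y⟩)
    (k : Fin K) : Summable fun y : ι k => β ⟨k, some y⟩ ^ 2 := by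
  refine Summable.of_nonneg_of_le (fun _ => sq_nonneg _) (fun y => ?_)
    ((hs k).mul_left (alpha β k))
  rw [sq]
  exact mul_le_mul_of_nonneg_right (le_alpha hβ hs ⟨k, some y⟩) (hβ _).le

theorem tsum_errorVar (hβ : ∀ u, 0 < β u) (hs : ∀ k, Summable fun y : ι k => β ⟨k, some y⟩)
    (k : Fin K) :
    ∑' y : ι k, errorVar β ⟨k, some y⟩
      = ∑' y : ι k, β ⟨k, some y⟩ - (∑' y : ι k, β ⟨k, some y⟩ ^ 2) / alpha β k := by
  simp only [errorVar]
  rw [(hs k).tsum_sub ((summable_sq_gain hβ hs k).div_const _), tsum_div_const]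

end MeanPowers

/-! ### First two moments of a Poisson variable. -/

section PoissonMoments

open scoped Nat in
-- The Stein–Chen identity, by shifting the index in the series: (n + 1) r^{n+1} / (n + 1)! = r ·
-- r^n / n!. Taking f = 1 and f = id gives the two moments.
theorem lintegral_natCast_mul_poissonMeasure (r : ℝ≥0) (f : ℕ → ℝ≥0∞) :
    ∫⁻ n, (n : ℝ≥0∞) * f n ∂(poissonMeasure r) = r * ∫⁻ n, f (n + 1) ∂(poissonMeasure r) := by
  simp only [poissonMeasure, lintegral_sum_measure, lintegral_smul_measure, lintegral_dirac,
    smul_eq_mul]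
  rw [tsum_eq_zero_add' ENNReal.summable]
  simp only [Nat.cast_zero, zero_mul, mul_zero, zero_add]
  rw [← ENNReal.tsum_mul_left]
  congr 1
  ext n
  rw [← mul_assoc, ← mul_assoc]
  congr 1
  have h1 : ((n + 1 : ℕ) : ℝ≥0∞) = ENNReal.ofReal (n + 1 : ℝ) := by
    rw [← Nat.cast_succ, ENNReal.ofReal_natCast]
  have h2 : (r : ℝ≥0∞) = ENNReal.ofReal (r : ℝ) := (ENNReal.ofReal_coe_nnreal).symm
  rw [h1, h2, ← ENNReal.ofReal_mul (by positivity), ← ENNReal.ofReal_mul (by positivity)]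
  congr 1
  rw [Nat.factorial_succ]
  push_cast
  field_simp
  ring

theorem lintegral_natCast_poissonMeasure (r : ℝ≥0) :
    ∫⁻ n, (n : ℝ≥0∞) ∂(poissonMeasure r) = r := by
  simpa using lintegral_natCast_mul_poissonMeasure r fun _ => 1

theorem lintegral_natCast_mul_self_poissonMeasure (r : ℝ≥0) :
    ∫⁻ n, (n : ℝ≥0∞) * n ∂(poissonMeasure r) = r * r + r := by
  rw [lintegral_natCast_mul_poissonMeasure r fun n => n]
  push_cast
  rw [lintegral_add_right _ measurable_const, lintegral_natCast_poissonMeasure]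
  simp [mul_add]

end PoissonMoments

/-! ### Campbell's formulas for Poisson point processes. -/

section Campbell

/-- The counting measure of a subset of the plane, as a sum of Dirac masses. -/
noncomputable def pointMeasure (S : Set Plane) : Measure Plane :=
  Measure.sum fun y : S => Measure.dirac (y : Plane)

theorem lintegral_pointMeasure (S : Set Plane) {f : Plane → ℝ≥0∞} (hf : Measurable f) :
    ∫⁻ y, f y ∂(pointMeasure S) = ∑' y : S, f y := by
  rw [pointMeasure, lintegral_sum_measure]
  simp_rw [lintegral_dirac' _ hf]

theorem pointMeasure_apply (S : Set Plane) {B : Set Plane} (hB : MeasurableSet B) :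
    pointMeasure S B = ((S ∩ B).encard : ℝ≥0∞) := by
  rw [← lintegral_indicator_one hB, lintegral_pointMeasure S (measurable_one.indicator hB),
    ← ENNReal.tsum_set_one, tsum_subtype S (B.indicator 1), Set.indicator_indicator,
    ← tsum_subtype (S ∩ B) (1 : Plane → ℝ≥0∞)]
  rfl

/-- Measurability is with respect to the σ-algebra of the process itself, so independence of these
σ-algebras passes to functionals of the processes. -/
theorem measurable_pointMeasure_pointProcessSigma {Ω : Type*} (Φ : Ω → Set Plane) :
    Measurable[pointProcessSigma Φ] fun ω => pointMeasure (Φ ω) := by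
  refine @Measure.measurable_of_measurable_coe _ _ _ (pointProcessSigma Φ) _ fun B hB => ?_
  simp only [pointMeasure_apply _ hB]
  have h : Measurable[pointProcessSigma Φ] fun ω => (Φ ω ∩ B).encard :=
    Measurable.of_comap_le (le_iSup₂_of_le B hB le_rfl)
  exact Measurable.comp Measurable.of_discrete h

variable {Ω : Type*} [MeasurableSpace Ω] {μ : Measure Ω} {Φ : Ω → Set Plane} {Λ : Measure Plane}

theorem pointProcessSigma_le (h : IsPoissonPointProcess μ Φ Λ) :
    pointProcessSigma Φ ≤ ‹MeasurableSpace Ω› :=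
  iSup₂_le fun B hB => (h.measurable_count B hB).comap_le

theorem measurable_pointMeasure (h : IsPoissonPointProcess μ Φ Λ) :
    Measurable fun ω => pointMeasure (Φ ω) :=
  (measurable_pointMeasure_pointProcessSigma Φ).mono (pointProcessSigma_le h) le_rfl

theorem measurable_pointMeasure_apply (h : IsPoissonPointProcess μ Φ Λ) {B : Set Plane}
    (hB : MeasurableSet B) : Measurable fun ω => pointMeasure (Φ ω) B :=
  (Measure.measurable_coe hB).comp (measurable_pointMeasure h)

theorem lintegral_count (h : IsPoissonPointProcess μ Φ Λ) {B : Set Plane}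
    (hB : MeasurableSet B) (hΛ : Λ B ≠ ∞) (f : ℝ≥0∞ → ℝ≥0∞) :
    ∫⁻ ω, f (pointMeasure (Φ ω) B) ∂μ = ∫⁻ n : ℕ, f n ∂(poissonMeasure (Λ B).toNNReal) := by
  have h1 : ∫⁻ n : ℕ∞, f n ∂(μ.map fun ω => (Φ ω ∩ B).encard)
      = ∫⁻ ω, f ((Φ ω ∩ B).encard) ∂μ :=
    lintegral_map Measurable.of_discrete (h.measurable_count B hB)
  simp_rw [pointMeasure_apply _ hB]
  rw [← h1, h.law_count B hB hΛ, lintegral_map Measurable.of_discrete Measurable.of_discrete]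
  simp

theorem lintegral_pointMeasure_apply (h : IsPoissonPointProcess μ Φ Λ) {B : Set Plane}
    (hB : MeasurableSet B) (hΛ : Λ B ≠ ∞) : ∫⁻ ω, pointMeasure (Φ ω) B ∂μ = Λ B := by
  rw [lintegral_count h hB hΛ fun x => x, lintegral_natCast_poissonMeasure,
    ENNReal.coe_toNNReal hΛ]

theorem lintegral_pointMeasure_apply_mul_self (h : IsPoissonPointProcess μ Φ Λ) {B : Set Plane}
    (hB : MeasurableSet B) (hΛ : Λ B ≠ ∞) :
    ∫⁻ ω, pointMeasure (Φ ω) B * pointMeasure (Φ ω) B ∂μ = Λ B * Λ B + Λ B := by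
  rw [lintegral_count h hB hΛ fun x => x * x, lintegral_natCast_mul_self_poissonMeasure,
    ENNReal.coe_toNNReal hΛ]

theorem lintegral_pointMeasure_apply_mul_of_disjoint (h : IsPoissonPointProcess μ Φ Λ)
    {A B : Set Plane} (hA : MeasurableSet A) (hB : MeasurableSet B) (hAB : Disjoint A B)
    (hΛA : Λ A ≠ ∞) (hΛB : Λ B ≠ ∞) :
    ∫⁻ ω, pointMeasure (Φ ω) A * pointMeasure (Φ ω) B ∂μ = Λ A * Λ B := by
  have hind := h.indep_count 2 ![A, B] (by
      intro i; fin_cases i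
      · exact hA
      · exact hB) (by
      intro i j hij
      fin_cases i <;> fin_cases j
      · exact absurd rfl hij
      · exact hAB
      · exact hAB.symm
      · exact absurd rfl hij)
  have h01 := (hind.indepFun (show (0 : Fin 2) ≠ 1 by decide)).comp
    (φ := fun n : ℕ∞ => (n : ℝ≥0∞)) (ψ := fun n : ℕ∞ => (n : ℝ≥0∞))
    Measurable.of_discrete Measurable.of_discrete
  have hfun : ∀ {B : Set Plane}, MeasurableSet B → (fun n : ℕ∞ => (n : ℝ≥0∞)) ∘
      (fun ω => (Φ ω ∩ B).encard) = fun ω => pointMeasure (Φ ω) B := by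
    intro B hB
    ext ω
    rw [pointMeasure_apply _ hB]
    rfl
  simp only [Matrix.cons_val_zero, Matrix.cons_val_one] at h01
  rw [hfun hA, hfun hB] at h01
  rw [← lintegral_pointMeasure_apply h hA hΛA, ← lintegral_pointMeasure_apply h hB hΛB]
  exact lintegral_mul_eq_lintegral_mul_lintegral_of_indepFun
    (measurable_pointMeasure_apply h hA) (measurable_pointMeasure_apply h hB) h01

/-- Split A and B along A ∩ B. Counts on disjoint pieces are independent, and the square of the
count on A ∩ B contributes the extra Λ (A ∩ B). -/
theorem lintegral_pointMeasure_apply_mul (h : IsPoissonPointProcess μ Φ Λ)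
    {A B : Set Plane} (hA : MeasurableSet A) (hB : MeasurableSet B)
    (hΛA : Λ A ≠ ∞) (hΛB : Λ B ≠ ∞) :
    ∫⁻ ω, pointMeasure (Φ ω) A * pointMeasure (Φ ω) B ∂μ = Λ A * Λ B + Λ (A ∩ B) := by
  have hC := hA.inter hB
  have hD := hA.diff hB
  have hF := hB.diff hA
  have hΛC : Λ (A ∩ B) ≠ ∞ := measure_ne_top_of_subset Set.inter_subset_left hΛA
  have hΛD : Λ (A \ B) ≠ ∞ := measure_ne_top_of_subset Set.sdiff_subset hΛA
  have hΛF : Λ (B \ A) ≠ ∞ := measure_ne_top_of_subset Set.sdiff_subset hΛB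
  have hsplitA : ∀ ν : Measure Plane, ν A = ν (A ∩ B) + ν (A \ B) :=
    fun ν => (measure_inter_add_sdiff A hB).symm
  have hsplitB : ∀ ν : Measure Plane, ν B = ν (A ∩ B) + ν (B \ A) := fun ν => by
    rw [Set.inter_comm]; exact (measure_inter_add_sdiff B hA).symm
  have hexp : ∀ ω, pointMeasure (Φ ω) A * pointMeasure (Φ ω) B
      = (pointMeasure (Φ ω) (A ∩ B) * pointMeasure (Φ ω) (A ∩ B)
        + pointMeasure (Φ ω) (A ∩ B) * pointMeasure (Φ ω) (B \ A))
        + (pointMeasure (Φ ω) (A \ B) * pointMeasure (Φ ω) (A ∩ B)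
        + pointMeasure (Φ ω) (A \ B) * pointMeasure (Φ ω) (B \ A)) := fun ω => by
    rw [hsplitA, hsplitB]; ring
  simp_rw [hexp]
  have mC := measurable_pointMeasure_apply h hC
  have mD := measurable_pointMeasure_apply h hD
  have mF := measurable_pointMeasure_apply h hF
  rw [lintegral_add_left (by fun_prop), lintegral_add_left (by fun_prop),
    lintegral_add_left (by fun_prop), lintegral_pointMeasure_apply_mul_self h hC hΛC,
    lintegral_pointMeasure_apply_mul_of_disjoint h hC hF
      (Set.disjoint_sdiff_right.mono_left Set.inter_subset_left) hΛC hΛF,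
    lintegral_pointMeasure_apply_mul_of_disjoint h hD hC
      (Set.disjoint_sdiff_left.mono_right Set.inter_subset_right) hΛD hΛC,
    lintegral_pointMeasure_apply_mul_of_disjoint h hD hF
      (Set.disjoint_sdiff_left.mono_right Set.sdiff_subset) hΛD hΛF,
    hsplitA Λ, hsplitB Λ]
  ring

/-- The counts are Poisson only on sets of finite intensity; σ-finiteness makes such sets sufficient
to identify a measure. -/
theorem measure_ext_of_finite_sets [SigmaFinite Λ] {ν₁ ν₂ : Measure Plane}
    (h : ∀ B, MeasurableSet B → Λ B ≠ ∞ → ν₁ B = ν₂ B) : ν₁ = ν₂ := by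
  refine (Measure.ext_iff_of_iUnion_eq_univ (iUnion_spanningSets Λ)).2 fun n => ?_
  ext B hB
  rw [Measure.restrict_apply hB, Measure.restrict_apply hB]
  exact h _ (hB.inter (measurableSet_spanningSets Λ n))
    (measure_ne_top_of_subset Set.inter_subset_right (measure_spanningSets_lt_top Λ n).ne)

/-- Campbell's formula for the mean. -/
theorem lintegral_lintegral_pointMeasure [SigmaFinite Λ] (h : IsPoissonPointProcess μ Φ Λ)
    {f : Plane → ℝ≥0∞} (hf : Measurable f) :
    ∫⁻ ω, ∫⁻ y, f y ∂(pointMeasure (Φ ω)) ∂μ = ∫⁻ y, f y ∂Λ := by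
  have hN := measurable_pointMeasure h
  have hbind : μ.bind (fun ω => pointMeasure (Φ ω)) = Λ :=
    measure_ext_of_finite_sets fun B hB hΛ => by
      rw [Measure.bind_apply hB hN.aemeasurable, lintegral_pointMeasure_apply h hB hΛ]
  rw [← Measure.lintegral_bind hN.aemeasurable (by fun_prop), hbind]

/-- For fixed A the map B ↦ E[N(A) N(B)] is a measure, a mixture of the point measures weighted by
N(A), and it equals Λ(A) Λ + Λ restricted to A. Integrating `f` against it replaces one set by a
function. -/
theorem lintegral_pointMeasure_apply_mul_lintegral [SigmaFinite Λ]
    (h : IsPoissonPointProcess μ Φ Λ) {A : Set Plane} (hA : MeasurableSet A) (hΛA : Λ A ≠ ∞)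
    {f : Plane → ℝ≥0∞} (hf : Measurable f) :
    ∫⁻ ω, pointMeasure (Φ ω) A * ∫⁻ y, f y ∂(pointMeasure (Φ ω)) ∂μ
      = Λ A * ∫⁻ y, f y ∂Λ + ∫⁻ y in A, f y ∂Λ := by
  have hN := measurable_pointMeasure h
  have mA := measurable_pointMeasure_apply h hA
  have mf : Measurable fun ω => ∫⁻ y, f y ∂(pointMeasure (Φ ω)) :=
    (Measure.measurable_lintegral hf).comp hN
  have hbind : (μ.withDensity fun ω => pointMeasure (Φ ω) A).bind (fun ω => pointMeasure (Φ ω))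
      = Λ A • Λ + Λ.restrict A :=
    measure_ext_of_finite_sets fun B hB hΛB => by
      rw [Measure.bind_apply hB hN.aemeasurable,
        lintegral_withDensity_eq_lintegral_mul _ mA (measurable_pointMeasure_apply h hB),
        Measure.add_apply, Measure.smul_apply, Measure.restrict_apply hB, smul_eq_mul,
        Set.inter_comm, ← lintegral_pointMeasure_apply_mul h hA hB hΛA hΛB]
      rfl
  have h1 := Measure.lintegral_bind (m := μ.withDensity fun ω => pointMeasure (Φ ω) A)
    (μ := fun ω => pointMeasure (Φ ω)) (f := f) hN.aemeasurable hf.aemeasurable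
  rw [hbind, lintegral_add_measure, lintegral_smul_measure, smul_eq_mul,
    lintegral_withDensity_eq_lintegral_mul _ mA mf] at h1
  exact h1.symm

/-- The second-order Campbell formula. -/
theorem lintegral_lintegral_pointMeasure_mul [SigmaFinite Λ] (h : IsPoissonPointProcess μ Φ Λ)
    {f g : Plane → ℝ≥0∞} (hf : Measurable f) (hg : Measurable g) :
    ∫⁻ ω, (∫⁻ y, f y ∂(pointMeasure (Φ ω))) * ∫⁻ y, g y ∂(pointMeasure (Φ ω)) ∂μ
      = (∫⁻ y, f y ∂Λ) * (∫⁻ y, g y ∂Λ) + ∫⁻ y, f y * g y ∂Λ := by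
  have hN := measurable_pointMeasure h
  have mf : Measurable fun ω => ∫⁻ y, f y ∂(pointMeasure (Φ ω)) :=
    (Measure.measurable_lintegral hf).comp hN
  have mg : Measurable fun ω => ∫⁻ y, g y ∂(pointMeasure (Φ ω)) :=
    (Measure.measurable_lintegral hg).comp hN
  -- The weighting argument once more, now with weight ∑ f, replaces the second set by `g`.
  have hbind : (μ.withDensity fun ω => ∫⁻ y, f y ∂(pointMeasure (Φ ω))).bind
      (fun ω => pointMeasure (Φ ω)) = (∫⁻ y, f y ∂Λ) • Λ + Λ.withDensity f :=
    measure_ext_of_finite_sets fun B hB hΛB => by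
      rw [Measure.bind_apply hB hN.aemeasurable,
        lintegral_withDensity_eq_lintegral_mul _ mf (measurable_pointMeasure_apply h hB),
        Measure.add_apply, Measure.smul_apply, withDensity_apply _ hB, smul_eq_mul,
        mul_comm (∫⁻ y, f y ∂Λ), ← lintegral_pointMeasure_apply_mul_lintegral h hB hΛB hf]
      refine lintegral_congr fun ω => ?_
      rw [Pi.mul_apply, mul_comm]
  have h1 := Measure.lintegral_bind
    (m := μ.withDensity fun ω => ∫⁻ y, f y ∂(pointMeasure (Φ ω)))
    (μ := fun ω => pointMeasure (Φ ω)) (f := g) hN.aemeasurable hg.aemeasurable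
  rw [hbind, lintegral_add_measure, lintegral_smul_measure, smul_eq_mul,
    lintegral_withDensity_eq_lintegral_mul _ mf mg,
    lintegral_withDensity_eq_lintegral_mul _ hf hg] at h1
  exact h1.symm

end Campbell

/-! ### Radial integrals of the path loss. -/

section RadialIntegrals

/-- The radial profile `1` for `ρ < d₀`, and `(ρ / d₀) ^ s` for `ρ ≥ d₀`. -/
noncomputable def radialProfile (d₀ s ρ : ℝ) : ℝ := if ρ < d₀ then 1 else (ρ / d₀) ^ s

theorem measurable_radialProfile (d₀ s : ℝ) : Measurable (radialProfile d₀ s) :=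
  Measurable.ite measurableSet_Iio measurable_const (by fun_prop)

theorem pathLoss_eq (A₀ d₀ γ : ℝ) (x : Plane) :
    pathLoss A₀ d₀ γ x = A₀ * radialProfile d₀ (-γ) ‖x‖ := by
  rw [pathLoss, radialProfile]
  split_ifs <;> simp

theorem radialProfile_pos {d₀ : ℝ} (hd : 0 < d₀) (s ρ : ℝ) : 0 < radialProfile d₀ s ρ := by
  rw [radialProfile]
  split_ifs with h
  · exact one_pos
  · exact Real.rpow_pos_of_pos (div_pos (hd.trans_le (not_lt.1 h)) hd) _

theorem radialProfile_neg_inv {d₀ : ℝ} (hd : 0 < d₀) (s ρ : ℝ) :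
    (radialProfile d₀ (-s) ρ)⁻¹ = radialProfile d₀ s ρ := by
  rw [radialProfile, radialProfile]
  split_ifs with h
  · exact inv_one
  · rw [← Real.rpow_neg (div_pos (hd.trans_le (not_lt.1 h)) hd).le, neg_neg]

theorem integral_radial_plane (f : ℝ → ℝ) :
    ∫ x : Plane, f ‖x‖ = 2 * Real.pi * ∫ ρ in Set.Ioi (0 : ℝ), ρ * f ρ := by
  have hv : (volume : Measure Plane).real (Metric.ball 0 1) = Real.pi := by
    rw [measureReal_def, EuclideanSpace.volume_ball_fin_two]
    simp [Real.pi_pos.le]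
  rw [integral_fun_norm_addHaar, hv]
  simp [mul_assoc]

theorem integrable_radial_plane {f : ℝ → ℝ} :
    Integrable (fun x : Plane => f ‖x‖) ↔ IntegrableOn (fun ρ => ρ * f ρ) (Set.Ioi 0) := by
  rw [integrable_fun_norm_addHaar]
  simp

theorem mul_div_rpow {d₀ ρ : ℝ} (hd : 0 < d₀) (hρ : 0 < ρ) (s : ℝ) :
    ρ * (ρ / d₀) ^ s = d₀ ^ (-s) * ρ ^ (s + 1) := by
  rw [Real.div_rpow hρ.le hd.le, Real.rpow_neg hd.le, Real.rpow_add_one hρ.ne']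
  field_simp

/-- The mean of `∑ (|y| / d₀) ^ (-s)` over a Poisson process of intensity `lam` outside the disk. -/
theorem lintegral_compl_closedBall_rpow {d₀ R lam s : ℝ} (hd : 0 < d₀) (hR : 0 < R)
    (hlam : lam * Real.pi * R ^ 2 = 1) (hs : 2 < s) :
    ENNReal.ofReal lam * ∫⁻ x in (Metric.closedBall (0 : Plane) R)ᶜ,
        ENNReal.ofReal ((‖x‖ / d₀) ^ (-s))
      = ENNReal.ofReal (2 * (d₀ / R) ^ s / (s - 2)) := by
  set f : ℝ → ℝ := (Set.Ioi R).indicator fun ρ => (ρ / d₀) ^ (-s) with hf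
  -- With this intensity the area factor π cancels and only the ratio d₀ / R survives.
  have hlam0 : lam = 1 / (Real.pi * R ^ 2) := by
    have := Real.pi_pos
    field_simp
    linarith
  have hfx : ∀ x : Plane, ((Metric.closedBall (0 : Plane) R)ᶜ).indicator
      (fun x => ENNReal.ofReal ((‖x‖ / d₀) ^ (-s))) x = ENNReal.ofReal (f ‖x‖) := by
    intro x
    by_cases hx : R < ‖x‖
    · simp [hf, Set.indicator, hx]
    · simp [hf, Set.indicator, hx]
  have hρf : ∀ ρ ∈ Set.Ioi (0 : ℝ), ρ * f ρ
      = (Set.Ioi R).indicator (fun ρ => d₀ ^ s * ρ ^ (1 - s)) ρ := by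
    intro ρ hρ
    by_cases h : R < ρ
    · simp only [hf, Set.indicator, Set.mem_Ioi, h, if_true]
      rw [mul_div_rpow hd hρ, neg_neg, neg_add_eq_sub]
    · simp [hf, Set.indicator, h]
  have hsub : Set.Ioi R ∩ Set.Ioi (0 : ℝ) = Set.Ioi R :=
    Set.inter_eq_left.2 (Set.Ioi_subset_Ioi hR.le)
  have hint1 : IntegrableOn (fun ρ : ℝ => d₀ ^ s * ρ ^ (1 - s)) (Set.Ioi R) :=
    (integrableOn_Ioi_rpow_of_lt (by linarith) hR).const_mul _
  have hint : Integrable fun x : Plane => f ‖x‖ := by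
    rw [integrable_radial_plane, integrableOn_congr_fun hρf measurableSet_Ioi]
    rw [IntegrableOn, integrable_indicator_iff measurableSet_Ioi, IntegrableOn,
      Measure.restrict_restrict measurableSet_Ioi, hsub]
    exact hint1
  have hval : ∫ x : Plane, f ‖x‖ = 2 * Real.pi * (d₀ ^ s * (R ^ (2 - s) / (s - 2))) := by
    rw [integral_radial_plane, setIntegral_congr_fun measurableSet_Ioi hρf,
      integral_indicator measurableSet_Ioi, Measure.restrict_restrict measurableSet_Ioi, hsub,
      integral_const_mul, integral_Ioi_rpow_of_lt (by linarith) hR]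
    congr 2
    have h1 : 1 - s + 1 = 2 - s := by ring
    rw [h1, ← neg_sub s 2, div_neg, neg_div, neg_neg, neg_sub]
  have hf0 : ∀ x : Plane, 0 ≤ f ‖x‖ := by
    intro x
    refine Set.indicator_nonneg (fun ρ hρ => ?_) _
    exact Real.rpow_nonneg (div_nonneg (hR.le.trans (le_of_lt hρ)) hd.le) _
  rw [← lintegral_indicator measurableSet_closedBall.compl]
  simp_rw [hfx]
  rw [← ofReal_integral_eq_lintegral_ofReal hint (Filter.Eventually.of_forall hf0), hval,
    ← ENNReal.ofReal_mul (by rw [hlam0]; positivity)]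
  congr 1
  rw [hlam0, Real.div_rpow hd.le hR.le, Real.rpow_sub hR, Real.rpow_two]
  have hs2 : s - 2 ≠ 0 := by linarith
  have := Real.pi_pos
  have hRs := Real.rpow_pos_of_pos hR s
  field_simp

/-- The mean of the radial profile at a uniform point of the disk. -/
theorem integral_cond_radialProfile {d₀ R s : ℝ} (hd : 0 < d₀) (hdR : d₀ ≤ R) (hs : s ≠ -2) :
    ∫ x, radialProfile d₀ s ‖x‖ ∂(ProbabilityTheory.cond (volume : Measure Plane)
        (Metric.closedBall 0 R))
      = (d₀ / R) ^ 2 + 2 * ((d₀ / R) ^ (-s) - (d₀ / R) ^ 2) / (s + 2) := by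
  have hR : 0 < R := hd.trans_le hdR
  set f : ℝ → ℝ := (Set.Iic R).indicator (radialProfile d₀ s) with hf
  have hfx : ∀ x : Plane, (Metric.closedBall (0 : Plane) R).indicator
      (fun x => radialProfile d₀ s ‖x‖) x = f ‖x‖ := by
    intro x
    by_cases hx : ‖x‖ ≤ R
    · simp [hf, Set.indicator, hx]
    · simp [hf, Set.indicator, hx]
  have hρf : ∀ ρ : ℝ, ρ * f ρ
      = (Set.Iic R).indicator (fun ρ => ρ * radialProfile d₀ s ρ) ρ := by
    intro ρ
    by_cases h : ρ ≤ R
    · simp [hf, Set.indicator, h]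
    · simp [hf, Set.indicator, h]
  have hsub : Set.Iic R ∩ Set.Ioi (0 : ℝ) = Set.Ioc 0 R := by
    rw [Set.inter_comm]; rfl
  have e1 : Set.EqOn (fun ρ => ρ * radialProfile d₀ s ρ) (fun ρ => ρ) (Set.Ioo 0 d₀) := by
    intro ρ hρ
    simp [radialProfile, hρ.2]
  have e2 : Set.EqOn (fun ρ => ρ * radialProfile d₀ s ρ)
      (fun ρ => d₀ ^ (-s) * ρ ^ (s + 1)) (Set.uIcc d₀ R) := by
    intro ρ hρ
    rw [Set.uIcc_of_le hdR] at hρ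
    simp only [radialProfile, not_lt.2 hρ.1, if_false]
    exact mul_div_rpow hd (hd.trans_le hρ.1) s
  have h0 : (0 : ℝ) ∉ Set.uIcc d₀ R := by
    rw [Set.uIcc_of_le hdR]
    exact fun h => absurd h.1 (not_le.2 hd)
  have i1 : ∫ ρ in (0 : ℝ)..d₀, ρ * radialProfile d₀ s ρ = d₀ ^ 2 / 2 := by
    rw [intervalIntegral.integral_of_le hd.le,
      integral_Ioc_eq_integral_Ioo, setIntegral_congr_fun measurableSet_Ioo e1,
      ← integral_Ioc_eq_integral_Ioo, ← intervalIntegral.integral_of_le hd.le, integral_id]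
    ring
  have i2 : ∫ ρ in d₀..R, ρ * radialProfile d₀ s ρ
      = d₀ ^ (-s) * ((R ^ (s + 2) - d₀ ^ (s + 2)) / (s + 2)) := by
    have hs1 : s + 1 ≠ -1 := fun h => hs (by linarith)
    rw [intervalIntegral.integral_congr e2, intervalIntegral.integral_const_mul,
      integral_rpow (Or.inr ⟨hs1, h0⟩)]
    have : s + 1 + 1 = s + 2 := by ring
    rw [this]
  have ii1 : IntervalIntegrable (fun ρ => ρ * radialProfile d₀ s ρ) volume 0 d₀ := by
    rw [intervalIntegrable_iff_integrableOn_Ioo_of_le hd.le,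
      integrableOn_congr_fun e1 measurableSet_Ioo,
      ← intervalIntegrable_iff_integrableOn_Ioo_of_le hd.le]
    exact intervalIntegral.intervalIntegrable_id
  have ii2 : IntervalIntegrable (fun ρ => ρ * radialProfile d₀ s ρ) volume d₀ R := by
    refine IntervalIntegrable.congr (f := fun ρ => d₀ ^ (-s) * ρ ^ (s + 1)) ?_
      ((intervalIntegral.intervalIntegrable_rpow (Or.inr h0)).const_mul _)
    exact fun ρ hρ => (e2 (Set.uIoc_subset_uIcc hρ)).symm
  have hball : (volume (Metric.closedBall (0 : Plane) R))⁻¹.toReal = (Real.pi * R ^ 2)⁻¹ := by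
    rw [EuclideanSpace.volume_closedBall_fin_two, ENNReal.toReal_inv, ENNReal.toReal_mul,
      ENNReal.toReal_pow, ENNReal.toReal_ofReal hR.le, ENNReal.toReal_ofReal Real.pi_pos.le,
      mul_comm]
  rw [ProbabilityTheory.cond, integral_smul_measure, hball,
    ← integral_indicator measurableSet_closedBall]
  simp_rw [hfx]
  rw [integral_radial_plane]
  simp_rw [hρf]
  rw [integral_indicator measurableSet_Iic, Measure.restrict_restrict measurableSet_Iic, hsub,
    ← intervalIntegral.integral_of_le hR.le,
    -- The disk is cut at radius d₀: flat profile inside, pure power outside.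
    ← intervalIntegral.integral_add_adjacent_intervals ii1 ii2, i1, i2, smul_eq_mul]
  have hs2 : s + 2 ≠ 0 := fun h => hs (by linarith)
  have hpi := Real.pi_pos
  have hRs := Real.rpow_pos_of_pos hR s
  have hds := Real.rpow_pos_of_pos hd s
  rw [Real.rpow_neg (div_pos hd hR).le, Real.div_rpow hd.le hR.le, Real.rpow_neg hd.le,
    Real.rpow_add hR, Real.rpow_add hd, Real.rpow_two, Real.rpow_two]
  field_simp

end RadialIntegrals

/-! ### Pilotwise comparison of the powers. -/

section Comparison

variable {K M : ℕ} {ι : Fin K → Type} {β : UE ι → ℝ}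

theorem errorVar_none (hβ : ∀ u, 0 < β u) (k : Fin K) :
    errorVar β ⟨k, none⟩ = β ⟨k, none⟩ * (∑' y : ι k, β ⟨k, some y⟩) / alpha β k := by
  have hα := (alpha_pos hβ k).ne'
  rw [errorVar]
  field_simp
  rw [alpha]
  ring

/-- The difference of the two sides is exactly t³ / (r (r + t)), which also settles the strict case.
-/
theorem sub_sq_div_le {r t : ℝ} (hr : 0 < r) (ht : 0 ≤ t) : t - t ^ 2 / r ≤ r * t / (r + t) := by
  have h : r * t / (r + t) - (t - t ^ 2 / r) = t ^ 3 / (r * (r + t)) := by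
    field_simp
    ring
  have : 0 ≤ t ^ 3 / (r * (r + t)) := by positivity
  linarith

theorem sub_sq_div_lt {r t : ℝ} (hr : 0 < r) (ht : 0 < t) : t - t ^ 2 / r < r * t / (r + t) := by
  have h : r * t / (r + t) - (t - t ^ 2 / r) = t ^ 3 / (r * (r + t)) := by
    field_simp
    ring
  have : 0 < t ^ 3 / (r * (r + t)) := by positivity
  linarith

/-- On pilot `k` the denominator of r t / (r + t) is α_k and cancels the prefactor. That term
appears unchanged in `lowerZF`, so the lower bound loses something only on the other pilots. -/
theorem intra_eq_split (hβ : ∀ u, 0 < β u) (hKM : K < M) (k : Fin K) :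
    alpha β k / ((M : ℝ) - K) * ∑ k', errorVar β ⟨k', none⟩
      = β ⟨k, none⟩ * (∑' y : ι k, β ⟨k, some y⟩) / ((M : ℝ) - K)
        + alpha β k / ((M : ℝ) - K) * ∑ k' ∈ Finset.univ.erase k, errorVar β ⟨k', none⟩ := by
  have hMK : 0 < (M : ℝ) - K := sub_pos.2 (by exact_mod_cast hKM)
  have hα := alpha_pos hβ k
  rw [← Finset.add_sum_erase _ _ (Finset.mem_univ k), mul_add, errorVar_none hβ k]
  congr 1
  field_simp

theorem lowerZF_le (hβ : ∀ u, 0 < β u) (hKM : K < M) (k : Fin K) :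
    lowerZF M β k ≤ alpha β k / ((M : ℝ) - K) * ∑ k', errorVar β ⟨k', none⟩ := by
  have hMK : 0 < (M : ℝ) - K := sub_pos.2 (by exact_mod_cast hKM)
  have hα := alpha_pos hβ k
  rw [intra_eq_split hβ hKM]
  refine add_le_add_right ?_ _
  refine mul_le_mul_of_nonneg_left (Finset.sum_le_sum fun k' _ => ?_) (div_pos hα hMK).le
  rw [errorVar_none hβ]
  exact sub_sq_div_le (hβ _) (tsum_nonneg fun _ => (hβ _).le)

theorem lowerZF_lt (hβ : ∀ u, 0 < β u) (hKM : K < M) {k k' : Fin K} (hk : k' ≠ k)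
    (ht : 0 < ∑' y : ι k', β ⟨k', some y⟩) :
    lowerZF M β k < alpha β k / ((M : ℝ) - K) * ∑ k', errorVar β ⟨k', none⟩ := by
  have hMK : 0 < (M : ℝ) - K := sub_pos.2 (by exact_mod_cast hKM)
  have hα := alpha_pos hβ k
  rw [intra_eq_split hβ hKM]
  refine add_lt_add_right ?_ _
  refine mul_lt_mul_of_pos_left (Finset.sum_lt_sum (fun j _ => ?_) ⟨k', by simp [hk], ?_⟩)
    (div_pos hα hMK)
  · rw [errorVar_none hβ]
    exact sub_sq_div_le (hβ _) (tsum_nonneg fun _ => (hβ _).le)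
  · rw [errorVar_none hβ]
    exact sub_sq_div_lt (hβ _) ht

theorem tsum_sq_gain_le (hβ : ∀ u, 0 < β u) (hs : ∀ k, Summable fun y : ι k => β ⟨k, some y⟩)
    (k : Fin K) : ∑' y : ι k, β ⟨k, some y⟩ ^ 2 ≤ (∑' y : ι k, β ⟨k, some y⟩) ^ 2 := by
  rw [sq, ← tsum_mul_right]
  refine Summable.tsum_le_tsum (fun y => ?_) (summable_sq_gain hβ hs k) ((hs k).mul_right _)
  rw [sq]
  exact mul_le_mul_of_nonneg_left ((hs k).le_tsum y fun _ _ => (hβ _).le) (hβ _).le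

/-- With a second UE b present, the gain of a is strictly below the total, so its square is strictly
below its product with the total. -/
theorem tsum_sq_gain_lt (hβ : ∀ u, 0 < β u) (hs : ∀ k, Summable fun y : ι k => β ⟨k, some y⟩)
    {k : Fin K} {a b : ι k} (hab : a ≠ b) :
    ∑' y : ι k, β ⟨k, some y⟩ ^ 2 < (∑' y : ι k, β ⟨k, some y⟩) ^ 2 := by
  classical
  rw [sq, ← tsum_mul_right]
  refine Summable.tsum_lt_tsum (i := a) (fun y => ?_) ?_ (summable_sq_gain hβ hs k)
    ((hs k).mul_right _)
  · simp only [sq]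
    exact mul_le_mul_of_nonneg_left ((hs k).le_tsum y fun _ _ => (hβ _).le) (hβ _).le
  · simp only [sq]
    refine mul_lt_mul_of_pos_left ?_ (hβ _)
    have h := (hs k).sum_le_tsum {a, b} fun _ _ => (hβ _).le
    rw [Finset.sum_pair hab] at h
    have := hβ ⟨k, some b⟩
    linarith

/-- After multiplication by α = r + t the claim is r t ≤ t (r + t) - s, that is s ≤ t². -/
theorem errorVar_none_le (hβ : ∀ u, 0 < β u) (hs : ∀ k, Summable fun y : ι k => β ⟨k, some y⟩)
    (k : Fin K) : errorVar β ⟨k, none⟩ ≤ ∑' y : ι k, errorVar β ⟨k, some y⟩ := by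
  have hα := alpha_pos hβ k
  have h := tsum_sq_gain_le hβ hs k
  rw [errorVar_none hβ, tsum_errorVar hβ hs, div_le_iff₀ hα, sub_mul, div_mul_cancel₀ _ hα.ne']
  rw [alpha]
  nlinarith

theorem errorVar_none_lt (hβ : ∀ u, 0 < β u) (hs : ∀ k, Summable fun y : ι k => β ⟨k, some y⟩)
    {k : Fin K} {a b : ι k} (hab : a ≠ b) :
    errorVar β ⟨k, none⟩ < ∑' y : ι k, errorVar β ⟨k, some y⟩ := by
  have hα := alpha_pos hβ k
  have h := tsum_sq_gain_lt hβ hs hab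
  rw [errorVar_none hβ, tsum_errorVar hβ hs, div_lt_iff₀ hα, sub_mul, div_mul_cancel₀ _ hα.ne']
  rw [alpha]
  nlinarith

theorem intraZF_le_interZF (hβ : ∀ u, 0 < β u)
    (hs : ∀ k, Summable fun y : ι k => β ⟨k, some y⟩) (hKM : K < M) (k : Fin K) :
    intraZF M β k ≤ interZF M β k := by
  have hMK : 0 < (M : ℝ) - K := sub_pos.2 (by exact_mod_cast hKM)
  rw [intraZF_eq hβ hs hKM, interZF_eq hβ hs hKM]
  exact ENNReal.ofReal_le_ofReal (mul_le_mul_of_nonneg_left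
    (Finset.sum_le_sum fun k' _ => errorVar_none_le hβ hs k') (div_pos (alpha_pos hβ k) hMK).le)

theorem intraZF_lt_interZF (hβ : ∀ u, 0 < β u)
    (hs : ∀ k, Summable fun y : ι k => β ⟨k, some y⟩) (hKM : K < M) {k : Fin K} {a b : ι k}
    (hab : a ≠ b) : intraZF M β k < interZF M β k := by
  have hMK : 0 < (M : ℝ) - K := sub_pos.2 (by exact_mod_cast hKM)
  rw [intraZF_eq hβ hs hKM, interZF_eq hβ hs hKM]
  have h : ∑ k', errorVar β ⟨k', none⟩ < ∑ k', ∑' y : ι k', errorVar β ⟨k', some y⟩ :=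
    Finset.sum_lt_sum (fun k' _ => errorVar_none_le hβ hs k')
      ⟨k, Finset.mem_univ k, errorVar_none_lt hβ hs hab⟩
  have h0 : 0 ≤ ∑ k', errorVar β ⟨k', none⟩ :=
    Finset.sum_nonneg fun k' _ => errorVar_nonneg hβ hs _
  have hc := div_pos (alpha_pos hβ k) hMK
  exact (ENNReal.ofReal_lt_ofReal_iff (mul_pos hc (h0.trans_lt h))).2
    (mul_lt_mul_of_pos_left h hc)

theorem tsum_errorVar_le (hβ : ∀ u, 0 < β u) (hs : ∀ k, Summable fun y : ι k => β ⟨k, some y⟩)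
    (k : Fin K) : ∑' y : ι k, errorVar β ⟨k, some y⟩ ≤ ∑' y : ι k, β ⟨k, some y⟩ := by
  rw [tsum_errorVar hβ hs]
  exact sub_le_self _ (div_nonneg (tsum_nonneg fun _ => sq_nonneg _) (alpha_pos hβ k).le)

theorem interZF_le_upperZF (hβ : ∀ u, 0 < β u)
    (hs : ∀ k, Summable fun y : ι k => β ⟨k, some y⟩) (hKM : K < M) (k : Fin K) :
    interZF M β k ≤ upperZF M β k := by
  have hMK : 0 < (M : ℝ) - K := sub_pos.2 (by exact_mod_cast hKM)
  rw [upperZF_eq hβ hs hKM, interZF_eq hβ hs hKM]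
  exact ENNReal.ofReal_le_ofReal (mul_le_mul_of_nonneg_left
    (Finset.sum_le_sum fun k' _ => tsum_errorVar_le hβ hs k') (div_pos (alpha_pos hβ k) hMK).le)

theorem interZF_lt_upperZF (hβ : ∀ u, 0 < β u)
    (hs : ∀ k, Summable fun y : ι k => β ⟨k, some y⟩) (hKM : K < M) {k : Fin K} (a : ι k) :
    interZF M β k < upperZF M β k := by
  have hMK : 0 < (M : ℝ) - K := sub_pos.2 (by exact_mod_cast hKM)
  rw [upperZF_eq hβ hs hKM, interZF_eq hβ hs hKM]
  have h : ∑ k', ∑' y : ι k', errorVar β ⟨k', some y⟩ < ∑ k', ∑' y : ι k', β ⟨k', some y⟩ := by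
    refine Finset.sum_lt_sum (fun k' _ => tsum_errorVar_le hβ hs k') ⟨k, Finset.mem_univ k, ?_⟩
    rw [tsum_errorVar hβ hs]
    refine sub_lt_self _ (div_pos ?_ (alpha_pos hβ k))
    exact (summable_sq_gain hβ hs k).tsum_pos (fun _ => sq_nonneg _) a (pow_pos (hβ _) 2)
  have h0 : 0 ≤ ∑ k', ∑' y : ι k', errorVar β ⟨k', some y⟩ :=
    Finset.sum_nonneg fun k' _ => tsum_nonneg fun y => errorVar_nonneg hβ hs _
  have hc := div_pos (alpha_pos hβ k) hMK
  exact (ENNReal.ofReal_lt_ofReal_iff (mul_pos hc (h0.trans_lt h))).2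
    (mul_lt_mul_of_pos_left h hc)

end Comparison

/-! ### Moments of the outer gain and occurrence of two outer UEs. -/

section PoissonInterference

theorem pathLoss_pos {A₀ d₀ : ℝ} (hA : 0 < A₀) (hd : 0 < d₀) (γ : ℝ) (x : Plane) :
    0 < pathLoss A₀ d₀ γ x := by
  rw [pathLoss_eq]
  exact mul_pos hA (radialProfile_pos hd _ _)

theorem measurable_pathLoss (A₀ d₀ γ : ℝ) : Measurable (pathLoss A₀ d₀ γ) := by
  have : pathLoss A₀ d₀ γ = fun x => A₀ * radialProfile d₀ (-γ) ‖x‖ := by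
    ext x; exact pathLoss_eq _ _ _ _
  rw [this]
  exact ((measurable_radialProfile d₀ (-γ)).comp measurable_norm).const_mul _

theorem toReal_lintegral_pointMeasure (S : Set Plane) {f : Plane → ℝ} (hf : Measurable f)
    (hf0 : ∀ y, 0 ≤ f y) :
    (∫⁻ y, ENNReal.ofReal (f y) ∂(pointMeasure S)).toReal = ∑' y : S, f y := by
  rw [lintegral_pointMeasure S hf.ennreal_ofReal,
    ENNReal.tsum_toReal_eq fun _ => ENNReal.ofReal_ne_top]
  simp_rw [ENNReal.toReal_ofReal (hf0 _)]

theorem summable_of_lintegral_pointMeasure_ne_top {S : Set Plane} {f : Plane → ℝ}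
    (hf : Measurable f) (hf0 : ∀ y, 0 ≤ f y)
    (h : ∫⁻ y, ENNReal.ofReal (f y) ∂(pointMeasure S) ≠ ∞) : Summable fun y : S => f y := by
  rw [lintegral_pointMeasure S hf.ennreal_ofReal] at h
  have := ENNReal.summable_toReal h
  simpa only [ENNReal.toReal_ofReal (hf0 _)] using this

/-- The intensity measure of the inter-cell UEs that share a pilot. -/
noncomputable abbrev outerIntensity (R lam : ℝ) : Measure Plane :=
  ENNReal.ofReal lam • (volume : Measure Plane).restrict (Metric.closedBall (0 : Plane) R)ᶜ

instance sigmaFinite_outerIntensity (R lam : ℝ) : SigmaFinite (outerIntensity R lam) :=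
  inferInstanceAs (SigmaFinite (Real.toNNReal lam •
    (volume : Measure Plane).restrict (Metric.closedBall (0 : Plane) R)ᶜ))

variable {A₀ d₀ γ R lam : ℝ}

/-- Outside the disk the path loss is a pure power, as d₀ ≤ R, and its n-th power is again one with
exponent nγ. The cases n = 1 and n = 2 give the mean and the variance. -/
theorem lintegral_outerIntensity_pathLoss_pow (hA : 0 < A₀) (hd : 0 < d₀) (hdR : d₀ ≤ R)
    (hlam : lam * Real.pi * R ^ 2 = 1) (n : ℕ) (hn : 2 < n * γ) :
    ∫⁻ y, ENNReal.ofReal (pathLoss A₀ d₀ γ y ^ n) ∂(outerIntensity R lam)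
      = ENNReal.ofReal (A₀ ^ n * (2 * (d₀ / R) ^ (n * γ) / (n * γ - 2))) := by
  have hR := hd.trans_le hdR
  have hcongr : ∀ y ∈ (Metric.closedBall (0 : Plane) R)ᶜ,
      ENNReal.ofReal (pathLoss A₀ d₀ γ y ^ n)
        = ENNReal.ofReal (A₀ ^ n) * ENNReal.ofReal ((‖y‖ / d₀) ^ (-(n * γ))) := by
    intro y hy
    have hy' : R < ‖y‖ := by simpa using hy
    have hpos : 0 < ‖y‖ / d₀ := div_pos (hR.trans hy') hd
    rw [pathLoss, if_neg (not_lt.2 (hdR.trans hy'.le)), mul_pow, ← Real.rpow_mul_natCast hpos.le,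
      ENNReal.ofReal_mul (pow_nonneg hA.le _)]
    congr 3
    ring
  rw [lintegral_smul_measure, setLIntegral_congr_fun measurableSet_closedBall.compl hcongr,
    lintegral_const_mul' _ _ ENNReal.ofReal_ne_top, smul_eq_mul, mul_left_comm,
    lintegral_compl_closedBall_rpow hd hR hlam hn, ← ENNReal.ofReal_mul (pow_nonneg hA.le _)]

/-- The mean of the total gain of the inter-cell UEs that share a pilot. -/
noncomputable def interMean (A₀ d₀ γ R : ℝ) : ℝ := 2 * A₀ * (d₀ / R) ^ γ / (γ - 2)

/-- The variance of the total gain of the inter-cell UEs that share a pilot. -/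
noncomputable def interVar (A₀ d₀ γ R : ℝ) : ℝ := A₀ ^ 2 * (d₀ / R) ^ (2 * γ) / (γ - 1)

theorem measurable_interGain {Ω : Type*} {Φ : Ω → Set Plane} (A₀ d₀ γ : ℝ) (n : ℕ)
    {m : MeasurableSpace Ω} (h : Measurable[m] fun ω => pointMeasure (Φ ω)) (hA : 0 < A₀) (hd : 0 < d₀) :
    Measurable[m] fun ω => ∑' y : Φ ω, pathLoss A₀ d₀ γ y ^ n := by
  have hp : Measurable fun y => pathLoss A₀ d₀ γ y ^ n := (measurable_pathLoss A₀ d₀ γ).pow_const n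
  have := (((Measure.measurable_lintegral hp.ennreal_ofReal).comp h).ennreal_toReal)
  convert this using 2 with ω
  exact (toReal_lintegral_pointMeasure (Φ ω) hp
    fun y => pow_nonneg (pathLoss_pos hA hd γ y).le n).symm

variable {Ω : Type*} [MeasurableSpace Ω] {μ : Measure Ω} {Φ : Ω → Set Plane}

section Moments

variable (hA : 0 < A₀) (hd : 0 < d₀) (hdR : d₀ ≤ R) (hγ : 2 < γ)
  (hlam : lam * Real.pi * R ^ 2 = 1) (h : IsPoissonPointProcess μ Φ (outerIntensity R lam))

include hA hd hdR hγ hlam h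

theorem lintegral_interGain :
    ∫⁻ ω, ∫⁻ y, ENNReal.ofReal (pathLoss A₀ d₀ γ y) ∂(pointMeasure (Φ ω)) ∂μ
      = ENNReal.ofReal (interMean A₀ d₀ γ R) := by
  have h1 := lintegral_outerIntensity_pathLoss_pow (γ := γ) hA hd hdR hlam 1 (by simpa using hγ)
  simp only [pow_one, Nat.cast_one, one_mul] at h1
  rw [lintegral_lintegral_pointMeasure h (measurable_pathLoss A₀ d₀ γ).ennreal_ofReal, h1,
    interMean]
  congr 1
  ring

theorem lintegral_interGain_sq :
    ∫⁻ ω, (∫⁻ y, ENNReal.ofReal (pathLoss A₀ d₀ γ y) ∂(pointMeasure (Φ ω)))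
        * (∫⁻ y, ENNReal.ofReal (pathLoss A₀ d₀ γ y) ∂(pointMeasure (Φ ω))) ∂μ
      = ENNReal.ofReal (interMean A₀ d₀ γ R ^ 2 + interVar A₀ d₀ γ R) := by
  have hR := hd.trans_le hdR
  have hm := (measurable_pathLoss A₀ d₀ γ).ennreal_ofReal
  have h1 := lintegral_outerIntensity_pathLoss_pow (γ := γ) hA hd hdR hlam 1 (by simpa using hγ)
  have h2 := lintegral_outerIntensity_pathLoss_pow (γ := γ) hA hd hdR hlam 2
    (by push_cast; linarith)
  simp only [pow_one, Nat.cast_one, one_mul] at h1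
  have hsq : ∀ y, ENNReal.ofReal (pathLoss A₀ d₀ γ y) * ENNReal.ofReal (pathLoss A₀ d₀ γ y)
      = ENNReal.ofReal (pathLoss A₀ d₀ γ y ^ 2) := fun y => by
    rw [sq, ENNReal.ofReal_mul (pathLoss_pos hA hd γ y).le]
  have e1 : A₀ * (2 * (d₀ / R) ^ γ / (γ - 2)) = interMean A₀ d₀ γ R := by rw [interMean]; ring
  have e2 : A₀ ^ 2 * (2 * (d₀ / R) ^ ((2 : ℕ) * γ) / ((2 : ℕ) * γ - 2)) = interVar A₀ d₀ γ R := by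
    have : γ - 1 ≠ 0 := by linarith
    have h' : 2 * γ - 2 = 2 * (γ - 1) := by ring
    rw [interVar]
    push_cast
    rw [h']
    field_simp
  have hm0 : 0 ≤ interMean A₀ d₀ γ R := by
    have : 0 < γ - 2 := by linarith
    rw [interMean]; positivity
  have hv0 : 0 ≤ interVar A₀ d₀ γ R := by
    have : 0 < γ - 1 := by linarith
    rw [interVar]; positivity
  rw [lintegral_lintegral_pointMeasure_mul h hm hm]
  simp_rw [hsq]
  rw [h1, h2, e1, e2, ← ENNReal.ofReal_mul hm0, ← ENNReal.ofReal_add (by positivity) hv0, sq]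

theorem ae_interGain_lt_top :
    ∀ᵐ ω ∂μ, ∫⁻ y, ENNReal.ofReal (pathLoss A₀ d₀ γ y) ∂(pointMeasure (Φ ω)) < ∞ := by
  have hm := (Measure.measurable_lintegral (measurable_pathLoss A₀ d₀ γ).ennreal_ofReal).comp
    (measurable_pointMeasure h)
  refine ae_lt_top hm ?_
  have := lintegral_interGain hA hd hdR hγ hlam h
  rw [this]
  exact ENNReal.ofReal_ne_top

theorem ae_summable_interGain :
    ∀ᵐ ω ∂μ, Summable fun y : Φ ω => pathLoss A₀ d₀ γ y := by
  filter_upwards [ae_interGain_lt_top hA hd hdR hγ hlam h] with ω hω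
  exact summable_of_lintegral_pointMeasure_ne_top (measurable_pathLoss A₀ d₀ γ)
    (fun y => (pathLoss_pos hA hd γ y).le) hω.ne

theorem integrable_interGain : Integrable (fun ω => ∑' y : Φ ω, pathLoss A₀ d₀ γ y) μ := by
  have hm := (Measure.measurable_lintegral (measurable_pathLoss A₀ d₀ γ).ennreal_ofReal).comp
    (measurable_pointMeasure h)
  have h1 := lintegral_interGain hA hd hdR hγ hlam h
  have := integrable_toReal_of_lintegral_ne_top hm.aemeasurable
    (by simp only [Function.comp_apply]; rw [h1]; exact ENNReal.ofReal_ne_top)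
  simpa only [Function.comp_apply, toReal_lintegral_pointMeasure _ (measurable_pathLoss A₀ d₀ γ)
    fun y => (pathLoss_pos hA hd γ y).le] using this

theorem integral_interGain :
    ∫ ω, ∑' y : Φ ω, pathLoss A₀ d₀ γ y ∂μ = interMean A₀ d₀ γ R := by
  have hR := hd.trans_le hdR
  have hm := (Measure.measurable_lintegral (measurable_pathLoss A₀ d₀ γ).ennreal_ofReal).comp
    (measurable_pointMeasure h)
  have h2 := integral_toReal hm.aemeasurable (ae_interGain_lt_top hA hd hdR hγ hlam h)
  simp only [Function.comp_apply, toReal_lintegral_pointMeasure _ (measurable_pathLoss A₀ d₀ γ)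
    fun y => (pathLoss_pos hA hd γ y).le] at h2
  rw [h2, lintegral_interGain hA hd hdR hγ hlam h, ENNReal.toReal_ofReal]
  have : 0 < γ - 2 := by linarith
  rw [interMean]; positivity

theorem integrable_interGain_sq :
    Integrable (fun ω => (∑' y : Φ ω, pathLoss A₀ d₀ γ y) ^ 2) μ := by
  have hm := (Measure.measurable_lintegral (measurable_pathLoss A₀ d₀ γ).ennreal_ofReal).comp
    (measurable_pointMeasure h)
  have h1 := lintegral_interGain_sq hA hd hdR hγ hlam h
  have := integrable_toReal_of_lintegral_ne_top (hm.mul hm).aemeasurable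
    (by simp only [Pi.mul_apply, Function.comp_apply]; rw [h1]; exact ENNReal.ofReal_ne_top)
  simpa only [Pi.mul_apply, Function.comp_apply, ← sq, ENNReal.toReal_pow,
    toReal_lintegral_pointMeasure _ (measurable_pathLoss A₀ d₀ γ)
    fun y => (pathLoss_pos hA hd γ y).le] using this

theorem integral_interGain_sq :
    ∫ ω, (∑' y : Φ ω, pathLoss A₀ d₀ γ y) ^ 2 ∂μ
      = interMean A₀ d₀ γ R ^ 2 + interVar A₀ d₀ γ R := by
  have hR := hd.trans_le hdR
  have hm := (Measure.measurable_lintegral (measurable_pathLoss A₀ d₀ γ).ennreal_ofReal).comp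
    (measurable_pointMeasure h)
  have h2 := integral_toReal (hm.mul hm).aemeasurable (by
    filter_upwards [ae_interGain_lt_top hA hd hdR hγ hlam h] with ω hω
    exact ENNReal.mul_lt_top hω hω)
  simp only [Pi.mul_apply, Function.comp_apply, ← sq, ENNReal.toReal_pow,
    toReal_lintegral_pointMeasure _ (measurable_pathLoss A₀ d₀ γ)
    fun y => (pathLoss_pos hA hd γ y).le] at h2
  have h3 := lintegral_interGain_sq hA hd hdR hγ hlam h
  simp only [← sq] at h3
  rw [h2, h3, ENNReal.toReal_ofReal]
  have : 0 < γ - 1 := by linarith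
  have hv : 0 ≤ interVar A₀ d₀ γ R := by rw [interVar]; positivity
  positivity

end Moments

/-- An annulus of width 1 around the disk has positive finite intensity, so its Poisson count equals
2 with positive probability. The event itself need not be measurable: only its not being null is
used. -/
theorem measure_two_points_ne_zero (hR : 0 < R) (hlam : lam * Real.pi * R ^ 2 = 1)
    (h : IsPoissonPointProcess μ Φ (outerIntensity R lam)) :
    μ {ω | ∃ a b : Φ ω, a ≠ b} ≠ 0 := by
  have hlam0 : 0 < lam := by
    have hp : 0 < Real.pi * R ^ 2 := by positivity
    by_contra hneg
    nlinarith [mul_nonneg (neg_nonneg.2 (not_lt.1 hneg)) hp.le]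
  set B : Set Plane := Metric.closedBall 0 (R + 1) \ Metric.closedBall 0 R with hB_def
  have hB : MeasurableSet B := measurableSet_closedBall.diff measurableSet_closedBall
  have hsub : B ∩ (Metric.closedBall (0 : Plane) R)ᶜ = B :=
    Set.inter_eq_left.2 fun y hy => hy.2
  have hΛ : outerIntensity R lam B = ENNReal.ofReal lam * volume B := by
    rw [outerIntensity, Measure.smul_apply, Measure.restrict_apply hB, hsub, smul_eq_mul]
  have hvB : volume B ≠ ∞ :=
    measure_ne_top_of_subset Set.sdiff_subset measure_closedBall_lt_top.ne
  have hvB0 : volume B ≠ 0 := by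
    intro h0
    have hle := measure_le_inter_add_sdiff (volume : Measure Plane)
      (Metric.closedBall 0 (R + 1)) (Metric.closedBall 0 R)
    rw [← hB_def, h0, add_zero] at hle
    have hle2 := hle.trans (measure_mono Set.inter_subset_right)
    rw [EuclideanSpace.volume_closedBall_fin_two, EuclideanSpace.volume_closedBall_fin_two,
      ← ENNReal.ofReal_pow (by linarith), ← ENNReal.ofReal_pow hR.le,
      ← ENNReal.ofReal_mul (by positivity), ← ENNReal.ofReal_mul (by positivity),
      ENNReal.ofReal_le_ofReal_iff (by positivity)] at hle2
    have := le_of_mul_le_mul_right hle2 Real.pi_pos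
    nlinarith
  have hΛtop : outerIntensity R lam B ≠ ∞ := by
    rw [hΛ]; exact ENNReal.mul_ne_top ENNReal.ofReal_ne_top hvB
  have hΛ0 : 0 < (outerIntensity R lam B).toNNReal := by
    rw [ENNReal.toNNReal_pos_iff]
    refine ⟨?_, hΛtop.lt_top⟩
    rw [hΛ]
    exact pos_iff_ne_zero.2 (mul_ne_zero (ENNReal.ofReal_pos.2 hlam0).ne' hvB0)
  have hlaw := DFunLike.congr_fun (h.law_count B hB hΛtop) {(2 : ℕ∞)}
  rw [Measure.map_apply (h.measurable_count B hB) (MeasurableSet.of_discrete),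
    Measure.map_apply Measurable.of_discrete MeasurableSet.of_discrete] at hlaw
  have hpois : poissonMeasure (outerIntensity R lam B).toNNReal
      ((fun n : ℕ => (n : ℕ∞)) ⁻¹' {2}) ≠ 0 := by
    have : ((fun n : ℕ => (n : ℕ∞)) ⁻¹' {2}) = {2} := by
      ext n
      simp only [Set.mem_preimage, Set.mem_singleton_iff]
      exact_mod_cast Iff.rfl
    rw [this]
    intro h0
    have := poissonMeasure_real_singleton_pos 2 hΛ0
    rw [measureReal_def, h0] at this
    simp at this
  rw [← hlaw] at hpois
  intro h0
  refine hpois (measure_mono_null ?_ h0)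
  intro ω hω
  obtain ⟨a, b, hab, hs⟩ := Set.encard_eq_two.1 hω
  have ha : a ∈ Φ ω ∩ B := hs ▸ Set.mem_insert a _
  have hb : b ∈ Φ ω ∩ B := hs ▸ Set.mem_insert_of_mem a rfl
  exact ⟨⟨a, ha.1⟩, ⟨b, hb.1⟩, fun h => hab (congrArg Subtype.val h)⟩

end PoissonInterference

/-! ### Means of the bounding variables from independence. -/

section IndependentMoments

variable {Ω : Type*} [MeasurableSpace Ω] {μ : Measure Ω} {K : ℕ} {r t : Fin K → Ω → ℝ}

theorem measurable_sumElim (hr : ∀ j, Measurable (r j)) (ht : ∀ j, Measurable (t j))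
    (i : Fin K ⊕ Fin K) : Measurable (Sum.elim r t i) := by
  cases i with
  | inl j => exact hr j
  | inr j => exact ht j

theorem indepFun_gain (hind : iIndepFun (Sum.elim r t) μ) (k : Fin K) : IndepFun (r k) (t k) μ :=
  hind.indepFun (i := Sum.inl k) (j := Sum.inr k) (by simp)

theorem indepFun_add_gain (hind : iIndepFun (Sum.elim r t) μ) (hr : ∀ j, Measurable (r j))
    (ht : ∀ j, Measurable (t j)) {k k' : Fin K} (hk : k' ≠ k) {φ : ℝ × ℝ → ℝ} (hφ : Measurable φ) :
    IndepFun (fun ω => r k ω + t k ω) (fun ω => φ (r k' ω, t k' ω)) μ := by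
  have h := hind.indepFun_prodMk_prodMk (measurable_sumElim hr ht) (Sum.inl k) (Sum.inr k)
    (Sum.inl k') (Sum.inr k') (by simp [hk.symm]) (by simp) (by simp) (by simp [hk.symm])
  exact h.comp (φ := fun p : ℝ × ℝ => p.1 + p.2) (ψ := φ) (by fun_prop) hφ

variable {ρ κ m v c : ℝ}
  (hind : iIndepFun (Sum.elim r t) μ) (hr : ∀ j, Measurable (r j)) (ht : ∀ j, Measurable (t j))
  (hri : ∀ j, Integrable (r j) μ) (hti : ∀ j, Integrable (t j) μ)
  (ht2 : ∀ j, Integrable (fun ω => t j ω ^ 2) μ)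
  (hrv : ∀ j, ∫ ω, r j ω ∂μ = ρ) (htv : ∀ j, ∫ ω, t j ω ∂μ = m)
  (ht2v : ∀ j, ∫ ω, t j ω ^ 2 ∂μ = m ^ 2 + v)

include hind hr ht hri hti hrv htv

theorem integral_mul_gain (k : Fin K) :
    Integrable (fun ω => r k ω * t k ω) μ ∧ ∫ ω, r k ω * t k ω ∂μ = ρ * m := by
  have h := indepFun_gain hind k
  refine ⟨h.integrable_mul (hri k) (hti k), ?_⟩
  rw [h.integral_fun_mul_eq_mul_integral (hr k).aestronglyMeasurable (ht k).aestronglyMeasurable,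
    hrv, htv]

theorem integral_add_mul_gain {k k' : Fin K} (hk : k' ≠ k) {φ : ℝ × ℝ → ℝ} (hφ : Measurable φ)
    (hφi : Integrable (fun ω => φ (r k' ω, t k' ω)) μ) :
    Integrable (fun ω => (r k ω + t k ω) * φ (r k' ω, t k' ω)) μ ∧
      ∫ ω, (r k ω + t k ω) * φ (r k' ω, t k' ω) ∂μ
        = (ρ + m) * ∫ ω, φ (r k' ω, t k' ω) ∂μ := by
  have h := indepFun_add_gain hind hr ht hk hφ
  refine ⟨h.integrable_mul ((hri k).add (hti k)) hφi, ?_⟩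
  rw [h.integral_fun_mul_eq_mul_integral ((hr k).add (ht k)).aestronglyMeasurable
    (hφ.comp ((hr k').prodMk (ht k'))).aestronglyMeasurable, integral_add (hri k) (hti k), hrv, htv]

theorem integral_add_mul_sum_gain (k : Fin K) {φ : ℝ × ℝ → ℝ} (hφ : Measurable φ) {e : ℝ}
    (hφi : ∀ j, Integrable (fun ω => φ (r j ω, t j ω)) μ)
    (hφv : ∀ j, ∫ ω, φ (r j ω, t j ω) ∂μ = e) :
    Integrable (fun ω => (r k ω + t k ω) * ∑ k' ∈ Finset.univ.erase k, φ (r k' ω, t k' ω)) μ ∧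
      ∫ ω, (r k ω + t k ω) * ∑ k' ∈ Finset.univ.erase k, φ (r k' ω, t k' ω) ∂μ
        = ((K : ℝ) - 1) * ((ρ + m) * e) := by
  have hone := fun k' (hk' : k' ∈ Finset.univ.erase k) => integral_add_mul_gain hind hr ht hri hti
    hrv htv (Finset.ne_of_mem_erase hk') hφ (hφi k')
  simp only [Finset.mul_sum]
  refine ⟨integrable_finsetSum _ fun k' hk' => (hone k' hk').1, ?_⟩
  rw [integral_finsetSum _ fun k' hk' => (hone k' hk').1,
    Finset.sum_congr rfl fun k' hk' => (hone k' hk').2.trans (by rw [hφv k'])]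
  rw [Finset.sum_const, Finset.card_erase_of_mem (Finset.mem_univ k), Finset.card_univ,
    Fintype.card_fin, nsmul_eq_mul, Nat.cast_sub (by have := k.2; omega), Nat.cast_one]

include ht2 ht2v

/-- Each of the K - 1 other pilots gives (ρ + m) m by independence. Pilot `k` gives ρ m + E t² = (ρ
+ m) m + v, so the variance occurs once. -/
theorem integral_upper (k : Fin K) :
    Integrable (fun ω => (r k ω + t k ω) / c * ∑ k', t k' ω) μ ∧
      ∫ ω, (r k ω + t k ω) / c * ∑ k', t k' ω ∂μ = (K * (ρ + m) * m + v) / c := by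
  have h1 := integral_mul_gain hind hr ht hri hti hrv htv k
  have h2 := integral_add_mul_sum_gain hind hr ht hri hti hrv htv k measurable_snd hti htv
  simp only at h2
  have hexp : ∀ ω, (r k ω + t k ω) / c * ∑ k', t k' ω
      = ((r k ω * t k ω + t k ω ^ 2)
        + (r k ω + t k ω) * ∑ k' ∈ Finset.univ.erase k, t k' ω) / c := by
    intro ω
    rw [← Finset.add_sum_erase _ _ (Finset.mem_univ k)]
    ring
  simp_rw [hexp]
  refine ⟨((h1.1.add (ht2 k)).add h2.1).div_const c, ?_⟩
  rw [integral_div, integral_add (f := fun ω => r k ω * t k ω + t k ω ^ 2)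
    (g := fun ω => (r k ω + t k ω) * ∑ k' ∈ Finset.univ.erase k, t k' ω) (h1.1.add (ht2 k)) h2.1,
    integral_add h1.1 (ht2 k), h1.2, ht2v, h2.2]
  ring

/-- The summands on the other pilots are independent of r_k + t_k, and inside each one t² is
independent of 1/r, so the first two moments of t and the means of r and 1/r suffice. -/
theorem integral_lower (hrinv : ∀ j, Integrable (fun ω => (r j ω)⁻¹) μ)
    (hrinvv : ∀ j, ∫ ω, (r j ω)⁻¹ ∂μ = κ) (k : Fin K) :
    Integrable (fun ω => r k ω * t k ω / c + (r k ω + t k ω) / c *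
      ∑ k' ∈ Finset.univ.erase k, (t k' ω - t k' ω ^ 2 / r k' ω)) μ ∧
      ∫ ω, r k ω * t k ω / c + (r k ω + t k ω) / c *
        ∑ k' ∈ Finset.univ.erase k, (t k' ω - t k' ω ^ 2 / r k' ω) ∂μ
        = (ρ * m + (K - 1) * ((ρ + m) * (m - (m ^ 2 + v) * κ))) / c := by
  have h1 := integral_mul_gain hind hr ht hri hti hrv htv k
  have hsq : ∀ j, Integrable (fun ω => t j ω ^ 2 / r j ω) μ ∧
      ∫ ω, t j ω ^ 2 / r j ω ∂μ = (m ^ 2 + v) * κ := by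
    intro j
    have h : IndepFun (fun ω => t j ω ^ 2) (fun ω => (r j ω)⁻¹) μ :=
      (indepFun_gain hind j).symm.comp (φ := fun x : ℝ => x ^ 2) (ψ := fun x : ℝ => x⁻¹)
        (by fun_prop) (by fun_prop)
    refine ⟨h.integrable_mul (ht2 j) (hrinv j), ?_⟩
    simp only [div_eq_mul_inv]
    rw [h.integral_fun_mul_eq_mul_integral ((ht j).pow_const 2).aestronglyMeasurable
      (hr j).inv.aestronglyMeasurable, ht2v, hrinvv]
  have hφ : Measurable fun p : ℝ × ℝ => p.2 - p.2 ^ 2 / p.1 := by fun_prop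
  have h2 := integral_add_mul_sum_gain hind hr ht hri hti hrv htv k hφ
    (e := m - (m ^ 2 + v) * κ) (fun j => (hti j).sub (hsq j).1)
    (fun j => by
      simp only
      rw [integral_sub (hti j) (hsq j).1, htv, (hsq j).2])
  have hexp : ∀ ω, r k ω * t k ω / c + (r k ω + t k ω) / c *
        ∑ k' ∈ Finset.univ.erase k, (t k' ω - t k' ω ^ 2 / r k' ω)
      = (r k ω * t k ω + (r k ω + t k ω) *
        ∑ k' ∈ Finset.univ.erase k, (t k' ω - t k' ω ^ 2 / r k' ω)) / c := fun ω => by ring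
  simp_rw [hexp]
  refine ⟨(h1.1.add h2.1).div_const c, ?_⟩
  rw [integral_div, integral_add h1.1 h2.1, h1.2, h2.2]

end IndependentMoments

/-! ### Mean gain and mean inverse gain of an in-cell UE. -/

section IntraCellGain

variable {A₀ d₀ γ R : ℝ}

/-- The mean gain of an intra-cell UE. -/
noncomputable def intraMean (A₀ d₀ γ R : ℝ) : ℝ :=
  A₀ * ((d₀ / R) ^ 2 + 2 * ((d₀ / R) ^ γ - (d₀ / R) ^ 2) / (2 - γ))

/-- The mean inverse gain of an intra-cell UE. -/
noncomputable def intraInvMean (A₀ d₀ γ R : ℝ) : ℝ :=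
  A₀⁻¹ * ((d₀ / R) ^ 2 + 2 * ((d₀ / R) ^ (-γ) - (d₀ / R) ^ 2) / (γ + 2))

variable {Ω : Type*} [MeasurableSpace Ω] {μ : Measure Ω} {X : Ω → Plane}
  (hA : 0 < A₀) (hd : 0 < d₀) (hdR : d₀ ≤ R) (hγ : 2 < γ) (hX : Measurable X)
  (hu : pdf.IsUniform X (Metric.closedBall (0 : Plane) R) μ volume)

include hu hX in
theorem integral_radialProfile_uniform (s : ℝ) :
    ∫ ω, radialProfile d₀ s ‖X ω‖ ∂μ = ∫ x, radialProfile d₀ s ‖x‖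
      ∂(ProbabilityTheory.cond (volume : Measure Plane) (Metric.closedBall 0 R)) := by
  have hm : Measurable fun x : Plane => radialProfile d₀ s ‖x‖ :=
    (measurable_radialProfile d₀ s).comp measurable_norm
  have h : μ.map X = ProbabilityTheory.cond volume (Metric.closedBall (0 : Plane) R) := hu
  rw [← h, integral_map hX.aemeasurable hm.aestronglyMeasurable]

include hd hdR hγ hX hu

theorem integral_intraGain : ∫ ω, pathLoss A₀ d₀ γ (X ω) ∂μ = intraMean A₀ d₀ γ R := by
  simp_rw [pathLoss_eq]
  rw [integral_const_mul, integral_radialProfile_uniform hX hu,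
    integral_cond_radialProfile hd hdR (by linarith), neg_neg, neg_add_eq_sub, intraMean]

theorem integral_intraGain_inv :
    ∫ ω, (pathLoss A₀ d₀ γ (X ω))⁻¹ ∂μ = intraInvMean A₀ d₀ γ R := by
  simp_rw [pathLoss_eq, mul_inv, radialProfile_neg_inv hd]
  rw [integral_const_mul, integral_radialProfile_uniform hX hu,
    integral_cond_radialProfile hd hdR (by linarith), intraInvMean]

omit hdR hu in
theorem integrable_intraGain [IsFiniteMeasure μ] :
    Integrable (fun ω => pathLoss A₀ d₀ γ (X ω)) μ := by
  refine Integrable.of_bound (C := |A₀|)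
    ((measurable_pathLoss A₀ d₀ γ).comp hX).aestronglyMeasurable
    (Filter.Eventually.of_forall fun ω => ?_)
  rw [pathLoss_eq, norm_mul, Real.norm_eq_abs, Real.norm_eq_abs,
    abs_of_pos (radialProfile_pos hd _ _)]
  refine mul_le_of_le_one_right (abs_nonneg _) ?_
  rw [radialProfile]
  split_ifs with h
  · exact le_rfl
  · exact Real.rpow_le_one_of_one_le_of_nonpos ((one_le_div hd).2 (not_lt.1 h)) (by linarith)

include hA in
-- The inverse gain grows without bound in the plane, but the UE is almost surely in the disk, where
-- it is at most its value at radius R.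
theorem integrable_intraGain_inv [IsFiniteMeasure μ] :
    Integrable (fun ω => (pathLoss A₀ d₀ γ (X ω))⁻¹) μ := by
  have hball : ∀ᵐ ω ∂μ, X ω ∈ Metric.closedBall (0 : Plane) R := by
    refine ae_of_ae_map hX.aemeasurable ?_
    have h : μ.map X = ProbabilityTheory.cond volume (Metric.closedBall (0 : Plane) R) := hu
    rw [h]
    exact Measure.smul_absolutelyContinuous.ae_le (ae_restrict_mem measurableSet_closedBall)
  refine Integrable.of_bound (C := A₀⁻¹ * (R / d₀) ^ γ)
    ((measurable_pathLoss A₀ d₀ γ).comp hX).inv.aestronglyMeasurable ?_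
  filter_upwards [hball] with ω hω
  have hω' : ‖X ω‖ ≤ R := by simpa using hω
  rw [pathLoss_eq, mul_inv, radialProfile_neg_inv hd, norm_mul, Real.norm_eq_abs,
    Real.norm_eq_abs, abs_of_pos (inv_pos.2 hA), abs_of_pos (radialProfile_pos hd _ _)]
  refine mul_le_mul_of_nonneg_left ?_ (inv_pos.2 hA).le
  rw [radialProfile]
  split_ifs with h
  · exact Real.one_le_rpow ((one_le_div hd).2 hdR) (by linarith)
  · exact Real.rpow_le_rpow (div_nonneg (norm_nonneg _) hd.le)
      (div_le_div_of_nonneg_right hω' hd.le) (by linarith)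

end IntraCellGain

/-! ### Algebraic simplification of the two means. -/

section ClosedForms

variable {A₀ γ l : ℝ} {M K : ℕ}

theorem upper_closedForm {d₀ R : ℝ} (hl0 : 0 < l) (hl : l = d₀ / R) (hγ : 2 < γ) (hKM : K < M) :
    ((K : ℝ) * (intraMean A₀ d₀ γ R + interMean A₀ d₀ γ R) * interMean A₀ d₀ γ R
        + interVar A₀ d₀ γ R) / ((M : ℝ) - K)
      = 2 * K * γ * l ^ (γ + 2) * A₀ ^ 2 / ((M - K) * (γ - 2) ^ 2)
        + l ^ (2 * γ) * A₀ ^ 2 / ((M - K) * (γ - 1)) := by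
  have hMK : (M : ℝ) - K ≠ 0 := (sub_pos.2 (by exact_mod_cast hKM)).ne'
  have h1 : γ - 2 ≠ 0 := by linarith
  have h2 : γ - 1 ≠ 0 := by linarith
  have h3 : 2 - γ ≠ 0 := by linarith
  rw [intraMean, interMean, interVar, ← hl, Real.rpow_add hl0, Real.rpow_two]
  have h4 : 2 - γ = -(γ - 2) := by ring
  rw [h4]
  field_simp
  ring

theorem lower_closedForm {d₀ R : ℝ} (hA : 0 < A₀) (hl0 : 0 < l) (hl : l = d₀ / R) (hγ : 2 < γ)
    (hK : 0 < K) (hKM : K < M) :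
    (intraMean A₀ d₀ γ R * interMean A₀ d₀ γ R + ((K : ℝ) - 1)
        * ((intraMean A₀ d₀ γ R + interMean A₀ d₀ γ R) * (interMean A₀ d₀ γ R
          - (interMean A₀ d₀ γ R ^ 2 + interVar A₀ d₀ γ R) * intraInvMean A₀ d₀ γ R)))
        / ((M : ℝ) - K)
      = 2 * K * γ * l ^ (γ + 2) * A₀ ^ 2 / ((M - K) * (γ - 2) ^ 2) *
        (1 - 2 * l ^ (γ - 2) / (K * γ)
          - (K - 1) / (2 * K * (γ + 2)) * (2 + γ * l ^ (γ + 2)) *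
              ((γ - 2) / (γ - 1) + 4 / (γ - 2))) := by
  have hMK : (M : ℝ) - K ≠ 0 := (sub_pos.2 (by exact_mod_cast hKM)).ne'
  have h1 : γ - 2 ≠ 0 := by linarith
  have h2 : γ - 1 ≠ 0 := by linarith
  have h5 : γ + 2 ≠ 0 := by linarith
  have h6 : γ ≠ 0 := by linarith
  have hK' : (K : ℝ) ≠ 0 := by exact_mod_cast hK.ne'
  have hp : l ^ γ ≠ 0 := (Real.rpow_pos_of_pos hl0 γ).ne'
  rw [intraMean, interMean, interVar, intraInvMean, ← hl, Real.rpow_add hl0, Real.rpow_two,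
    Real.rpow_sub hl0, Real.rpow_two, Real.rpow_neg hl0.le, mul_comm 2 γ, Real.rpow_mul hl0.le,
    Real.rpow_two]
  have h4 : 2 - γ = -(γ - 2) := by ring
  rw [h4]
  -- All powers of l are now expressed through l² and l ^ γ, so a rational identity in independent
  -- symbols remains.
  generalize l ^ γ = p at *
  field_simp
  ring

end ClosedForms

/-! ### Independence of the gains in the spatial model. -/

section SpatialModel

variable {Ω : Type*} [MeasurableSpace Ω] {μ : Measure Ω} {K : ℕ} {R lam : ℝ}
  {x : Fin K → Ω → Plane} {Φ : Fin K → Ω → Set Plane} {A₀ d₀ : ℝ}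

theorem iIndepFun_gain (h : IsSpatialModel μ R lam x Φ) (hA : 0 < A₀) (hd : 0 < d₀) (γ : ℝ) :
    iIndepFun (Sum.elim (fun j ω => pathLoss A₀ d₀ γ (x j ω))
      (fun j ω => ∑' y : Φ j ω, pathLoss A₀ d₀ γ y)) μ := by
  refine (iIndepFun_iff_iIndep _ _ _).2 (iIndep_of_iIndep_of_le h.indep ?_)
  rintro (j | j)
  · refine Measurable.comap_le ?_
    exact (measurable_pathLoss A₀ d₀ γ).comp (comap_measurable (x j))
  · refine Measurable.comap_le ?_
    have := measurable_interGain (m := pointProcessSigma (Φ j)) A₀ d₀ γ 1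
      (measurable_pointMeasure_pointProcessSigma (Φ j)) hA hd
    simp only [pow_one] at this
    exact this

end SpatialModel

/-! ### Averages over the locations and strict inequalities. -/

section SpatialMeans

variable {Ω : Type*} [MeasurableSpace Ω] {μ : Measure Ω} {M K : ℕ} {R lam A₀ d₀ γ : ℝ}
  {x : Fin K → Ω → Plane} {Φ : Fin K → Ω → Set Plane}

theorem gain_pos (hA : 0 < A₀) (hd : 0 < d₀) (γ : ℝ) (y : Fin K → Plane)
    (φ : Fin K → Set Plane) (u : UE fun j => ↥(φ j)) : 0 < gain A₀ d₀ γ y φ u := by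
  rcases u with ⟨j, _ | a⟩
  · exact pathLoss_pos hA hd γ _
  · exact pathLoss_pos hA hd γ _

variable (hA : 0 < A₀) (hd : 0 < d₀) (hdR : d₀ ≤ R) (hγ : 2 < γ)
  (hlam : lam * Real.pi * R ^ 2 = 1) (h : IsSpatialModel μ R lam x Φ)

include hA hd hdR hγ hlam h in
theorem ae_summable_gain : ∀ᵐ ω ∂μ, ∀ j,
    Summable fun y : Φ j ω => gain A₀ d₀ γ (fun j => x j ω) (fun j => Φ j ω) ⟨j, some y⟩ :=
  ae_all_iff.2 fun j => ae_summable_interGain hA hd hdR hγ hlam (h.poisson_inter j)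

include h in
theorem measurable_gain_none (j : Fin K) :
    Measurable fun ω => gain A₀ d₀ γ (fun j => x j ω) (fun j => Φ j ω) ⟨j, none⟩ :=
  (measurable_pathLoss A₀ d₀ γ).comp (h.measurable_intra j)

include hA hd h in
theorem measurable_tsum_gain_pow (j : Fin K) (n : ℕ) : Measurable fun ω => ∑' y : Φ j ω,
    gain A₀ d₀ γ (fun j => x j ω) (fun j => Φ j ω) ⟨j, some y⟩ ^ n :=
  measurable_interGain A₀ d₀ γ n (measurable_pointMeasure (h.poisson_inter j)) hA hd

include hA hd h in
theorem measurable_tsum_gain (j : Fin K) : Measurable fun ω => ∑' y : Φ j ω,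
    gain A₀ d₀ γ (fun j => x j ω) (fun j => Φ j ω) ⟨j, some y⟩ := by
  simpa only [pow_one] using measurable_tsum_gain_pow (γ := γ) hA hd h j 1

include hA hd h in
theorem measurable_alpha_gain (j : Fin K) :
    Measurable fun ω => alpha (gain A₀ d₀ γ (fun j => x j ω) (fun j => Φ j ω)) j :=
  (measurable_gain_none h j).add (measurable_tsum_gain hA hd h j)

include hA hd h in
theorem measurable_errorVar_gain_none (j : Fin K) : Measurable fun ω =>
    errorVar (gain A₀ d₀ γ (fun j => x j ω) (fun j => Φ j ω)) ⟨j, none⟩ :=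
  (measurable_gain_none h j).sub
    (((measurable_gain_none h j).pow_const 2).div (measurable_alpha_gain hA hd h j))

include hA hd hdR hγ hlam h in
-- The label set varies with ω, so measurability is read off from the closed form, which holds where
-- the outer gains are summable, hence almost everywhere.
theorem aemeasurable_intraZF (hKM : K < M) (k : Fin K) : AEMeasurable
    (fun ω => intraZF M (gain A₀ d₀ γ (fun j => x j ω) (fun j => Φ j ω)) k) μ := by
  refine ⟨_, (((measurable_alpha_gain (γ := γ) hA hd h k).div_const ((M : ℝ) - K)).mul
    (Finset.measurable_sum Finset.univ fun k' _ =>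
      measurable_errorVar_gain_none (γ := γ) hA hd h k')).ennreal_ofReal, ?_⟩
  filter_upwards [ae_summable_gain hA hd hdR hγ hlam h] with ω hω
  exact intraZF_eq (gain_pos hA hd γ _ _) hω hKM k

include hA hd hdR hγ hlam h in
theorem aemeasurable_interZF (hKM : K < M) (k : Fin K) : AEMeasurable
    (fun ω => interZF M (gain A₀ d₀ γ (fun j => x j ω) (fun j => Φ j ω)) k) μ := by
  refine ⟨_, (((measurable_alpha_gain (γ := γ) hA hd h k).div_const ((M : ℝ) - K)).mul
    (Finset.measurable_sum Finset.univ fun k' _ => (measurable_tsum_gain (γ := γ) hA hd h k').sub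
      ((measurable_tsum_gain_pow (γ := γ) hA hd h k' 2).div
        (measurable_alpha_gain (γ := γ) hA hd h k')))).ennreal_ofReal, ?_⟩
  filter_upwards [ae_summable_gain hA hd hdR hγ hlam h] with ω hω
  rw [interZF_eq (gain_pos hA hd γ _ _) hω hKM k,
    Finset.sum_congr rfl fun k' _ => tsum_errorVar (gain_pos hA hd γ _ _) hω k']
  rfl

include hA hd hdR hγ hlam h in
theorem aemeasurable_upperZF (hKM : K < M) (k : Fin K) : AEMeasurable
    (fun ω => upperZF M (gain A₀ d₀ γ (fun j => x j ω) (fun j => Φ j ω)) k) μ := by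
  refine ⟨_, (((measurable_alpha_gain (γ := γ) hA hd h k).div_const ((M : ℝ) - K)).mul
    (Finset.measurable_sum Finset.univ fun k' _ =>
      measurable_tsum_gain (γ := γ) hA hd h k')).ennreal_ofReal, ?_⟩
  filter_upwards [ae_summable_gain hA hd hdR hγ hlam h] with ω hω
  exact upperZF_eq (gain_pos hA hd γ _ _) hω hKM k

variable [IsProbabilityMeasure μ]

include hA hd hdR hγ hlam h in
theorem integral_lowerZF (k : Fin K) :
    Integrable (fun ω => lowerZF M (gain A₀ d₀ γ (fun j => x j ω) (fun j => Φ j ω)) k) μ ∧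
      ∫ ω, lowerZF M (gain A₀ d₀ γ (fun j => x j ω) (fun j => Φ j ω)) k ∂μ
        = (intraMean A₀ d₀ γ R * interMean A₀ d₀ γ R + ((K : ℝ) - 1)
        * ((intraMean A₀ d₀ γ R + interMean A₀ d₀ γ R) * (interMean A₀ d₀ γ R
          - (interMean A₀ d₀ γ R ^ 2 + interVar A₀ d₀ γ R) * intraInvMean A₀ d₀ γ R)))
        / ((M : ℝ) - K) :=
  integral_lower (iIndepFun_gain h hA hd γ)
    (measurable_gain_none h) (measurable_tsum_gain hA hd h)
    (fun j => integrable_intraGain hd hγ (h.measurable_intra j))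
    (fun j => integrable_interGain hA hd hdR hγ hlam (h.poisson_inter j))
    (fun j => integrable_interGain_sq hA hd hdR hγ hlam (h.poisson_inter j))
    (fun j => integral_intraGain hd hdR hγ (h.measurable_intra j) (h.uniform_intra j))
    (fun j => integral_interGain hA hd hdR hγ hlam (h.poisson_inter j))
    (fun j => integral_interGain_sq hA hd hdR hγ hlam (h.poisson_inter j))
    (fun j => integrable_intraGain_inv hA hd hdR hγ (h.measurable_intra j) (h.uniform_intra j))
    (fun j => integral_intraGain_inv hd hdR hγ (h.measurable_intra j) (h.uniform_intra j)) k

include hA hd hdR hγ hlam h in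
theorem integral_alpha_mul_sum_tsum (c : ℝ) (k : Fin K) :
    Integrable (fun ω => alpha (gain A₀ d₀ γ (fun j => x j ω) (fun j => Φ j ω)) k / c
        * ∑ k', ∑' y : Φ k' ω,
          gain A₀ d₀ γ (fun j => x j ω) (fun j => Φ j ω) ⟨k', some y⟩) μ ∧
      ∫ ω, alpha (gain A₀ d₀ γ (fun j => x j ω) (fun j => Φ j ω)) k / c
        * ∑ k', ∑' y : Φ k' ω,
          gain A₀ d₀ γ (fun j => x j ω) (fun j => Φ j ω) ⟨k', some y⟩ ∂μ
        = (K * (intraMean A₀ d₀ γ R + interMean A₀ d₀ γ R) * interMean A₀ d₀ γ R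
          + interVar A₀ d₀ γ R) / c :=
  integral_upper (iIndepFun_gain h hA hd γ)
    (measurable_gain_none h) (measurable_tsum_gain hA hd h)
    (fun j => integrable_intraGain hd hγ (h.measurable_intra j))
    (fun j => integrable_interGain hA hd hdR hγ hlam (h.poisson_inter j))
    (fun j => integrable_interGain_sq hA hd hdR hγ hlam (h.poisson_inter j))
    (fun j => integral_intraGain hd hdR hγ (h.measurable_intra j) (h.uniform_intra j))
    (fun j => integral_interGain hA hd hdR hγ hlam (h.poisson_inter j))
    (fun j => integral_interGain_sq hA hd hdR hγ hlam (h.poisson_inter j)) k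

include hA hd hdR hγ hlam h in
theorem lintegral_upperZF (hKM : K < M) (k : Fin K) :
    ∫⁻ ω, upperZF M (gain A₀ d₀ γ (fun j => x j ω) (fun j => Φ j ω)) k ∂μ
      = ENNReal.ofReal ((K * (intraMean A₀ d₀ γ R + interMean A₀ d₀ γ R) * interMean A₀ d₀ γ R
          + interVar A₀ d₀ γ R) / ((M : ℝ) - K)) := by
  have hMK : 0 < (M : ℝ) - K := sub_pos.2 (by exact_mod_cast hKM)
  have hu := integral_alpha_mul_sum_tsum (γ := γ) hA hd hdR hγ hlam h ((M : ℝ) - K) k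
  rw [← hu.2, ofReal_integral_eq_lintegral_ofReal hu.1]
  · refine lintegral_congr_ae ?_
    filter_upwards [ae_summable_gain hA hd hdR hγ hlam h] with ω hω
    exact upperZF_eq (gain_pos hA hd γ _ _) hω hKM k
  · refine Filter.Eventually.of_forall fun ω => ?_
    exact mul_nonneg (div_pos (alpha_pos (gain_pos hA hd γ _ _) k) hMK).le
      (Finset.sum_nonneg fun k' _ => tsum_nonneg fun y => (gain_pos hA hd γ _ _ _).le)

include hA hd hdR hγ hlam h in
-- The pointwise inequality is strict whenever pilot `k` has an outer UE, and the upper mean is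
-- finite, so strictness survives averaging.
theorem lintegral_interZF_lt_upperZF (hKM : K < M) (k : Fin K) :
    ∫⁻ ω, interZF M (gain A₀ d₀ γ (fun j => x j ω) (fun j => Φ j ω)) k ∂μ
      < ∫⁻ ω, upperZF M (gain A₀ d₀ γ (fun j => x j ω) (fun j => Φ j ω)) k ∂μ := by
  have hsum := ae_summable_gain hA hd hdR hγ hlam h
  have hle : ∀ᵐ ω ∂μ, interZF M (gain A₀ d₀ γ (fun j => x j ω) (fun j => Φ j ω)) k
      ≤ upperZF M (gain A₀ d₀ γ (fun j => x j ω) (fun j => Φ j ω)) k := by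
    filter_upwards [hsum] with ω hω
    exact interZF_le_upperZF (gain_pos hA hd γ _ _) hω hKM k
  refine lintegral_strict_mono_of_ae_le_of_ae_lt_on
    (aemeasurable_upperZF hA hd hdR hγ hlam h hKM k)
    (ne_top_of_le_ne_top ?_ (lintegral_mono_ae hle)) hle (measure_two_points_ne_zero (hd.trans_le hdR) hlam (h.poisson_inter k)) ?_
  · rw [lintegral_upperZF hA hd hdR hγ hlam h hKM k]
    exact ENNReal.ofReal_ne_top
  · filter_upwards [hsum] with ω hω
    rintro ⟨a, -, -⟩
    exact interZF_lt_upperZF (gain_pos hA hd γ _ _) hω hKM (k := k) a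

include hA hd hdR hγ hlam h in
theorem lintegral_intraZF_lt_interZF (hKM : K < M) (k : Fin K) :
    ∫⁻ ω, intraZF M (gain A₀ d₀ γ (fun j => x j ω) (fun j => Φ j ω)) k ∂μ
      < ∫⁻ ω, interZF M (gain A₀ d₀ γ (fun j => x j ω) (fun j => Φ j ω)) k ∂μ := by
  have hsum := ae_summable_gain hA hd hdR hγ hlam h
  have hle : ∀ᵐ ω ∂μ, intraZF M (gain A₀ d₀ γ (fun j => x j ω) (fun j => Φ j ω)) k
      ≤ interZF M (gain A₀ d₀ γ (fun j => x j ω) (fun j => Φ j ω)) k := by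
    filter_upwards [hsum] with ω hω
    exact intraZF_le_interZF (gain_pos hA hd γ _ _) hω hKM k
  refine lintegral_strict_mono_of_ae_le_of_ae_lt_on
    (aemeasurable_interZF hA hd hdR hγ hlam h hKM k) (ne_top_of_le_ne_top
      (lintegral_interZF_lt_upperZF hA hd hdR hγ hlam h hKM k).ne_top (lintegral_mono_ae hle))
    hle (measure_two_points_ne_zero (hd.trans_le hdR) hlam (h.poisson_inter k)) ?_
  filter_upwards [hsum] with ω hω
  rintro ⟨a, b, hab⟩
  exact intraZF_lt_interZF (gain_pos hA hd γ _ _) hω hKM (k := k) hab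

include hA hd hdR hγ hlam h in
-- The lower variable may be negative and is averaged by a Bochner integral; this puts the
-- intra-cell mean, finite by the chain above it, in the same form.
theorem integral_toReal_intraZF (hKM : K < M) (k : Fin K) :
    Integrable (fun ω => alpha (gain A₀ d₀ γ (fun j => x j ω) (fun j => Φ j ω)) k / ((M : ℝ) - K)
        * ∑ k', errorVar (gain A₀ d₀ γ (fun j => x j ω) (fun j => Φ j ω)) ⟨k', none⟩) μ ∧
      (∫⁻ ω, intraZF M (gain A₀ d₀ γ (fun j => x j ω) (fun j => Φ j ω)) k ∂μ).toReal
        = ∫ ω, alpha (gain A₀ d₀ γ (fun j => x j ω) (fun j => Φ j ω)) k / ((M : ℝ) - K)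
          * ∑ k', errorVar (gain A₀ d₀ γ (fun j => x j ω) (fun j => Φ j ω)) ⟨k', none⟩ ∂μ := by
  have hMK : 0 < (M : ℝ) - K := sub_pos.2 (by exact_mod_cast hKM)
  have hm := aemeasurable_intraZF hA hd hdR hγ hlam h hKM k
  have hfin := (lintegral_intraZF_lt_interZF hA hd hdR hγ hlam h hKM k).ne_top
  have hae : (fun ω => (intraZF M (gain A₀ d₀ γ (fun j => x j ω) (fun j => Φ j ω)) k).toReal)
      =ᵐ[μ] fun ω => alpha (gain A₀ d₀ γ (fun j => x j ω) (fun j => Φ j ω)) k / ((M : ℝ) - K)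
        * ∑ k', errorVar (gain A₀ d₀ γ (fun j => x j ω) (fun j => Φ j ω)) ⟨k', none⟩ := by
    filter_upwards [ae_summable_gain hA hd hdR hγ hlam h] with ω hω
    have hβ := gain_pos hA hd γ (fun j => x j ω) (fun j => Φ j ω)
    rw [intraZF_eq hβ hω hKM k, ENNReal.toReal_ofReal]
    exact mul_nonneg (div_pos (alpha_pos hβ k) hMK).le
      (Finset.sum_nonneg fun k' _ => errorVar_nonneg hβ hω _)
  refine ⟨(integrable_toReal_of_lintegral_ne_top hm hfin).congr hae, ?_⟩
  rw [← integral_congr_ae hae, integral_toReal hm (ae_lt_top' hm hfin)]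

include hA hd hdR hγ hlam h in
theorem integral_lowerZF_le (hKM : K < M) (k : Fin K) :
    ∫ ω, lowerZF M (gain A₀ d₀ γ (fun j => x j ω) (fun j => Φ j ω)) k ∂μ
      ≤ (∫⁻ ω, intraZF M (gain A₀ d₀ γ (fun j => x j ω) (fun j => Φ j ω)) k ∂μ).toReal := by
  have hi := integral_toReal_intraZF hA hd hdR hγ hlam h hKM k
  rw [hi.2]
  exact integral_mono (integral_lowerZF hA hd hdR hγ hlam h k).1 hi.1
    fun ω => lowerZF_le (gain_pos hA hd γ _ _) hKM k

include hA hd hdR hγ hlam h in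
theorem integral_lowerZF_lt (hKM : K < M) {k k' : Fin K} (hk : k' ≠ k) :
    ∫ ω, lowerZF M (gain A₀ d₀ γ (fun j => x j ω) (fun j => Φ j ω)) k ∂μ
      < (∫⁻ ω, intraZF M (gain A₀ d₀ γ (fun j => x j ω) (fun j => Φ j ω)) k ∂μ).toReal := by
  have hi := integral_toReal_intraZF hA hd hdR hγ hlam h hKM k
  have hl := (integral_lowerZF (M := M) hA hd hdR hγ hlam h k).1
  rw [hi.2, ← sub_pos, ← integral_sub hi.1 hl,
    integral_pos_iff_support_of_nonneg
      (fun ω => sub_nonneg.2 (lowerZF_le (gain_pos hA hd γ _ _) hKM k)) (hi.1.sub hl)]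
  -- If the gap vanished almost surely, then almost surely pilot k' would not have two outer UEs.
  refine pos_iff_ne_zero.2 fun h0 =>
    measure_two_points_ne_zero (hd.trans_le hdR) hlam (h.poisson_inter k') ?_
  refine measure_mono_null_ae ?_ h0
  filter_upwards [ae_summable_gain hA hd hdR hγ hlam h] with ω hω
  rintro ⟨a, -, -⟩
  have hβ := gain_pos hA hd γ (fun j => x j ω) (fun j => Φ j ω)
  exact (sub_pos.2 (lowerZF_lt hβ hKM hk ((hω k').tsum_pos (fun y => (hβ _).le) a (hβ _)))).ne'

end SpatialMeans

end UplinkMIMO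

/-! ### The main theorem. -/

theorem proposition5 {Ω : Type*} [MeasurableSpace Ω] (μ : Measure Ω) [IsProbabilityMeasure μ]
    (M K : ℕ) (hKM : K < M) (k : Fin K)
    (A₀ d₀ γ R lam l : ℝ) (hA₀ : 0 < A₀) (hd₀ : 0 < d₀) (hdR : d₀ ≤ R) (hγ : 2 < γ)
    (hlam : lam * Real.pi * R ^ 2 = 1) (hl : l = d₀ / R)
    (x : Fin K → Ω → UplinkMIMO.Plane) (Φ : Fin K → Ω → Set UplinkMIMO.Plane)
    (hmodel : UplinkMIMO.IsSpatialModel μ R lam x Φ)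
    (β : ∀ ω, UplinkMIMO.UE (fun j => ↥(Φ j ω)) → ℝ)
    (hβ : ∀ ω, β ω = UplinkMIMO.gain A₀ d₀ γ (fun j => x j ω) (fun j => Φ j ω))
    (lower upper : ℝ)
    (hlower : lower =
      2 * K * γ * l ^ (γ + 2) * A₀ ^ 2 / ((M - K) * (γ - 2) ^ 2) *
        (1 - 2 * l ^ (γ - 2) / (K * γ)
          - (K - 1) / (2 * K * (γ + 2)) * (2 + γ * l ^ (γ + 2)) *
              ((γ - 2) / (γ - 1) + 4 / (γ - 2))))
    (hupper : upper =
      2 * K * γ * l ^ (γ + 2) * A₀ ^ 2 / ((M - K) * (γ - 2) ^ 2)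
        + l ^ (2 * γ) * A₀ ^ 2 / ((M - K) * (γ - 1))) :
    -- the interference powers are random variables
    AEMeasurable (fun ω => UplinkMIMO.intraZF M (β ω) k) μ ∧
    AEMeasurable (fun ω => UplinkMIMO.interZF M (β ω) k) μ ∧
    AEMeasurable (fun ω => UplinkMIMO.upperZF M (β ω) k) μ ∧
    -- the means of the two bounding random variables
    Integrable (fun ω => UplinkMIMO.lowerZF M (β ω) k) μ ∧
    ∫ ω, UplinkMIMO.lowerZF M (β ω) k ∂μ = lower ∧
    ∫⁻ ω, UplinkMIMO.upperZF M (β ω) k ∂μ = ENNReal.ofReal upper ∧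
    -- they bound the mean intra-cell and inter-cell interference powers
    lower ≤ (∫⁻ ω, UplinkMIMO.intraZF M (β ω) k ∂μ).toReal ∧
    (2 ≤ K → lower < (∫⁻ ω, UplinkMIMO.intraZF M (β ω) k ∂μ).toReal) ∧
    ∫⁻ ω, UplinkMIMO.intraZF M (β ω) k ∂μ < ∫⁻ ω, UplinkMIMO.interZF M (β ω) k ∂μ ∧
    ∫⁻ ω, UplinkMIMO.interZF M (β ω) k ∂μ < ENNReal.ofReal upper := by
  open UplinkMIMO in
  have hl0 : 0 < l := hl ▸ div_pos hd₀ (hd₀.trans_le hdR)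
  have hβ' : β = fun ω => gain A₀ d₀ γ (fun j => x j ω) (fun j => Φ j ω) := funext hβ
  subst hβ'
  have hL := integral_lowerZF (M := M) hA₀ hd₀ hdR hγ hlam hmodel k
  rw [lower_closedForm hA₀ hl0 hl hγ (Fin.pos k) hKM, ← hlower] at hL
  have hU := lintegral_upperZF hA₀ hd₀ hdR hγ hlam hmodel hKM k
  rw [upper_closedForm hl0 hl hγ hKM, ← hupper] at hU
  refine ⟨aemeasurable_intraZF hA₀ hd₀ hdR hγ hlam hmodel hKM k,
    aemeasurable_interZF hA₀ hd₀ hdR hγ hlam hmodel hKM k,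
    aemeasurable_upperZF hA₀ hd₀ hdR hγ hlam hmodel hKM k, hL.1, hL.2, hU, ?_, fun hK => ?_,
    lintegral_intraZF_lt_interZF hA₀ hd₀ hdR hγ hlam hmodel hKM k, ?_⟩
  · rw [← hL.2]
    exact integral_lowerZF_le hA₀ hd₀ hdR hγ hlam hmodel hKM k
  · have : Nontrivial (Fin K) := Fin.nontrivial_iff_two_le.2 hK
    obtain ⟨k', hk'⟩ := exists_ne k
    rw [← hL.2]
    exact integral_lowerZF_lt hA₀ hd₀ hdR hγ hlam hmodel hKM hk'
  · rw [← hU]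
    exact lintegral_interZF_lt_upperZF hA₀ hd₀ hdR hγ hlam hmodel hKM k
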